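/- **Theorem (Global sections of $\mathcal T_{\mathcal M}$).** Work in the complex analytic category. Let $0\neq\omega\in H^1(\mathbb P^2,\mathcal T_{\mathbb P^2}(-3))$ and let $\mathcal M=\mathbb P^2_\omega(\mathcal F_{\mathcal M})$ be the non-projected complex supermanifold of dimension $2|2$ over $\mathbb P^2$ with fermionic sheaf $\mathcal F_{\mathcal M}=\Pi\mathcal O_{\mathbb P^2}(-1)\oplus\Pi\mathcal O_{\mathbb P^2}(-2)$ (so that $Sym^2\mathcal F_{\mathcal M}\cong\mathcal O_{\mathbb P^2}(-3)$) and characteristic class $\omega$. Explicitly, if $(\omega_{ij})$ is any Čech cocycle representing $\omega$ with respect to the standard affine cover $\{U_0,U_1,U_2\}$ of $\mathbb P^2$, each $\omega_{ij}$ being regarded as a derivation $\mathcal O_{\mathbb P^2}\to\mathcal O_{\mathbb P^2}(-3)$ over $U_i\cap U_j$, then the structure sheaf $\mathcal O_{\mathcal M}$ is obtained by gluing the sheaves of superalgebras $$\mathcal O_{U_i}\oplus\mathcal O_{U_i}(-1)\,\theta_1\oplus\mathcal O_{U_i}(-2)\,\theta_2\oplus\mathcal O_{U_i}(-3)\,\theta_1\theta_2$$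 over $U_i\cap U_j$ along the automorphisms $f\mapsto f+\omega_{ij}(f)\,\theta_1\theta_2$ for $f\in\mathcal O_{\mathbb P^2}$, which fix the odd part and $\mathcal O(-3)\,\theta_1\theta_2$. Let $\mathcal T_{\mathcal M}$ be the tangent sheaf of $\mathcal M$, that is, the sheaf of $\mathbb C$-linear superderivations of $\mathcal O_{\mathcal M}$. Then $\mathcal T_{\mathcal M}$ has exactly $12|12$ global sections: the even part and the odd part of the complex super vector space $H^0(\mathcal T_{\mathcal M})$ both have dimension $12$. -/

import Mathlib

open TopologicalSpace

namespace SuperP2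

noncomputable section

/-! ### The projective plane and its line bundles -/

/-- The complex projective plane, the space of lines in `ℂ³`. -/
abbrev P2 : Type := Projectivization ℂ (Fin 3 → ℂ)

/-- The quotient topology from `ℂ³ \ {0}`. -/
instance : TopologicalSpace P2 :=
  TopologicalSpace.coinduced
    (fun x : {x : Fin 3 → ℂ // x ≠ 0} => Projectivization.mk ℂ x.1 x.2) inferInstance

/-- The standard affine chart `X_i ≠ 0`. -/
def chart (i : Fin 3) : Opens P2 where
  carrier := {p | p.rep i ≠ 0}
  is_open' := by
    rw [isOpen_coinduced]
    have : (fun x : {x : Fin 3 → ℂ // x ≠ 0} => Projectivization.mk ℂ x.1 x.2) ⁻¹'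
        {p | p.rep i ≠ 0} = {x | x.1 i ≠ 0} := by
      ext x
      obtain ⟨a, ha⟩ := Projectivization.exists_smul_eq_mk_rep ℂ x.1 x.2
      simp only [Set.mem_preimage, Set.mem_ofPred_eq, ← ha, Pi.smul_apply]
      simp [Units.smul_def]
    rw [this]
    exact isOpen_ne_fun ((continuous_apply i).comp continuous_subtype_val) continuous_const

/-- The open cone in `ℂ³ \ {0}` of all nonzero vectors that span a line in `U`. -/
def cone (U : Opens P2) : Set (Fin 3 → ℂ) :=
  {x | ∃ h : x ≠ 0, Projectivization.mk ℂ x h ∈ U}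

theorem cone_mono {U V : Opens P2} (h : V ≤ U) : cone V ⊆ cone U :=
  fun _ hx => ⟨hx.1, h hx.2⟩

/-- The space `𝒪(k)(U)`: the holomorphic functions on the cone over `U` that are homogeneous of
degree `k`. For `k = 0` these are the holomorphic functions on `U`. -/
def OSubmodule (k : ℤ) (U : Opens P2) : Submodule ℂ (cone U → ℂ) where
  carrier := {f | (∃ F : (Fin 3 → ℂ) → ℂ, DifferentiableOn ℂ F (cone U) ∧ ∀ x : cone U, f x = F x) ∧
    ∀ (t : ℂ) (x y : cone U), t ≠ 0 → (y : Fin 3 → ℂ) = t • (x : Fin 3 → ℂ) → f y = t ^ k * f x}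
  zero_mem' := ⟨⟨0, differentiableOn_const 0, fun _ => rfl⟩, by simp⟩
  add_mem' := by
    rintro f g ⟨⟨F, hF, hf⟩, hf'⟩ ⟨⟨G, hG, hg⟩, hg'⟩
    refine ⟨⟨F + G, hF.add hG, fun x => by simp [hf, hg]⟩, fun t x y ht hxy => ?_⟩
    simp only [Pi.add_apply, hf' t x y ht hxy, hg' t x y ht hxy, mul_add]
  smul_mem' := by
    rintro a f ⟨⟨F, hF, hf⟩, hf'⟩
    refine ⟨⟨a • F, hF.const_smul a, fun x => by simp [hf]⟩, fun t x y ht hxy => ?_⟩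
    simp only [Pi.smul_apply, hf' t x y ht hxy, smul_eq_mul]
    ring

/-- The space `𝒪(k)(U)`. -/
def O (k : ℤ) (U : Opens P2) : Type := OSubmodule k U

instance (k : ℤ) (U : Opens P2) : AddCommGroup (O k U) :=
  inferInstanceAs (AddCommGroup (OSubmodule k U))

instance (k : ℤ) (U : Opens P2) : Module ℂ (O k U) :=
  inferInstanceAs (Module ℂ (OSubmodule k U))

namespace O

variable {k : ℤ} {U : Opens P2}

@[ext]
theorem ext {f g : O k U} (h : ∀ x, f.1 x = g.1 x) : f = g := Subtype.ext (funext h)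

@[simp]
theorem zero_apply (x : cone U) : (0 : O k U).1 x = 0 := rfl

@[simp]
theorem add_apply (f g : O k U) (x : cone U) : (f + g).1 x = f.1 x + g.1 x := rfl

@[simp]
theorem sub_apply (f g : O k U) (x : cone U) : (f - g).1 x = f.1 x - g.1 x := rfl

@[simp]
theorem smul_apply (a : ℂ) (f : O k U) (x : cone U) : (a • f).1 x = a * f.1 x := rfl

end O

/-- Restriction of sections of `𝒪(k)`. -/
def O.res {k : ℤ} {U V : Opens P2} (h : V ≤ U) : O k U →ₗ[ℂ] O k V where
  toFun f := ⟨fun x => f.1 ⟨x.1, cone_mono h x.2⟩, by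
    obtain ⟨f, ⟨F, hF, hf⟩, hf'⟩ := f
    exact ⟨⟨F, hF.mono (cone_mono h), fun x => hf _⟩, fun t x y ht hxy => hf' t _ _ ht hxy⟩⟩
  map_add' _ _ := rfl
  map_smul' _ _ := rfl

/-- Multiplication `𝒪(k) × 𝒪(l) → 𝒪(m)`, `m = k + l`. -/
def O.mul {k l m : ℤ} (h : k + l = m) {U : Opens P2} (f : O k U) (g : O l U) : O m U :=
  ⟨f.1 * g.1, by
    obtain ⟨f, ⟨F, hF, hf⟩, hf'⟩ := f
    obtain ⟨g, ⟨G, hG, hg⟩, hg'⟩ := g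
    refine ⟨⟨F * G, hF.mul hG, fun x => by simp [hf, hg]⟩, fun t x y ht hxy => ?_⟩
    simp only [Pi.mul_apply, hf' t x y ht hxy, hg' t x y ht hxy, ← h, zpow_add₀ ht]
    ring⟩

@[simp]
theorem O.res_apply {k : ℤ} {U V : Opens P2} (h : V ≤ U) (f : O k U) (x : cone V) :
    (O.res h f).1 x = f.1 ⟨x.1, cone_mono h x.2⟩ := rfl

@[simp]
theorem O.mul_apply {k l m : ℤ} (h : k + l = m) {U : Opens P2} (f : O k U) (g : O l U)
    (x : cone U) : (O.mul h f g).1 x = f.1 x * g.1 x := rfl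

/-- The constant function `1`. -/
def O.one (U : Opens P2) : O 0 U :=
  ⟨1, ⟨⟨1, differentiableOn_const 1, fun _ => rfl⟩, by simp⟩⟩

@[simp]
theorem O.one_apply (U : Opens P2) (x : cone U) : (O.one U).1 x = 1 := rfl

/-! ### Twisted tangent sheaves and the first cohomology of `𝒯(k)` -/

/-- The space `𝒯_{ℙ²}(k)(W)` of sections of `𝒯_{ℙ²} ⊗ 𝒪(k)`, as the space of derivations of sheaves from
`𝒪_{ℙ²}` to `𝒪(k)` over `W`: families of linear maps `𝒪(V) → 𝒪(k)(V)`, `V ⊆ W` open, that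
commute with restrictions and satisfy the Leibniz rule. -/
def TSubmodule (k : ℤ) (W : Opens P2) : Submodule ℂ (∀ V : Set.Iic W, O 0 V.1 →ₗ[ℂ] O k V.1) where
  carrier := {D |
    (∀ (V V' : Set.Iic W) (h : V'.1 ≤ V.1) (f : O 0 V.1),
      D V' (O.res h f) = O.res h (D V f)) ∧
    ∀ (V : Set.Iic W) (f g : O 0 V.1),
      D V (O.mul (add_zero 0) f g) =
        O.mul (zero_add k) f (D V g) + O.mul (zero_add k) g (D V f)}
  zero_mem' := by
    refine ⟨fun V V' h f => by simp, fun V f g => ?_⟩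
    ext x
    simp
  add_mem' := by
    rintro D E ⟨hD, hD'⟩ ⟨hE, hE'⟩
    refine ⟨fun V V' h f => by simp [hD V V' h, hE V V' h], fun V f g => ?_⟩
    ext x
    simp only [Pi.add_apply, LinearMap.add_apply, hD', hE']
    simp
    ring
  smul_mem' := by
    rintro a D ⟨hD, hD'⟩
    refine ⟨fun V V' h f => by simp [hD V V' h], fun V f g => ?_⟩
    ext x
    simp only [Pi.smul_apply, LinearMap.smul_apply, hD']
    simp
    ring

/-- The space `𝒯_{ℙ²}(k)(W)`. -/
def T (k : ℤ) (W : Opens P2) : Type := TSubmodule k W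

instance (k : ℤ) (W : Opens P2) : AddCommGroup (T k W) :=
  inferInstanceAs (AddCommGroup (TSubmodule k W))

instance (k : ℤ) (W : Opens P2) : Module ℂ (T k W) :=
  inferInstanceAs (Module ℂ (TSubmodule k W))

/-- Restriction of sections of `𝒯_{ℙ²}(k)`. -/
def T.res {k : ℤ} {W W' : Opens P2} (h : W' ≤ W) : T k W →ₗ[ℂ] T k W' where
  toFun D := ⟨fun V => D.1 ⟨V.1, le_trans V.2 h⟩,
    fun V V' h' f => D.2.1 ⟨V.1, le_trans V.2 h⟩ ⟨V'.1, le_trans V'.2 h⟩ h' f,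
    fun V => D.2.2 ⟨V.1, le_trans V.2 h⟩⟩
  map_add' _ _ := rfl
  map_smul' _ _ := rfl

/-- The first Čech differential `(η_i) ↦ (η_j - η_i)` of `𝒯_{ℙ²}(k)` for the standard cover. -/
def cechD0 (k : ℤ) : (∀ i, T k (chart i)) →ₗ[ℂ] ∀ i j, T k (chart i ⊓ chart j) where
  toFun η i j := T.res inf_le_right (η j) - T.res inf_le_left (η i)
  map_add' η ξ := by
    ext1 i; ext1 j
    simp only [Pi.add_apply, map_add]
    abel
  map_smul' a η := by
    ext1 i; ext1 j
    simp only [Pi.smul_apply, map_smul, smul_sub, RingHom.id_apply]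

/-- The second Čech differential `(ω_ij) ↦ (ω_jl - ω_il + ω_ij)`. -/
def cechD1 (k : ℤ) : (∀ i j, T k (chart i ⊓ chart j)) →ₗ[ℂ]
    ∀ i j l, T k (chart i ⊓ chart j ⊓ chart l) where
  toFun ω i j l :=
    T.res (inf_le_inf_right _ inf_le_right) (ω j l)
      - T.res (inf_le_inf_right _ inf_le_left) (ω i l) + T.res inf_le_left (ω i j)
  map_add' ω υ := by
    ext1 i; ext1 j; ext1 l
    simp only [Pi.add_apply, map_add]
    abel
  map_smul' a ω := by
    ext1 i; ext1 j; ext1 l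
    simp only [Pi.smul_apply, map_smul, smul_sub, smul_add, RingHom.id_apply]

/-- Čech 1-cocycles of `𝒯_{ℙ²}(k)` for the standard cover. -/
def Z1 (k : ℤ) : Submodule ℂ (∀ i j, T k (chart i ⊓ chart j)) := LinearMap.ker (cechD1 k)

/-- `H¹(ℙ², 𝒯_{ℙ²}(k))`, as Čech cohomology of the standard cover (a Leray cover, since all
its finite intersections are Stein). -/
abbrev H1 (k : ℤ) : Type :=
  Z1 k ⧸ (LinearMap.range (cechD0 k)).submoduleOf (Z1 k)

/-- The cohomology class of a cocycle. -/
def H1.mk {k : ℤ} (ω : Z1 k) : H1 k := Submodule.Quotient.mk ω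

/-! ### The supermanifold `ℙ²_ω(Π𝒪(-1) ⊕ Π𝒪(-2))` -/

/-- The sections over `U` of the structure sheaf of `ℙ²_ω(Π𝒪(-1) ⊕ Π𝒪(-2))`.

Over the chart `U_i` the supermanifold is the local model
`Λ(𝒪(-1) ⊕ 𝒪(-2)) = 𝒪 ⊕ 𝒪(-1) θ₁ ⊕ 𝒪(-2) θ₂ ⊕ 𝒪(-3) θ₁θ₂`, and over `U_i ∩ U_j` the local models
are glued by the automorphism `f ↦ f + ω_ij(f) θ₁θ₂`, `θ₁ ↦ θ₁`, `θ₂ ↦ θ₂`. Here `θ₁`, `θ₂` are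
formal symbols, and `1 / X_i`, `1 / X_i²` times them are the odd coordinates over `U_i`. So a
section over `U` consists of `f ∈ 𝒪(U)`, `b₁ ∈ 𝒪(-1)(U)`, `b₂ ∈ 𝒪(-2)(U)` and, for each `i`, an
element `c_i ∈ 𝒪(-3)(U ∩ U_i)` with `c_j - c_i = ω_ij(f)` over `U ∩ U_i ∩ U_j`; it is
`f + b₁ θ₁ + b₂ θ₂ + c_i θ₁θ₂` in the local model over `U ∩ U_i`. -/
def OMSubmodule (ω : Z1 (-3)) (U : Opens P2) :
    Submodule ℂ (O 0 U × O (-1) U × O (-2) U × ∀ i, O (-3) (U ⊓ chart i)) where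
  carrier := {s | ∀ i j,
    O.res (inf_le_inf_left U inf_le_right) (s.2.2.2 j)
      - O.res (inf_le_inf_left U inf_le_left) (s.2.2.2 i)
    = (ω.1 i j).1 ⟨U ⊓ (chart i ⊓ chart j), Set.mem_Iic.2 inf_le_right⟩ (O.res inf_le_left s.1)}
  zero_mem' := by intro i j; simp
  add_mem' := by
    intro s t hs ht i j
    have := congrArg₂ (· + ·) (hs i j) (ht i j)
    simp only [Prod.fst_add, Prod.snd_add, Pi.add_apply, map_add] at this ⊢
    rw [← this]
    abel
  smul_mem' := by
    intro a s hs i j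
    have := congrArg (a • ·) (hs i j)
    simp only [Prod.smul_fst, Prod.smul_snd, Pi.smul_apply, map_smul] at this ⊢
    rw [← this, smul_sub]

theorem mem_OMSubmodule {ω : Z1 (-3)} {U : Opens P2}
    {s : O 0 U × O (-1) U × O (-2) U × ∀ i, O (-3) (U ⊓ chart i)} :
    s ∈ OMSubmodule ω U ↔ ∀ i j,
      O.res (inf_le_inf_left U inf_le_right) (s.2.2.2 j)
        - O.res (inf_le_inf_left U inf_le_left) (s.2.2.2 i)
      = (ω.1 i j).1 ⟨U ⊓ (chart i ⊓ chart j), Set.mem_Iic.2 inf_le_right⟩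
          (O.res inf_le_left s.1) := Iff.rfl

/-- The sections over `U` of the structure sheaf of `ℙ²_ω(Π𝒪(-1) ⊕ Π𝒪(-2))`. -/
def OM (ω : Z1 (-3)) (U : Opens P2) : Type := OMSubmodule ω U

namespace OM

instance (ω : Z1 (-3)) (U : Opens P2) : AddCommGroup (OM ω U) :=
  inferInstanceAs (AddCommGroup (OMSubmodule ω U))

instance (ω : Z1 (-3)) (U : Opens P2) : Module ℂ (OM ω U) :=
  inferInstanceAs (Module ℂ (OMSubmodule ω U))

variable {ω : Z1 (-3)} {U V : Opens P2}

/-- The component `f`. -/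
abbrev f (s : OM ω U) : O 0 U := s.1.1

/-- The coefficient `b₁` of `θ₁`. -/
abbrev b₁ (s : OM ω U) : O (-1) U := s.1.2.1

/-- The coefficient `b₂` of `θ₂`. -/
abbrev b₂ (s : OM ω U) : O (-2) U := s.1.2.2.1

/-- The coefficient `c_i` of `θ₁θ₂` over `U ∩ U_i`. -/
abbrev c (s : OM ω U) (i : Fin 3) : O (-3) (U ⊓ chart i) := s.1.2.2.2 i

/-- Restriction of superfunctions. -/
def res (h : V ≤ U) : OM ω U →ₗ[ℂ] OM ω V where
  toFun s := ⟨(O.res h s.f, O.res h s.b₁, O.res h s.b₂,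
      fun i => O.res (inf_le_inf_right _ h) (s.c i)), by
    rw [mem_OMSubmodule]
    intro i j
    have := congrArg (O.res (inf_le_inf_right (chart i ⊓ chart j) h)) (s.2 i j)
    rw [← (ω.1 i j).2.1 ⟨U ⊓ (chart i ⊓ chart j), Set.mem_Iic.2 inf_le_right⟩
      ⟨V ⊓ (chart i ⊓ chart j), Set.mem_Iic.2 inf_le_right⟩] at this
    exact this⟩
  map_add' _ _ := rfl
  map_smul' _ _ := rfl

/-- The product `(f + b₁θ₁ + b₂θ₂ + cθ₁θ₂) (f' + b₁'θ₁ + b₂'θ₂ + c'θ₁θ₂)`, where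
`θ₁θ₂ = -θ₂θ₁` and `θ₁² = θ₂² = 0`. -/
instance : Mul (OM ω U) where
  mul s t := ⟨(O.mul (by norm_num) s.f t.f,
      O.mul (by norm_num) s.f t.b₁ + O.mul (by norm_num) s.b₁ t.f,
      O.mul (by norm_num) s.f t.b₂ + O.mul (by norm_num) s.b₂ t.f,
      fun i =>
        O.mul (zero_add (-3)) (O.res inf_le_left s.f) (t.c i)
        + O.mul (add_zero (-3)) (s.c i) (O.res inf_le_left t.f)
        + O.res inf_le_left
          (O.mul (by norm_num) s.b₁ t.b₂ - O.mul (by norm_num) s.b₂ t.b₁)), by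
    rw [mem_OMSubmodule]
    intro i j
    have hs := s.2 i j
    have ht := t.2 i j
    have hm := (ω.1 i j).2.2 ⟨U ⊓ (chart i ⊓ chart j), Set.mem_Iic.2 inf_le_right⟩
      (O.res inf_le_left s.f) (O.res inf_le_left t.f)
    rw [← hs, ← ht] at hm
    refine Eq.trans ?_ hm.symm
    ext x
    simp
    ring⟩

instance : One (OM ω U) where
  one := ⟨(O.one U, 0, 0, 0), by
    rw [mem_OMSubmodule]
    intro i j
    have h := (ω.1 i j).2.2 ⟨U ⊓ (chart i ⊓ chart j), Set.mem_Iic.2 inf_le_right⟩ (O.one _) (O.one _)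
    have e : O.mul (add_zero 0) (O.one (U ⊓ (chart i ⊓ chart j))) (O.one _) = O.one _ := by
      ext x; simp
    have e' : ∀ g : O (-3) (U ⊓ (chart i ⊓ chart j)), O.mul (zero_add (-3)) (O.one _) g = g := by
      intro g; ext x; simp
    rw [e, e'] at h
    have h0 := left_eq_add.mp h
    simp only [Pi.zero_apply, map_zero, sub_zero]
    exact h0.symm⟩

@[ext]
theorem ext {s t : OM ω U} (hf : s.f = t.f) (h₁ : s.b₁ = t.b₁) (h₂ : s.b₂ = t.b₂)
    (hc : s.c = t.c) : s = t :=
  Subtype.ext (Prod.ext hf (Prod.ext h₁ (Prod.ext h₂ hc)))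

theorem val_add (s t : OM ω U) : (s + t).1 = s.1 + t.1 := rfl

theorem val_zero : (0 : OM ω U).1 = 0 := rfl

theorem val_smul (a : ℂ) (s : OM ω U) : (a • s).1 = a • s.1 := rfl

theorem val_mul (s t : OM ω U) : (s * t).1 = (O.mul (by norm_num) s.f t.f,
      O.mul (by norm_num) s.f t.b₁ + O.mul (by norm_num) s.b₁ t.f,
      O.mul (by norm_num) s.f t.b₂ + O.mul (by norm_num) s.b₂ t.f,
      fun i =>
        O.mul (zero_add (-3)) (O.res inf_le_left s.f) (t.c i)
        + O.mul (add_zero (-3)) (s.c i) (O.res inf_le_left t.f)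
        + O.res inf_le_left
          (O.mul (by norm_num) s.b₁ t.b₂ - O.mul (by norm_num) s.b₂ t.b₁)) := rfl

theorem val_one : (1 : OM ω U).1 = (O.one U, 0, 0, 0) := rfl

/-- The structure sheaf is a sheaf of rings. -/
instance : Ring (OM ω U) where
  __ := (inferInstance : AddCommGroup (OM ω U))
  left_distrib s t u := by
    ext <;> simp [f, b₁, b₂, c, val_mul, val_add] <;> ring
  right_distrib s t u := by
    ext <;> simp [f, b₁, b₂, c, val_mul, val_add] <;> ring
  zero_mul s := by ext <;> simp [f, b₁, b₂, c, val_mul, val_zero]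
  mul_zero s := by ext <;> simp [f, b₁, b₂, c, val_mul, val_zero]
  mul_assoc s t u := by
    ext <;> simp [f, b₁, b₂, c, val_mul] <;> ring
  one_mul s := by ext <;> simp [f, b₁, b₂, c, val_mul, val_one]
  mul_one s := by ext <;> simp [f, b₁, b₂, c, val_mul, val_one]

/-- The structure sheaf is a sheaf of `ℂ`-algebras. -/
instance : Algebra ℂ (OM ω U) :=
  Algebra.ofModule
    (fun a s t => by ext <;> simp [f, b₁, b₂, c, val_mul, val_smul] <;> ring)
    (fun a s t => by ext <;> simp [f, b₁, b₂, c, val_mul, val_smul] <;> ring)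

/-- The homogeneous part of parity `p` of the structure sheaf. -/
def part (ω : Z1 (-3)) (U : Opens P2) (p : ZMod 2) : Submodule ℂ (OM ω U) where
  carrier := {s | (p = 0 → s.b₁ = 0 ∧ s.b₂ = 0) ∧ (p = 1 → s.f = 0 ∧ s.c = 0)}
  zero_mem' := ⟨fun _ => ⟨rfl, rfl⟩, fun _ => ⟨rfl, rfl⟩⟩
  add_mem' := by
    rintro s t ⟨hs, hs'⟩ ⟨ht, ht'⟩
    refine ⟨fun h => ?_, fun h => ?_⟩
    · have h1 := hs h; have h2 := ht h
      exact ⟨by change s.b₁ + t.b₁ = 0; simp [h1, h2], by change s.b₂ + t.b₂ = 0; simp [h1, h2]⟩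
    · have h1 := hs' h; have h2 := ht' h
      exact ⟨by change s.f + t.f = 0; simp [h1, h2], by change s.c + t.c = 0; simp [h1, h2]⟩
  smul_mem' := by
    rintro a s ⟨hs, hs'⟩
    refine ⟨fun h => ?_, fun h => ?_⟩
    · have h1 := hs h
      exact ⟨by change a • s.b₁ = 0; simp [h1], by change a • s.b₂ = 0; simp [h1]⟩
    · have h1 := hs' h
      exact ⟨by change a • s.f = 0; simp [h1], by change a • s.c = 0; simp [h1]⟩

end OM

/-- The sections over `W` of the homogeneous part of parity `p` of the tangent sheaf: the
derivations of parity `p` of the sheaf of superalgebras `𝒪_M` over `W`, that is the families of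
linear maps `𝒪_M(V) → 𝒪_M(V)`, `V ⊆ W` open, that commute with restrictions, shift the parity by
`p` and satisfy `D(st) = D(s) t + (-1)^{p|s|} s D(t)`. The tangent sheaf is the direct sum of
its even part `p = 0` and its odd part `p = 1`. -/
def TM (ω : Z1 (-3)) (W : Opens P2) (p : ZMod 2) :
    Submodule ℂ (∀ V : Set.Iic W, OM ω V.1 →ₗ[ℂ] OM ω V.1) where
  carrier := {D |
    (∀ (V V' : Set.Iic W) (h : V'.1 ≤ V.1) (s : OM ω V.1),
      D V' (OM.res h s) = OM.res h (D V s)) ∧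
    (∀ (V : Set.Iic W) (q : ZMod 2), ∀ s ∈ OM.part ω V.1 q, D V s ∈ OM.part ω V.1 (q + p)) ∧
    ∀ (V : Set.Iic W) (q : ZMod 2), ∀ s ∈ OM.part ω V.1 q, ∀ t : OM ω V.1,
      D V (s * t) = D V s * t + (-1 : ℂ) ^ (p * q).val • (s * D V t)}
  zero_mem' := by
    refine ⟨fun V V' h s => by simp, fun V q s hs => by simp, fun V q s hs t => by simp⟩
  add_mem' := by
    rintro D E ⟨hD1, hD2, hD3⟩ ⟨hE1, hE2, hE3⟩
    refine ⟨fun V V' h s => by simp [hD1 V V' h, hE1 V V' h],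
      fun V q s hs => Submodule.add_mem _ (hD2 V q s hs) (hE2 V q s hs), fun V q s hs t => ?_⟩
    simp only [Pi.add_apply, LinearMap.add_apply, hD3 V q s hs, hE3 V q s hs, add_mul, mul_add,
      smul_add]
    abel
  smul_mem' := by
    rintro a D ⟨hD1, hD2, hD3⟩
    refine ⟨fun V V' h s => by simp [hD1 V V' h],
      fun V q s hs => Submodule.smul_mem _ _ (hD2 V q s hs), fun V q s hs t => ?_⟩
    simp only [Pi.smul_apply, LinearMap.smul_apply, hD3 V q s hs, smul_add, smul_mul_assoc,
      mul_smul_comm, smul_comm a]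

/-- The part of parity `p` of the space `H⁰(𝒯_M)` of global sections of the tangent sheaf. -/
abbrev H0TM (ω : Z1 (-3)) (p : ZMod 2) : Type := TM ω ⊤ p

end

end SuperP2

open TopologicalSpace

namespace SuperP2

noncomputable section

/-! ### Holomorphic functions of several variables -/

section SeveralVariables

open Set Metric MeasureTheory Interval

variable {E : Type*} [NormedAddCommGroup E] [NormedSpace ℂ E]

/-! A superderivation is determined in the charts by its values on functions and on the odd elements
b θ₁, b θ₂ (`TM.eq_zero`), and every component of such a value is an operator of order at most one
between line bundles. The Euler field acts on 𝒪(k) as multiplication by k. So for k ≠ 0 an operator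
𝒪(k) → 𝒪(l) whose symbol is a derivation is the action of a unique field ∑ w_a ∂_a on the cone, with
w_a in 𝒪(l - k + 1) (`exists_field_of_operator`, `O.act_injective`). Globally such fields are
triples of sections. The sections of 𝒪(k) over the plane come from Liouville's theorem and Euler's
identity, and H¹(𝒪(k)) = 0 comes from Laurent splitting (`O.exists_cech_primitive`).

Even part. The θ₁-component of D(b θ₁) is a field w with linear coefficients (9 parameters), and the
θ₁-component of D(b θ₂) is multiplication by a linear form ℓ (3 parameters). The symbol of w is the
action on functions. The θ₂-component of D(b θ₁) lies in H⁰(𝒪(-1)) = 0, and on b θ₂ only a scalar α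
remains beside w. In the charts D(f) has a θ₁θ₂-component Z_i(f), and compatibility with the gluing
says that the commutator of ω with w, minus α ω, is the coboundary of (Z_i). Given w, such α and Z
exist because w acts on the class of ω by a scalar (`Z1.exists_lie_primitive`). They are unique
because the class is nonzero and H⁰(𝒯(-3)) = 0. This gives 9 + 3 = 12.

The scalar is found by Cartan's formula. Contraction with the volume form identifies 𝒯(-3) with Ω¹,
and the Lie derivative is d ι_w + ι_w d. The function ι_w ω_ij is a cocycle of 𝒪, and d ω_ij
corresponds to a cocycle of 𝒪(-3), the divergence. Both are coboundaries, so the Lie derivative of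
the class as a form vanishes, and what is left on 𝒯(-3) is the divergence of w.

Odd part. The bodies of D(b θ₁) and D(b θ₂) are φ₁ b and φ₂ b with φ₁ in H⁰(𝒪(1)) and φ₂ in
H⁰(𝒪(2)), which gives 3 + 6 parameters. All pairs occur: the obstructions b ↦ ω_ij(φ b) are cocycles
of fields, which are coboundaries since H¹(𝒪(k)) = 0. If φ₁ = φ₂ = 0, the θ₁θ₂-components are global
fields with coefficients in 𝒪(-1), hence zero, and in 𝒪, hence three constants. Their symbols are
the action on functions. This gives 9 + 3 = 12. -/

theorem norm_fderiv_le_of_norm_le {f : E → ℂ} {c : E} {r M : ℝ} (hr : 0 < r)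
    (hd : DifferentiableOn ℂ f (ball c r)) (hM : ∀ x ∈ ball c r, ‖f x‖ ≤ M) :
    ‖fderiv ℂ f c‖ ≤ 2 * M / r := by
  refine Complex.norm_fderiv_le_div_of_mapsTo_ball hd (fun x hx => ?_) hr
  rw [mem_closedBall, dist_eq_norm]
  linarith [norm_sub_le (f x) (f c), hM x hx, hM c (mem_ball_self hr)]

/-- Cauchy's estimate bounds the derivative in x uniformly in t, so differentiation under the
integral sign needs only joint continuity of G. -/
theorem differentiableOn_intervalIntegral [ProperSpace E] {U : Set E} (hU : IsOpen U)
    {G : E → ℝ → ℂ} {a b : ℝ} (hab : a ≤ b)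
    (hc : ContinuousOn (Function.uncurry G) (U ×ˢ Icc a b))
    (hd : ∀ t ∈ Icc a b, DifferentiableOn ℂ (fun x => G x t) U) :
    DifferentiableOn ℂ (fun x => ∫ t in a..b, G x t) U := by
  intro x₀ hx₀
  obtain ⟨ρ, hρ, hρU⟩ := nhds_basis_closedBall.mem_iff.1 (hU.mem_nhds hx₀)
  -- Halving the radius keeps the r-balls about points of `ball x₀ r` inside a compact ball on which
  -- G is bounded.
  obtain ⟨r, hr, rfl⟩ : ∃ r, 0 < r ∧ ρ = 2 * r := ⟨ρ / 2, by positivity, by ring⟩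
  have hsub : ∀ x ∈ ball x₀ r, ball x r ⊆ closedBall x₀ (2 * r) := by
    intro x hx y hy
    rw [mem_ball] at hx hy
    rw [mem_closedBall]
    linarith [dist_triangle y x x₀]
  have hK : IsCompact (closedBall x₀ (2 * r) ×ˢ Icc a b) :=
    (isCompact_closedBall _ _).prod isCompact_Icc
  have hcK : ContinuousOn (Function.uncurry G) (closedBall x₀ (2 * r) ×ˢ Icc a b) :=
    hc.mono (prod_mono hρU le_rfl)
  obtain ⟨M, hM⟩ := hK.exists_bound_of_continuousOn hcK
  have hcont : ∀ x ∈ U, ContinuousOn (G x) (Icc a b) := fun x hx =>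
    hc.comp (continuousOn_const.prodMk continuousOn_id) (fun t ht => ⟨hx, ht⟩)
  have huIoc : Ι a b ⊆ Icc a b := by rw [uIoc_of_le hab]; exact Ioc_subset_Icc_self
  have hmeas : ∀ x ∈ U, AEStronglyMeasurable (G x) (volume.restrict (Ι a b)) := fun x hx =>
    ((hcont x hx).mono huIoc).aestronglyMeasurable measurableSet_uIoc
  have hball : ∀ x ∈ ball x₀ r, x ∈ U := fun x hx =>
    hρU (hsub x hx (mem_ball_self hr))
  have hF' : ContinuousOn (fun t => fderiv ℂ (fun x => G x t) x₀) (Icc a b) := by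
    intro t ht
    rw [ContinuousWithinAt, Metric.tendsto_nhdsWithin_nhds]
    intro ε hε
    have huc := hK.uniformContinuousOn_of_continuous hcK
    rw [Metric.uniformContinuousOn_iff] at huc
    -- Cauchy's estimate for G(·, s) - G(·, t): a bound ε r / 4 on the r-ball bounds the difference
    -- of derivatives by ε / 2.
    obtain ⟨δ, hδ, h⟩ := huc (ε * r / 4) (by positivity)
    refine ⟨δ, hδ, fun s hs hst => ?_⟩
    have hdt : ∀ t ∈ Icc a b, DifferentiableAt ℂ (fun x => G x t) x₀ := fun t ht =>
      (hd t ht).differentiableAt (hU.mem_nhds hx₀)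
    have hsub' := hsub x₀ (mem_ball_self hr)
    rw [dist_eq_norm, ← fderiv_fun_sub (hdt s hs) (hdt t ht)]
    refine lt_of_le_of_lt (norm_fderiv_le_of_norm_le hr (M := ε * r / 4)
      (((hd s hs).sub (hd t ht)).mono (hsub'.trans hρU)) (fun x hx => ?_)) ?_
    · rw [← dist_eq_norm]
      refine (h (x, s) ⟨hsub' hx, hs⟩ (x, t) ⟨hsub' hx, ht⟩ ?_).le
      simpa [Prod.dist_eq] using max_lt hδ hst
    · rw [div_lt_iff₀ hr]
      nlinarith [mul_pos hε hr]
  refine (intervalIntegral.hasFDerivAt_integral_of_dominated_of_fderiv_le (𝕜 := ℂ)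
    (F' := fun x t => fderiv ℂ (fun x => G x t) x) (bound := fun _ => 2 * M / r)
    (ball_mem_nhds x₀ hr) ?_ ?_ ?_ ?_ ?_ ?_).differentiableAt.differentiableWithinAt
  · filter_upwards [hU.mem_nhds hx₀] with x hx using hmeas x hx
  · exact (hcont x₀ hx₀).intervalIntegrable_of_Icc hab
  · exact (hF'.mono huIoc).aestronglyMeasurable measurableSet_uIoc
  · refine Filter.Eventually.of_forall fun t ht x hx => ?_
    exact norm_fderiv_le_of_norm_le hr ((hd t (huIoc ht)).mono ((hsub x hx).trans hρU))
      fun y hy => hM (y, t) ⟨hsub x hx hy, huIoc ht⟩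
  · exact intervalIntegrable_const
  · refine Filter.Eventually.of_forall fun t ht x hx => ?_
    exact ((hd t (huIoc ht)).differentiableAt (hU.mem_nhds (hball x hx))).hasFDerivAt

theorem differentiableOn_circleIntegral [ProperSpace E] {U : Set E} (hU : IsOpen U)
    {G : E → ℂ → ℂ} {R : ℝ} (hR : 0 ≤ R)
    (hc : ContinuousOn (Function.uncurry G) (U ×ˢ sphere 0 R))
    (hd : ∀ ζ ∈ sphere (0 : ℂ) R, DifferentiableOn ℂ (fun x => G x ζ) U) :
    DifferentiableOn ℂ (fun x => ∮ ζ in C(0, R), G x ζ) U := by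
  simp only [circleIntegral]
  refine differentiableOn_intervalIntegral hU Real.two_pi_pos.le ?_ ?_
  · have h1 : Continuous fun p : E × ℝ => deriv (circleMap 0 R) p.2 := by
      simp only [deriv_circleMap]; fun_prop
    refine h1.continuousOn.smul (hc.comp (f := fun p : E × ℝ => (p.1, circleMap 0 R p.2)) ?_ ?_)
    · exact (continuous_fst.prodMk ((continuous_circleMap 0 R).comp continuous_snd)).continuousOn
    · exact fun p hp => ⟨hp.1, circleMap_mem_sphere _ hR _⟩
  · exact fun t _ => (hd _ (circleMap_mem_sphere _ hR t)).const_smul (deriv (circleMap 0 R) t)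

/-- Partial derivatives of holomorphic functions are holomorphic. -/
theorem differentiableOn_fderiv_apply [ProperSpace E] {U : Set E} (hU : IsOpen U) {f : E → ℂ}
    (hf : DifferentiableOn ℂ f U) (v : E) :
    DifferentiableOn ℂ (fun x => fderiv ℂ f x v) U := by
  intro x₀ hx₀
  have hcont : Continuous fun p : E × ℂ => p.1 + p.2 • v := by fun_prop
  obtain ⟨W, hW, hx₀W, r, hr, hWr⟩ : ∃ W : Set E, IsOpen W ∧ x₀ ∈ W ∧ ∃ r : ℝ, 0 < r ∧
      ∀ x ∈ W, ∀ ζ ∈ closedBall (0 : ℂ) r, x + ζ • v ∈ U := by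
    have h := hcont.continuousAt.preimage_mem_nhds (x := (x₀, (0 : ℂ)))
      (by simpa using hU.mem_nhds hx₀)
    rw [nhds_prod_eq, Filter.mem_prod_iff] at h
    obtain ⟨A, hA, B, hB, hAB⟩ := h
    obtain ⟨r, hr, hrB⟩ := nhds_basis_closedBall.mem_iff.1 hB
    exact ⟨interior A, isOpen_interior, mem_interior_iff_mem_nhds.2 hA, r, hr, fun x hx ζ hζ =>
      hAB (show (x, ζ) ∈ A ×ˢ B from ⟨interior_subset hx, hrB hζ⟩)⟩
  have hne : ∀ ζ ∈ sphere (0 : ℂ) r, ζ ≠ 0 := fun ζ hζ h => by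
    rw [mem_sphere, h, dist_self] at hζ; exact hr.ne hζ
  -- Cauchy's formula for the derivative at 0 of ζ ↦ f(x + ζ v). The radius r serves all x in W, so
  -- the derivative becomes an integral depending holomorphically on x.
  have key : DifferentiableOn ℂ
      (fun x => (2 * Real.pi * Complex.I : ℂ)⁻¹ * ∮ ζ in C(0, r), ((ζ - 0) ^ 2)⁻¹ • f (x + ζ • v)) W := by
    refine DifferentiableOn.const_mul (differentiableOn_circleIntegral hW hr.le ?_ ?_) _
    · have h1 : ContinuousOn (fun p : E × ℂ => ((p.2 - 0) ^ 2)⁻¹) (W ×ˢ sphere 0 r) :=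
        ContinuousOn.inv₀ (by fun_prop) fun p hp => by simpa using hne _ hp.2
      exact h1.smul (hf.continuousOn.comp hcont.continuousOn
        fun p hp => hWr _ hp.1 _ (sphere_subset_closedBall hp.2))
    · intro ζ hζ
      have h1 : DifferentiableOn ℂ (fun x => f (x + ζ • v)) W :=
        hf.comp (f := fun x => x + ζ • v) (by fun_prop)
          fun x hx => hWr _ hx _ (sphere_subset_closedBall hζ)
      exact h1.const_smul (((ζ - 0) ^ 2)⁻¹)
  refine ((key.differentiableAt (hW.mem_nhds hx₀W)).congr_of_eventuallyEq ?_).differentiableWithinAt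
  filter_upwards [hW.mem_nhds hx₀W] with x hx
  have hxU : x ∈ U := by simpa using hWr x hx 0 (mem_closedBall_self hr.le)
  have h1 : HasDerivAt (fun ζ : ℂ => f (x + ζ • v)) (fderiv ℂ f x v) 0 := by
    have h2 : HasDerivAt (fun ζ : ℂ => x + ζ • v) v 0 := by
      simpa using ((hasDerivAt_id (0 : ℂ)).smul_const v).const_add x
    have h3 : HasFDerivAt f (fderiv ℂ f x) (x + (0 : ℂ) • v) := by
      simpa using (hf.differentiableAt (hU.mem_nhds hxU)).hasFDerivAt
    exact h3.comp_hasDerivAt _ h2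
  have hV : IsOpen {ζ : ℂ | x + ζ • v ∈ U} := hU.preimage (by fun_prop)
  have h4 : DifferentiableOn ℂ (fun ζ : ℂ => f (x + ζ • v)) {ζ : ℂ | x + ζ • v ∈ U} :=
    hf.comp (f := fun ζ : ℂ => x + ζ • v) (by fun_prop) fun _ h => h
  have h5 := Complex.two_pi_I_inv_smul_circleIntegral_sub_sq_inv_smul_of_differentiable
    hV (hWr x hx) h4 (mem_ball_self hr)
  rw [h1.deriv, smul_eq_mul] at h5
  exact h5.symm

end SeveralVariables

/-! ### Cones -/

theorem ne_zero_of_mem_cone {U : Opens P2} {x : Fin 3 → ℂ} (hx : x ∈ cone U) : x ≠ 0 := hx.1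

theorem smul_mem_cone {U : Opens P2} {x : Fin 3 → ℂ} {t : ℂ} (ht : t ≠ 0) (hx : x ∈ cone U) :
    t • x ∈ cone U := by
  obtain ⟨h0, hx⟩ := hx
  refine ⟨smul_ne_zero ht h0, ?_⟩
  have : Projectivization.mk ℂ (t • x) (smul_ne_zero ht h0) = Projectivization.mk ℂ x h0 :=
    (Projectivization.mk_eq_mk_iff' ℂ _ _ _ _).2 ⟨t, rfl⟩
  rwa [this]

theorem cone_inf (U V : Opens P2) : cone (U ⊓ V) = cone U ∩ cone V := by
  ext x
  exact ⟨fun ⟨h, h1, h2⟩ => ⟨⟨h, h1⟩, h, h2⟩, fun ⟨⟨h, h1⟩, _, h2⟩ => ⟨h, h1, h2⟩⟩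

@[simp]
theorem mem_cone_inf {U V : Opens P2} {x : Fin 3 → ℂ} :
    x ∈ cone (U ⊓ V) ↔ x ∈ cone U ∧ x ∈ cone V := by
  rw [cone_inf]; rfl

@[simp]
theorem mem_cone_top {x : Fin 3 → ℂ} : x ∈ cone ⊤ ↔ x ≠ 0 :=
  ⟨fun h => h.1, fun h => ⟨h, trivial⟩⟩

@[simp]
theorem mem_cone_chart {i : Fin 3} {x : Fin 3 → ℂ} : x ∈ cone (chart i) ↔ x i ≠ 0 := by
  constructor
  · rintro ⟨h, hx⟩ h0
    obtain ⟨a, ha⟩ := Projectivization.exists_smul_eq_mk_rep ℂ x h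
    apply hx
    rw [← ha, Pi.smul_apply, h0, smul_zero]
  · intro h0
    have h : x ≠ 0 := fun h => h0 (by rw [h]; rfl)
    refine ⟨h, ?_⟩
    obtain ⟨a, ha⟩ := Projectivization.exists_smul_eq_mk_rep ℂ x h
    change (Projectivization.mk ℂ x h).rep i ≠ 0
    rw [← ha, Pi.smul_apply]
    simpa [Units.smul_def] using h0

theorem isOpen_cone (U : Opens P2) : IsOpen (cone U) := by
  have h : IsOpen {x : Fin 3 → ℂ | x ≠ 0} := isOpen_ne
  have h2 := (h.isOpenEmbedding_subtypeVal).isOpenMap _ (isOpen_coinduced.1 U.2)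
  convert h2 using 1
  ext x
  simp [cone]

/-- Every scaling invariant open set is the cone over an open subset of the plane. -/
theorem exists_cone_eq {S : Set (Fin 3 → ℂ)} (hS : IsOpen S) (h0 : (0 : Fin 3 → ℂ) ∉ S)
    (h : ∀ (t : ℂ) (x : Fin 3 → ℂ), t ≠ 0 → x ∈ S → t • x ∈ S) : ∃ U : Opens P2, cone U = S := by
  have key : ∀ (x : Fin 3 → ℂ) (hx : x ≠ 0), (Projectivization.mk ℂ x hx).rep ∈ S ↔ x ∈ S := by
    intro x hx
    obtain ⟨a, ha⟩ := Projectivization.exists_smul_eq_mk_rep ℂ x hx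
    rw [← ha]
    refine ⟨fun hs => ?_, fun hs => h _ _ a.ne_zero hs⟩
    have := h (a⁻¹ : ℂˣ) _ (Units.ne_zero _) hs
    rwa [← Units.smul_def, inv_smul_smul] at this
  refine ⟨⟨{p | p.rep ∈ S}, ?_⟩, ?_⟩
  · rw [isOpen_coinduced]
    convert hS.preimage (continuous_subtype_val (p := fun x : Fin 3 → ℂ => x ≠ 0)) using 1
    ext x
    exact key x.1 x.2
  · ext x
    refine ⟨fun ⟨hx, hs⟩ => (key x hx).1 hs, fun hs => ?_⟩
    have hx : x ≠ 0 := fun hx => h0 (hx ▸ hs)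
    exact ⟨hx, (key x hx).2 hs⟩

theorem le_of_cone_subset {U V : Opens P2} (h : cone U ⊆ cone V) : U ≤ V := by
  intro p hp
  have : p.rep ∈ cone U := ⟨p.rep_nonzero, by simpa using hp⟩
  obtain ⟨h1, h2⟩ := h this
  simpa using h2

theorem exists_coord_ne_zero {x : Fin 3 → ℂ} (hx : x ≠ 0) : ∃ i, x i ≠ 0 := by
  by_contra! h
  exact hx (funext h)

/-! ### Sections of `𝒪(k)` as functions -/

namespace O

variable {k l m : ℤ} {U V : Opens P2} {x : Fin 3 → ℂ}

open Classical in
/-- A section of `𝒪(k)` as a function on the whole of `ℂ³`, extended by zero. -/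
def fn (f : O k U) (x : Fin 3 → ℂ) : ℂ := if h : x ∈ cone U then f.1 ⟨x, h⟩ else 0

theorem fn_of_mem (f : O k U) (hx : x ∈ cone U) : f.fn x = f.1 ⟨x, hx⟩ := dif_pos hx

theorem ext_fn {f g : O k U} (h : ∀ x ∈ cone U, f.fn x = g.fn x) : f = g := by
  ext x
  have := h x x.2
  rwa [fn_of_mem f x.2, fn_of_mem g x.2] at this

@[simp]
theorem fn_zero : (0 : O k U).fn x = 0 := by
  unfold fn; split_ifs <;> rfl

@[simp]
theorem fn_add (f g : O k U) : (f + g).fn x = f.fn x + g.fn x := by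
  unfold fn; split_ifs <;> simp

@[simp]
theorem fn_sub (f g : O k U) : (f - g).fn x = f.fn x - g.fn x := by
  unfold fn; split_ifs <;> simp

@[simp]
theorem fn_neg (f : O k U) : (-f).fn x = -f.fn x := by
  rw [← zero_sub, fn_sub, fn_zero, zero_sub]

@[simp]
theorem fn_smul (a : ℂ) (f : O k U) : (a • f).fn x = a * f.fn x := by
  unfold fn; split_ifs <;> simp

@[simp]
theorem fn_mul (h : k + l = m) (f : O k U) (g : O l U) :
    (O.mul h f g).fn x = f.fn x * g.fn x := by
  unfold fn; split_ifs <;> simp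

@[simp]
theorem fn_res (h : V ≤ U) (f : O k U) (hx : x ∈ cone V) : (O.res h f).fn x = f.fn x := by
  rw [fn_of_mem _ hx, fn_of_mem _ (cone_mono h hx)]; rfl

@[simp]
theorem fn_one (hx : x ∈ cone U) : (O.one U).fn x = 1 := by
  rw [fn_of_mem _ hx]; rfl

@[simp]
theorem fn_sum {ι : Type*} (s : Finset ι) (f : ι → O k U) :
    (∑ i ∈ s, f i).fn x = ∑ i ∈ s, (f i).fn x := by
  classical
  induction s using Finset.induction_on with
  | empty => simp
  | insert a s ha ih => rw [Finset.sum_insert ha, Finset.sum_insert ha, fn_add, ih]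

theorem differentiableOn_fn (f : O k U) : DifferentiableOn ℂ f.fn (cone U) := by
  obtain ⟨F, hF, hf⟩ := f.2.1
  exact hF.congr fun x hx => by rw [fn_of_mem f hx]; exact hf ⟨x, hx⟩

theorem differentiableAt_fn (f : O k U) (hx : x ∈ cone U) : DifferentiableAt ℂ f.fn x :=
  f.differentiableOn_fn.differentiableAt ((isOpen_cone U).mem_nhds hx)

theorem fn_smul_arg (f : O k U) {t : ℂ} (ht : t ≠ 0) (hx : x ∈ cone U) :
    f.fn (t • x) = t ^ k * f.fn x := by
  rw [fn_of_mem f hx, fn_of_mem f (smul_mem_cone ht hx)]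
  exact f.2.2 t ⟨x, hx⟩ ⟨t • x, _⟩ ht rfl

/-- The section given by a homogeneous holomorphic function. -/
def ofFun (F : (Fin 3 → ℂ) → ℂ) (hF : DifferentiableOn ℂ F (cone U))
    (hom : ∀ (t : ℂ) (x : Fin 3 → ℂ), t ≠ 0 → x ∈ cone U → F (t • x) = t ^ k * F x) : O k U :=
  ⟨fun x => F x, ⟨F, hF, fun _ => rfl⟩, fun t x y ht hxy => by
    change F y = t ^ k * F x
    rw [hxy]; exact hom t x ht x.2⟩

@[simp]
theorem fn_ofFun {F : (Fin 3 → ℂ) → ℂ} (hF : DifferentiableOn ℂ F (cone U))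
    (hom : ∀ (t : ℂ) (x : Fin 3 → ℂ), t ≠ 0 → x ∈ cone U → F (t • x) = t ^ k * F x)
    (hx : x ∈ cone U) : (ofFun F hF hom).fn x = F x := by
  rw [fn_of_mem _ hx]; rfl

@[simp]
theorem res_res {W : Opens P2} (h : V ≤ U) (h' : W ≤ V) (f : O k U) :
    O.res h' (O.res h f) = O.res (h'.trans h) f := rfl

@[simp]
theorem res_mul (hm : k + l = m) (h : V ≤ U) (f : O k U) (g : O l U) :
    O.res h (O.mul hm f g) = O.mul hm (O.res h f) (O.res h g) := rfl

/-- The value at `x` of the partial derivative in the direction of the `a`-th coordinate. -/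
def dv (f : O k U) (a : Fin 3) (x : Fin 3 → ℂ) : ℂ := fderiv ℂ f.fn x (Pi.single a 1)

theorem dv_eq_of_fn (f : O k U) {F : (Fin 3 → ℂ) → ℂ} (a : Fin 3)
    (h : ∀ y ∈ cone U, f.fn y = F y) (hx : x ∈ cone U) :
    f.dv a x = fderiv ℂ F x (Pi.single a 1) := by
  unfold dv
  rw [Filter.EventuallyEq.fderiv_eq]
  filter_upwards [(isOpen_cone U).mem_nhds hx] with y hy using h y hy

@[simp]
theorem dv_zero (a : Fin 3) : (0 : O k U).dv a x = 0 := by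
  have : (0 : O k U).fn = fun _ => 0 := funext fun _ => fn_zero
  simp [dv, this]

@[simp]
theorem dv_add (f g : O k U) (a : Fin 3) (hx : x ∈ cone U) :
    (f + g).dv a x = f.dv a x + g.dv a x := by
  rw [dv_eq_of_fn (f + g) (F := f.fn + g.fn) a (fun _ _ => by simp) hx,
    fderiv_add (f.differentiableAt_fn hx) (g.differentiableAt_fn hx)]
  rfl

@[simp]
theorem dv_smul (c : ℂ) (f : O k U) (a : Fin 3) (hx : x ∈ cone U) :
    (c • f).dv a x = c * f.dv a x := by
  rw [dv_eq_of_fn (c • f) (F := c • f.fn) a (fun _ _ => by simp) hx,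
    fderiv_const_smul (f.differentiableAt_fn hx)]
  rfl

@[simp]
theorem dv_neg (f : O k U) (a : Fin 3) (hx : x ∈ cone U) : (-f).dv a x = -f.dv a x := by
  have := dv_smul (-1) f a hx
  simpa using this

@[simp]
theorem dv_sub (f g : O k U) (a : Fin 3) (hx : x ∈ cone U) :
    (f - g).dv a x = f.dv a x - g.dv a x := by
  rw [sub_eq_add_neg, dv_add _ _ _ hx, dv_neg _ _ hx, sub_eq_add_neg]

@[simp]
theorem dv_mul (h : k + l = m) (f : O k U) (g : O l U) (a : Fin 3) (hx : x ∈ cone U) :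
    (O.mul h f g).dv a x = f.fn x * g.dv a x + f.dv a x * g.fn x := by
  rw [dv_eq_of_fn (O.mul h f g) (F := f.fn * g.fn) a (fun _ _ => by simp) hx,
    fderiv_mul (f.differentiableAt_fn hx) (g.differentiableAt_fn hx)]
  simp only [_root_.add_apply, _root_.smul_apply, smul_eq_mul, dv]
  ring

@[simp]
theorem dv_res (h : V ≤ U) (f : O k U) (a : Fin 3) (hx : x ∈ cone V) :
    (O.res h f).dv a x = f.dv a x :=
  dv_eq_of_fn _ a (fun _ hy => fn_res h f hy) hx

@[simp]
theorem dv_sum {ι : Type*} (s : Finset ι) (f : ι → O k U) (a : Fin 3) (hx : x ∈ cone U) :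
    (∑ i ∈ s, f i).dv a x = ∑ i ∈ s, (f i).dv a x := by
  classical
  induction s using Finset.induction_on with
  | empty => simp
  | insert b s hb ih => rw [Finset.sum_insert hb, Finset.sum_insert hb, dv_add _ _ _ hx, ih]

/-- Euler's identity. -/
theorem euler (f : O k U) (hx : x ∈ cone U) : ∑ a, x a * f.dv a x = k * f.fn x := by
  have h1 : HasDerivAt (fun t : ℂ => f.fn (t • x)) (fderiv ℂ f.fn x x) 1 := by
    have h2 : HasDerivAt (fun t : ℂ => t • x) x 1 := by
      simpa using (hasDerivAt_id (1 : ℂ)).smul_const x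
    have h3 : HasFDerivAt f.fn (fderiv ℂ f.fn x) ((1 : ℂ) • x) := by
      simpa using (f.differentiableAt_fn hx).hasFDerivAt
    exact h3.comp_hasDerivAt _ h2
  have h4 : HasDerivAt (fun t : ℂ => f.fn (t • x)) (k * f.fn x) 1 := by
    have h5 := (hasDerivAt_zpow k (1 : ℂ) (Or.inl one_ne_zero)).mul_const (f.fn x)
    simp only [one_zpow, mul_one] at h5
    refine h5.congr_of_eventuallyEq ?_
    filter_upwards [isOpen_ne.mem_nhds (one_ne_zero (α := ℂ))] with t ht
    exact f.fn_smul_arg ht hx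
  rw [← h1.unique h4]
  have h6 := congrArg (fderiv ℂ f.fn x) (pi_eq_sum_univ' x)
  rw [h6, map_sum]
  exact Finset.sum_congr rfl fun a _ => by rw [map_smul, smul_eq_mul, dv]

theorem euler' (f : O k U) (hx : x ∈ cone U) :
    x 0 * f.dv 0 x + x 1 * f.dv 1 x + x 2 * f.dv 2 x = k * f.fn x := by
  rw [← euler f hx, Fin.sum_univ_three]

theorem dv_smul_arg (h : l + 1 = k) (f : O k U) (a : Fin 3) {t : ℂ} (ht : t ≠ 0)
    (hx : x ∈ cone U) : f.dv a (t • x) = t ^ l * f.dv a x := by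
  have h1 : HasFDerivAt (fun y => f.fn (t • y))
      ((fderiv ℂ f.fn (t • x)).comp (t • ContinuousLinearMap.id ℂ (Fin 3 → ℂ))) x :=
    (f.differentiableAt_fn (smul_mem_cone ht hx)).hasFDerivAt.comp x
      ((hasFDerivAt_id x).const_smul t)
  have h2 : HasFDerivAt (fun y => f.fn (t • y)) (t ^ k • fderiv ℂ f.fn x) x := by
    refine ((f.differentiableAt_fn hx).hasFDerivAt.const_smul (t ^ k)).congr_of_eventuallyEq ?_
    filter_upwards [(isOpen_cone U).mem_nhds hx] with y hy using f.fn_smul_arg ht hy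
  have h3 := congrArg (fun L => L (Pi.single a 1)) (h1.unique h2)
  simp only [ContinuousLinearMap.comp_apply, _root_.smul_apply,
    ContinuousLinearMap.id_apply, map_smul, smul_eq_mul] at h3
  have h4 : t ^ k = t * t ^ l := by rw [← h, zpow_add₀ ht, zpow_one, mul_comm]
  rw [h4, mul_assoc] at h3
  exact mul_left_cancel₀ ht h3

theorem differentiableOn_dv (f : O k U) (a : Fin 3) : DifferentiableOn ℂ (f.dv a) (cone U) :=
  differentiableOn_fderiv_apply (isOpen_cone U) f.differentiableOn_fn _

/-- Partial derivatives of sections. -/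
def pd (h : l + 1 = k) (a : Fin 3) : O k U →ₗ[ℂ] O l U where
  toFun f := ofFun (f.dv a) (f.differentiableOn_dv a)
    fun _ _ ht hx => dv_smul_arg h f a ht hx
  map_add' f g := ext_fn fun x hx => by
    rw [fn_add, fn_ofFun _ _ hx, fn_ofFun _ _ hx, fn_ofFun _ _ hx, dv_add _ _ _ hx]
  map_smul' c f := ext_fn fun x hx => by
    rw [RingHom.id_apply, fn_smul, fn_ofFun _ _ hx, fn_ofFun _ _ hx, dv_smul _ _ _ hx]

@[simp]
theorem fn_pd (h : l + 1 = k) (a : Fin 3) (f : O k U) (hx : x ∈ cone U) :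
    (pd h a f).fn x = f.dv a x :=
  fn_ofFun (f.differentiableOn_dv a) (fun _ _ ht hx => dv_smul_arg h f a ht hx) hx

theorem dv_pd_comm (h : l + 1 = k) (a b : Fin 3) (f : O k U) (hx : x ∈ cone U) :
    (pd h a f).dv b x = (pd h b f).dv a x := by
  have hd : ∀ c, DifferentiableOn ℂ (fun y => fderiv ℂ f.fn y (Pi.single c 1)) (cone U) := fun c =>
    differentiableOn_fderiv_apply (isOpen_cone U) f.differentiableOn_fn _
  have hd1 : ∀ c, DifferentiableAt ℂ (fun y => fderiv ℂ f.fn y (Pi.single c 1)) x := fun c =>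
    (hd c).differentiableAt ((isOpen_cone U).mem_nhds hx)
  -- Symmetry of second derivatives needs the total derivative to be differentiable. It is assembled
  -- from the partial derivatives, which are holomorphic.
  have hd2 : DifferentiableAt ℂ (fderiv ℂ f.fn) x := by
    have e : fderiv ℂ f.fn = fun y => ∑ c, fderiv ℂ f.fn y (Pi.single c 1) •
        (ContinuousLinearMap.proj c : (Fin 3 → ℂ) →L[ℂ] ℂ) := by
      funext y
      ext v
      conv_lhs => rw [pi_eq_sum_univ' v]
      simp only [map_sum, map_smul, _root_.sum_apply, _root_.smul_apply,
        ContinuousLinearMap.proj_apply, smul_eq_mul]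
      exact Finset.sum_congr rfl fun c _ => mul_comm _ _
    rw [e]
    exact DifferentiableAt.fun_sum fun c _ => (hd1 c).smul_const _
  have h2 : ∀ c e, (pd h c f).dv e x =
      fderiv ℂ (fderiv ℂ f.fn) x (Pi.single e 1) (Pi.single c 1) := by
    intro c e
    rw [dv_eq_of_fn _ (F := f.dv c) e (fun _ hy => fn_pd h c f hy) hx]
    unfold dv
    rw [fderiv_clm_apply hd2 (differentiableAt_const _)]
    simp
  rw [h2, h2]
  refine second_derivative_symmetric_of_eventually (𝕜 := ℂ) (f := f.fn) ?_ hd2.hasFDerivAt _ _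
  filter_upwards [(isOpen_cone U).mem_nhds hx] with y hy
  exact (f.differentiableAt_fn hy).hasFDerivAt

/-- The homogeneous coordinates. -/
def X (a : Fin 3) (U : Opens P2) : O 1 U :=
  ofFun (fun x => x a) (differentiable_apply a).differentiableOn fun t x _ _ => by simp

@[simp]
theorem fn_X (a : Fin 3) (hx : x ∈ cone U) : (X a U).fn x = x a := fn_ofFun _ _ hx

@[simp]
theorem dv_X (a b : Fin 3) (hx : x ∈ cone U) : (X a U).dv b x = if a = b then 1 else 0 := by
  rw [dv_eq_of_fn _ (F := fun x => x a) b (fun _ hy => fn_X a hy) hx]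
  rw [(hasFDerivAt_apply (𝕜 := ℂ) a x).fderiv]
  simp [Pi.single_apply]

/-- The powers of a homogeneous coordinate over its chart. -/
def Xpow (i : Fin 3) (k : ℤ) {U : Opens P2} (hU : U ≤ chart i) : O k U :=
  ofFun (fun x => x i ^ k)
    (fun x hx => (DifferentiableAt.zpow (differentiableAt_apply i x)
      (Or.inl (mem_cone_chart.1 (cone_mono hU hx)))).differentiableWithinAt)
    fun t x _ _ => by simp [mul_zpow]

@[simp]
theorem fn_Xpow (i : Fin 3) (hU : U ≤ chart i) (hx : x ∈ cone U) :
    (Xpow i k hU).fn x = x i ^ k := fn_ofFun _ _ hx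

@[simp]
theorem dv_Xpow (i : Fin 3) (hU : U ≤ chart i) (b : Fin 3) (hx : x ∈ cone U) :
    (Xpow i k hU).dv b x = if i = b then k * x i ^ (k - 1) else 0 := by
  rw [dv_eq_of_fn _ (F := fun x => x i ^ k) b (fun _ hy => fn_Xpow i hU hy) hx]
  have h1 := (hasDerivAt_zpow k (x i)
    (Or.inl (mem_cone_chart.1 (cone_mono hU hx)))).comp_hasFDerivAt x
      (hasFDerivAt_apply (𝕜 := ℂ) i x)
  change fderiv ℂ ((fun y : ℂ => y ^ k) ∘ fun y : Fin 3 → ℂ => y i) x _ = _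
  rw [h1.fderiv]
  simp [Pi.single_apply]

/-- Sections of `𝒪(k)` over the standard charts glue. -/
theorem exists_glue (g : ∀ i, O k (U ⊓ chart i))
    (h : ∀ i j, ∀ x ∈ cone U, x i ≠ 0 → x j ≠ 0 → (g i).fn x = (g j).fn x) :
    ∃ G : O k U, ∀ i, ∀ x ∈ cone U, x i ≠ 0 → G.fn x = (g i).fn x := by
  classical
  let F : (Fin 3 → ℂ) → ℂ := fun x => if hx : ∃ i, x i ≠ 0 then (g hx.choose).fn x else 0
  have hF : ∀ i, ∀ x ∈ cone U, x i ≠ 0 → F x = (g i).fn x := by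
    intro i x hx hi
    have hx' : ∃ i, x i ≠ 0 := ⟨i, hi⟩
    simp only [F, dif_pos hx']
    exact h _ _ x hx hx'.choose_spec hi
  refine ⟨ofFun F ?_ ?_, fun i x hx hi => by rw [fn_ofFun _ _ hx, hF i x hx hi]⟩
  · intro x hx
    obtain ⟨i, hi⟩ := exists_coord_ne_zero (ne_zero_of_mem_cone hx)
    have hx' : x ∈ cone (U ⊓ chart i) := by simp [hx, hi]
    refine (((g i).differentiableAt_fn hx').congr_of_eventuallyEq ?_).differentiableWithinAt
    filter_upwards [(isOpen_cone _).mem_nhds hx'] with y hy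
    simp only [mem_cone_inf, mem_cone_chart] at hy
    exact hF i y hy.1 hy.2
  · intro t x ht hx
    obtain ⟨i, hi⟩ := exists_coord_ne_zero (ne_zero_of_mem_cone hx)
    rw [hF i _ (smul_mem_cone ht hx) (by simp [ht, hi]), hF i x hx hi,
      fn_smul_arg _ ht (by simp [hx, hi])]

theorem ext_charts {f g : O k U}
    (h : ∀ i, res (inf_le_left : U ⊓ chart i ≤ U) f = res inf_le_left g) : f = g :=
  ext_fn fun x hx => by
    obtain ⟨i, hi⟩ := exists_coord_ne_zero (ne_zero_of_mem_cone hx)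
    have hx' : x ∈ cone (U ⊓ chart i) := by simp [hx, hi]
    have := congrArg (fun f => f.fn x) (h i)
    simpa [hx', -mem_cone_inf] using this

/-! ### Vector fields on cones -/

/-- The action of the vector field `∑ w_a ∂_a`. -/
def act (h : m + k = l + 1) (hV : V ≤ U) (w : Fin 3 → O m U) : O k V →ₗ[ℂ] O l V where
  toFun f := ∑ a, O.mul (by omega) (res hV (w a)) (pd (sub_add_cancel k 1) a f)
  map_add' f g := ext_fn fun x hx => by
    simp only [fn_sum, fn_mul, map_add, fn_add, mul_add, Finset.sum_add_distrib]
  map_smul' c f := ext_fn fun x hx => by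
    simp only [fn_sum, fn_mul, map_smul, fn_smul, RingHom.id_apply, Finset.mul_sum]
    exact Finset.sum_congr rfl fun _ _ => by ring

@[simp]
theorem fn_act (h : m + k = l + 1) (hV : V ≤ U) (w : Fin 3 → O m U) (f : O k V)
    (hx : x ∈ cone V) : (act h hV w f).fn x = ∑ a, (w a).fn x * f.dv a x := by
  change (∑ a, O.mul _ (res hV (w a)) (pd (sub_add_cancel k 1) a f) : O l V).fn x = _
  simp [hx]

theorem res_act {W : Opens P2} (h : m + k = l + 1) (hV : V ≤ U) (hW : W ≤ V)
    (w : Fin 3 → O m U) (f : O k V) :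
    res hW (act h hV w f) = act h (hW.trans hV) w (res hW f) :=
  ext_fn fun x hx => by simp [hx, cone_mono hW hx]

theorem act_res {W : Opens P2} (h : m + k = l + 1) (hV : V ≤ U) (hW : W ≤ V)
    (w : Fin 3 → O m U) (f : O k W) :
    act h hW (fun a => res hV (w a)) f = act h (hW.trans hV) w f :=
  ext_fn fun x hx => by simp [hx, cone_mono hW hx]

end O

/-! ### Derivations are vector fields -/

section Hadamard

open Set Metric MeasureTheory Interval

theorem O.fderiv_fn_apply {k : ℤ} {U : Opens P2} (f : O k U) (x v : Fin 3 → ℂ) :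
    fderiv ℂ f.fn x v = ∑ a, v a * f.dv a x := by
  have h := congrArg (fderiv ℂ f.fn x) (pi_eq_sum_univ' v)
  rw [h, map_sum]
  exact Finset.sum_congr rfl fun a _ => by rw [map_smul, smul_eq_mul, O.dv]

/-- Hadamard's lemma for functions of degree zero. -/
theorem O.exists_hadamard {i : Fin 3} {U : Opens P2} (f : O 0 U) {p : Fin 3 → ℂ}
    (hp : p ∈ cone U) (hi : p i ≠ 0) : ∃ V ≤ U, p ∈ cone V ∧ ∃ g : Fin 3 → O 0 V,
      (∀ a, (g a).fn p = p i * f.dv a p) ∧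
      ∀ x ∈ cone V, f.fn x = f.fn p + ∑ a, (x a / x i - p a / p i) * (g a).fn x := by
  obtain ⟨r, hr, hrU⟩ := nhds_basis_ball.mem_iff.1 ((isOpen_cone U).mem_nhds hp)
  -- `y x` is the representative of the line of x with i-th coordinate `p i`. Since f has degree 0,
  -- f x = f (y x), and one may integrate along the segment from p to `y x`. The set V consists of
  -- the lines for which this representative lies in the ball.
  let y : (Fin 3 → ℂ) → (Fin 3 → ℂ) := fun x => (p i / x i) • x
  have hyd : DifferentiableOn ℂ y {x | x i ≠ 0} := by
    intro x hx
    have h1 : DifferentiableAt ℂ (fun x : Fin 3 → ℂ => x i) x := differentiableAt_apply i x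
    have h2 : DifferentiableAt ℂ (fun x : Fin 3 → ℂ => p i / x i) x :=
      by simpa only [div_eq_mul_inv] using (h1.fun_inv hx).const_mul (p i)
    exact (h2.fun_smul differentiableAt_fun_id).differentiableWithinAt
  have hopen : IsOpen {x : Fin 3 → ℂ | x i ≠ 0} :=
    isOpen_ne_fun (continuous_apply i) continuous_const
  have hyt : ∀ (t : ℂ) (x : Fin 3 → ℂ), t ≠ 0 → y (t • x) = y x := by
    intro t x ht
    by_cases hx : x i = 0
    · simp [y, hx]
    · simp only [y, Pi.smul_apply, smul_eq_mul, smul_smul]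
      congr 1
      field_simp
  have hyp : y p = p := by simp [y, hi]
  obtain ⟨V, hV⟩ := exists_cone_eq (S := {x | x i ≠ 0} ∩ y ⁻¹' ball p r)
    (hyd.continuousOn.isOpen_inter_preimage hopen isOpen_ball) (fun h => h.1 rfl)
    (fun t x ht hx => ⟨by simpa [ht] using hx.1, by
      rw [mem_preimage, hyt t x ht]; exact hx.2⟩)
  have hVi : ∀ x ∈ cone V, x i ≠ 0 := fun x hx => by rw [hV] at hx; exact hx.1
  have hVy : ∀ x ∈ cone V, y x ∈ ball p r := fun x hx => by rw [hV] at hx; exact hx.2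
  have hVU : V ≤ U := by
    refine le_of_cone_subset fun x hx => ?_
    have h1 := smul_mem_cone (t := (p i / x i)⁻¹) (by simp [hi, hVi x hx]) (hrU (hVy x hx))
    simp only [y] at h1
    rwa [inv_smul_smul₀ (by simp [hi, hVi x hx])] at h1
  have hpV : p ∈ cone V := by rw [hV]; exact ⟨hi, by simp [hyp, hr]⟩
  have hseg : ∀ z ∈ ball p r, ∀ t ∈ Icc (0 : ℝ) 1, p + (t : ℂ) • (z - p) ∈ ball p r := by
    intro z hz t ht
    rw [mem_ball, dist_eq_norm] at hz ⊢
    rw [add_sub_cancel_left, norm_smul, Complex.norm_real, Real.norm_of_nonneg ht.1]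
    exact lt_of_le_of_lt (mul_le_of_le_one_left (norm_nonneg _) ht.2) hz
  have hH : ∀ a, DifferentiableOn ℂ
      (fun z => ∫ t in (0 : ℝ)..1, f.dv a (p + (t : ℂ) • (z - p))) (ball p r) := by
    intro a
    refine differentiableOn_intervalIntegral isOpen_ball zero_le_one ?_ ?_
    · refine (f.differentiableOn_dv a).continuousOn.comp
        (f := fun q : (Fin 3 → ℂ) × ℝ => p + (q.2 : ℂ) • (q.1 - p)) ?_
        fun q hq => hrU (hseg _ hq.1 _ hq.2)
      have hcont : Continuous fun q : (Fin 3 → ℂ) × ℝ => p + (q.2 : ℂ) • (q.1 - p) :=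
        continuous_const.add ((Complex.continuous_ofReal.comp continuous_snd).smul
          (continuous_fst.sub continuous_const))
      exact hcont.continuousOn
    · intro t ht
      refine (f.differentiableOn_dv a).comp (f := fun z => p + (t : ℂ) • (z - p)) ?_
        fun z hz => hrU (hseg z hz t ht)
      exact (((differentiable_id.sub_const p).const_smul (t : ℂ)).const_add p).differentiableOn
  -- The factor `p i` appears because the a-th coordinate of `y x` - p is p_i (x_a / x_i - p_a /
  -- p_i).
  refine ⟨V, hVU, hpV, fun a => O.ofFun
    (fun x => p i * ∫ t in (0 : ℝ)..1, f.dv a (p + (t : ℂ) • (y x - p))) ?_ ?_, ?_, ?_⟩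
  · exact ((hH a).comp (hyd.mono hVi) hVy).const_mul _
  · intro t x ht _
    rw [hyt t x ht, zpow_zero, one_mul]
  · intro a
    rw [O.fn_ofFun _ _ hpV, hyp]
    simp
  · intro x hx
    have hz := hVy x hx
    have h1 : f.fn x = f.fn (y x) := by
      have := f.fn_smul_arg (t := p i / x i) (by simp [hi, hVi x hx]) (cone_mono hVU hx)
      rw [this]; simp
    have h2 : ∫ t in (0 : ℝ)..1, (∑ a, (y x - p) a * f.dv a (p + (t : ℂ) • (y x - p))) =
        f.fn (y x) - f.fn p := by
      have h3 := intervalIntegral.integral_eq_sub_of_hasDerivAt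
        (f := fun t : ℝ => f.fn (p + (t : ℂ) • (y x - p)))
        (f' := fun t : ℝ => ∑ a, (y x - p) a * f.dv a (p + (t : ℂ) • (y x - p))) (a := 0) (b := 1)
        ?_ ?_
      · simpa using h3
      · intro t ht
        rw [uIcc_of_le zero_le_one] at ht
        rw [← O.fderiv_fn_apply]
        have h4 : HasDerivAt (fun t : ℝ => p + (t : ℂ) • (y x - p)) (y x - p) t := by
          simpa using ((hasDerivAt_id t).ofReal_comp.smul_const (y x - p)).const_add p
        have h5 := (f.differentiableAt_fn (hrU (hseg _ hz t ht))).hasFDerivAt.restrictScalars ℝ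
        exact h5.comp_hasDerivAt t h4
      · refine ContinuousOn.intervalIntegrable_of_Icc zero_le_one ?_
        refine continuousOn_finsetSum _ fun a _ => continuousOn_const.mul ?_
        refine (f.differentiableOn_dv a).continuousOn.comp
          (f := fun t : ℝ => p + (t : ℂ) • (y x - p)) ?_ fun t ht => hrU (hseg _ hz _ ht)
        exact (continuous_const.add (Complex.continuous_ofReal.smul continuous_const)).continuousOn
    rw [intervalIntegral.integral_finsetSum] at h2
    · rw [h1, ← sub_eq_iff_eq_add', ← h2]
      refine Finset.sum_congr rfl fun a _ => ?_
      rw [O.fn_ofFun _ _ hx, intervalIntegral.integral_const_mul, ← mul_assoc]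
      congr 1
      have := hVi x hx
      simp only [y, Pi.sub_apply, Pi.smul_apply, smul_eq_mul]
      field_simp
    · intro a _
      refine ContinuousOn.intervalIntegrable_of_Icc zero_le_one (continuousOn_const.mul ?_)
      refine (f.differentiableOn_dv a).continuousOn.comp
        (f := fun t : ℝ => p + (t : ℂ) • (y x - p)) ?_ fun t ht => hrU (hseg _ hz _ ht)
      exact (continuous_const.add (Complex.continuous_ofReal.smul continuous_const)).continuousOn

end Hadamard

namespace T

variable {k m : ℤ} {V W : Opens P2}

/-- The action of a derivation on functions over an open subset. -/
def app (D : T m W) (hV : V ≤ W) : O 0 V →ₗ[ℂ] O m V := D.1 ⟨V, hV⟩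

theorem ext_app {D E : T m W} (h : ∀ V (hV : V ≤ W) (f : O 0 V), D.app hV f = E.app hV f) :
    D = E :=
  Subtype.ext (funext fun V => LinearMap.ext fun f => h V.1 V.2 f)

@[simp]
theorem app_zero (hV : V ≤ W) (f : O 0 V) : (0 : T m W).app hV f = 0 := rfl

theorem res_app {V' : Opens P2} (D : T m W) (hV : V ≤ W) (h : V' ≤ V) (f : O 0 V) :
    O.res h (D.app hV f) = D.app (h.trans hV) (O.res h f) :=
  (D.2.1 ⟨V, hV⟩ ⟨V', h.trans hV⟩ h f).symm

theorem fn_app_mul (D : T m W) (hV : V ≤ W) (f g : O 0 V) (x : Fin 3 → ℂ) :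
    (D.app hV (O.mul (add_zero 0) f g)).fn x =
      f.fn x * (D.app hV g).fn x + g.fn x * (D.app hV f).fn x := by
  have := D.2.2 ⟨V, hV⟩ f g
  change D.app hV (O.mul (add_zero 0) f g) = _ at this
  rw [this]
  simp
  rfl

theorem app_one (D : T m W) (hV : V ≤ W) : D.app hV (O.one V) = 0 := by
  refine O.ext_fn fun x hx => ?_
  have h := D.fn_app_mul hV (O.one V) (O.one V) x
  have e : O.mul (add_zero 0) (O.one V) (O.one V) = O.one V := O.ext_fn fun x hx => by simp [hx]
  rw [e, O.fn_one hx] at h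
  simpa using h

/-- The derivation given by a vector field. -/
def ofField (w : Fin 3 → O (m + 1) W) : T m W :=
  ⟨fun V => O.act (add_zero (m + 1)) (Set.mem_Iic.1 V.2) w,
    fun V V' h f => (O.res_act _ _ h w f).symm,
    fun V f g => O.ext_fn fun x hx => by
      simp only [O.fn_act _ _ _ _ hx, O.fn_add, O.fn_mul, O.dv_mul _ _ _ _ hx, Finset.mul_sum,
        ← Finset.sum_add_distrib]
      exact Finset.sum_congr rfl fun a _ => by ring⟩

@[simp]
theorem app_ofField (w : Fin 3 → O (m + 1) W) (hV : V ≤ W) (f : O 0 V) :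
    (ofField w).app hV f = O.act (add_zero (m + 1)) hV w f := rfl

/-- The coefficients, with respect to the homogeneous coordinates, of a lift of a derivation over
the chart `U_i` to the cone. -/
def field (D : T m W) {i : Fin 3} (hW : W ≤ chart i) (a : Fin 3) : O (m + 1) W :=
  O.mul (add_comm 1 m) (O.X i W)
    (D.app le_rfl (O.mul (add_neg_cancel 1) (O.X a W) (O.Xpow i (-1) hW)))

/-- By Hadamard, near p one has f = f(p) + ∑ (x_a/x_i - p_a/p_i) g_a. Apply D and evaluate at p: the
terms with D(g_a) vanish, and g_a(p) = p_i ∂_a f(p) produces the coefficients x_i D(x_a/x_i). -/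
theorem app_eq_act (D : T m W) {i : Fin 3} (hW : W ≤ chart i) (hV : V ≤ W) (f : O 0 V) :
    D.app hV f = O.act (add_zero (m + 1)) hV (D.field hW) f := by
  refine O.ext_fn fun p hp => ?_
  have hi : p i ≠ 0 := mem_cone_chart.1 (cone_mono (hV.trans hW) hp)
  obtain ⟨V', hV', hpV, g, hg, hfg⟩ := O.exists_hadamard f hp hi
  let z : Fin 3 → O 0 V' := fun a => O.res (hV'.trans hV)
    (O.mul (add_neg_cancel 1) (O.X a W) (O.Xpow i (-1) hW))
  have e : O.res hV' f = f.fn p • O.one V' +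
      ∑ a, O.mul (add_zero 0) (z a - (p a / p i) • O.one V') (g a) := by
    refine O.ext_fn fun x hx => ?_
    have hxW := cone_mono (hV'.trans hV) hx
    simp only [O.fn_res _ _ hx, O.fn_add, O.fn_smul, O.fn_one hx, O.fn_sum, O.fn_mul, O.fn_sub, z,
      O.fn_X _ hxW, O.fn_Xpow _ _ hxW, zpow_neg_one, mul_one]
    rw [hfg x hx]
    rfl
  have e2 : (D.app hV f).fn p = (D.app (hV'.trans hV) (O.res hV' f)).fn p := by
    rw [← res_app, O.fn_res _ _ hpV]
  have hpW := cone_mono hV hp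
  rw [e2, e, O.fn_act _ _ _ _ hp]
  simp only [map_add, map_smul, app_one, map_sum, O.fn_add, O.fn_sum, fn_app_mul, map_sub,
    O.fn_sub, O.fn_smul, O.fn_zero, mul_zero, zero_add, sub_zero, hg, O.fn_one hpV]
  refine Finset.sum_congr rfl fun a _ => ?_
  simp only [field, O.fn_mul, z, O.fn_res _ _ hpV, O.fn_X _ hpW,
    O.fn_Xpow _ _ hpW, zpow_neg_one]
  have hz : (D.app (hV'.trans hV) (O.res (hV'.trans hV)
      (O.mul (add_neg_cancel 1) (O.X a W) (O.Xpow i (-1) hW)))).fn p =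
      (D.app le_rfl (O.mul (add_neg_cancel 1) (O.X a W) (O.Xpow i (-1) hW))).fn p := by
    rw [← res_app D le_rfl (hV'.trans hV), O.fn_res _ _ hpV]
  rw [hz]
  field_simp
  ring

end T

/-! ### Global sections of `𝒪(k)` -/

namespace O

open Filter Topology

/-- Liouville on the line p + t e_j, which misses the origin since p_i ≠ 0. Homogeneity gives h(p +
t e_j) = t⁻ⁿ h(e_j + t⁻¹ p), whose limit at infinity is the right side. The convention 0⁰ = 1 treats
the constants (n = 0) and the vanishing (n > 0) together. -/
theorem fn_top_of_nonpos {n : ℕ} (h : O (-n) ⊤) {p : Fin 3 → ℂ} {i j : Fin 3} (hij : i ≠ j)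
    (hp : p i ≠ 0) : h.fn p = 0 ^ n * h.fn (Pi.single j 1) := by
  set q : Fin 3 → ℂ := Pi.single j 1 with hq
  have hqi : q i = 0 := by simp [hq, hij]
  have hqj : q j = 1 := by simp [hq]
  have h1 : ∀ t : ℂ, p + t • q ∈ cone ⊤ := fun t => mem_cone_top.2 fun e => hp (by
    simpa [hqi] using congrFun e i)
  have h2 : ∀ s : ℂ, q + s • p ∈ cone ⊤ := fun s => mem_cone_top.2 fun e => by
    have e1 := congrFun e i
    simp only [Pi.add_apply, hqi, Pi.smul_apply, smul_eq_mul, Pi.zero_apply, zero_add,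
      mul_eq_zero, hp, or_false] at e1
    have e2 := congrFun e j
    simp [hqj, e1] at e2
  have hd : Differentiable ℂ fun t : ℂ => h.fn (p + t • q) := fun t =>
    (h.differentiableAt_fn (h1 t)).comp t (f := fun t : ℂ => p + t • q)
      (((differentiableAt_fun_id).smul_const q).const_add p)
  have hlim : Tendsto (fun t : ℂ => h.fn (p + t • q)) (cocompact ℂ) (𝓝 (0 ^ n * h.fn q)) := by
    have h3 : ContinuousAt (fun s : ℂ => s ^ n * h.fn (q + s • p)) 0 := by
      refine ContinuousAt.mul (by fun_prop) ?_
      exact ContinuousAt.comp (f := fun s : ℂ => q + s • p)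
        (h.differentiableAt_fn (h2 0)).continuousAt (by fun_prop)
    have h4 : Tendsto (fun t : ℂ => t⁻¹) (cocompact ℂ) (𝓝 0) := by
      rw [← Metric.cobounded_eq_cocompact]
      exact tendsto_inv₀_cobounded
    have h5 := h3.tendsto.comp h4
    simp only [zero_smul, add_zero] at h5
    refine h5.congr' ?_
    have h6 : ∀ᶠ t : ℂ in cocompact ℂ, t ≠ 0 := isCompact_singleton.compl_mem_cocompact
    filter_upwards [h6] with t ht
    have h7 : p + t • q = t • (q + t⁻¹ • p) := by
      rw [smul_add, smul_inv_smul₀ ht, add_comm]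
    rw [h7, h.fn_smul_arg ht (h2 _), zpow_neg, zpow_natCast]
    simp
  simpa using hd.apply_eq_of_tendsto_cocompact 0 hlim

theorem eq_zero_of_neg {k : ℤ} (hk : k < 0) (h : O k ⊤) : h = 0 := by
  obtain ⟨n, rfl⟩ : ∃ n : ℕ, k = -n := ⟨k.natAbs, by omega⟩
  refine ext_fn fun x hx => ?_
  obtain ⟨i, hi⟩ := exists_coord_ne_zero (ne_zero_of_mem_cone hx)
  obtain ⟨j, hj⟩ := exists_ne i
  rw [fn_top_of_nonpos h hj.symm hi, zero_pow (by omega)]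
  simp

theorem eq_smul_one (h : O 0 ⊤) : ∃ c : ℂ, h = c • O.one ⊤ := by
  have key : ∀ (p : Fin 3 → ℂ) (i j : Fin 3), i ≠ j → p i ≠ 0 → h.fn p = h.fn (Pi.single j 1) := by
    intro p i j hij hp
    have := fn_top_of_nonpos (n := 0) h hij hp
    rwa [pow_zero, one_mul] at this
  have h1 : ∀ j, h.fn (Pi.single j 1) = h.fn (Pi.single 0 1) := fun j => by
    by_cases hj : j = 0
    · rw [hj]
    · exact key _ j 0 hj (by simp)
  refine ⟨h.fn (Pi.single 0 1), ext_fn fun x hx => ?_⟩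
  obtain ⟨i, hi⟩ := exists_coord_ne_zero (ne_zero_of_mem_cone hx)
  obtain ⟨j, hj⟩ := exists_ne i
  rw [key x i j hj.symm hi, h1 j, fn_smul, fn_one hx, mul_one]

theorem single_mem_cone_top (a : Fin 3) : (Pi.single a 1 : Fin 3 → ℂ) ∈ cone ⊤ :=
  mem_cone_top.2 fun h => by simpa using congrFun h a

/-- The constant functions. -/
def constEquiv : ℂ ≃ₗ[ℂ] O 0 ⊤ :=
  LinearEquiv.ofBijective ((LinearMap.id (R := ℂ) (M := ℂ)).smulRight (O.one ⊤)) <| by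
    refine ⟨fun a b h => ?_, fun h => ?_⟩
    · have := congrArg (fun f => f.fn (Pi.single 0 1)) h
      simpa [fn_one (single_mem_cone_top 0)] using this
    · obtain ⟨c, rfl⟩ := eq_smul_one h
      exact ⟨c, rfl⟩

/-- The partial derivatives have degree 0, hence are constant, and Euler's identity recovers h from
them. -/
theorem exists_linear (h : O 1 ⊤) : ∃ c : Fin 3 → ℂ, h = ∑ a, c a • X a ⊤ := by
  choose c hc using fun a => eq_smul_one (pd (zero_add 1) a h)
  refine ⟨c, ext_fn fun x hx => ?_⟩
  have h1 := euler h hx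
  simp only [← fn_pd (zero_add 1) _ h hx, hc, fn_smul, fn_one hx] at h1
  simp only [fn_sum, fn_smul, fn_X _ hx]
  simp only [Fin.sum_univ_three] at h1 ⊢
  push_cast at h1
  linear_combination -h1

/-- The linear forms. -/
def linearEquiv : (Fin 3 → ℂ) ≃ₗ[ℂ] O 1 ⊤ :=
  LinearEquiv.ofBijective (Fintype.linearCombination ℂ fun a => X a ⊤) <| by
    refine ⟨fun c d h => ?_, fun h => ?_⟩
    · funext a
      have := congrArg (fun f => f.fn (Pi.single a 1)) h
      simpa [Fintype.linearCombination_apply, fn_X _ (single_mem_cone_top a), Pi.single_apply]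
        using this
    · obtain ⟨c, rfl⟩ := exists_linear h
      exact ⟨c, rfl⟩

/-- The quadratic monomials. -/
def quad : Fin 6 → O 2 ⊤ :=
  ![mul (by norm_num) (X 0 ⊤) (X 0 ⊤), mul (by norm_num) (X 1 ⊤) (X 1 ⊤),
    mul (by norm_num) (X 2 ⊤) (X 2 ⊤), mul (by norm_num) (X 0 ⊤) (X 1 ⊤),
    mul (by norm_num) (X 0 ⊤) (X 2 ⊤), mul (by norm_num) (X 1 ⊤) (X 2 ⊤)]

theorem fn_quad_sum (c : Fin 6 → ℂ) {x : Fin 3 → ℂ} (hx : x ∈ cone ⊤) :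
    (Fintype.linearCombination ℂ quad c).fn x = c 0 * x 0 ^ 2 + c 1 * x 1 ^ 2 + c 2 * x 2 ^ 2 +
      c 3 * (x 0 * x 1) + c 4 * (x 0 * x 2) + c 5 * (x 1 * x 2) := by
  simp only [Fintype.linearCombination_apply, Fin.sum_univ_six, quad, fn_add, fn_smul]
  simp [fn_X _ hx]
  ring

/-- The quadratic forms. -/
def quadEquiv : (Fin 6 → ℂ) ≃ₗ[ℂ] O 2 ⊤ :=
  LinearEquiv.ofBijective (Fintype.linearCombination ℂ quad) <| by
    refine ⟨(injective_iff_map_eq_zero _).2 fun c h => ?_, fun h => ?_⟩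
    · have key : ∀ x : Fin 3 → ℂ, x ≠ 0 → c 0 * x 0 ^ 2 + c 1 * x 1 ^ 2 + c 2 * x 2 ^ 2 +
          c 3 * (x 0 * x 1) + c 4 * (x 0 * x 2) + c 5 * (x 1 * x 2) = 0 := fun x hx => by
        rw [← fn_quad_sum c (mem_cone_top.2 hx), h, fn_zero]
      have h0 := key ![1, 0, 0] (by simp)
      have h1 := key ![0, 1, 0] (by simp)
      have h2 := key ![0, 0, 1] (by simp)
      have h3 := key ![1, 1, 0] (by simp)
      have h4 := key ![1, 0, 1] (by simp)
      have h5 := key ![0, 1, 1] (by simp)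
      simp at h0 h1 h2 h3 h4 h5
      simp only [h0, h1, h2, zero_add, add_zero] at h3 h4 h5
      funext a
      fin_cases a <;> assumption
    · choose M hM using fun a => exists_linear (pd (by norm_num : (1 : ℤ) + 1 = 2) a h)
      refine ⟨![M 0 0 / 2, M 1 1 / 2, M 2 2 / 2, (M 0 1 + M 1 0) / 2, (M 0 2 + M 2 0) / 2,
        (M 1 2 + M 2 1) / 2], ext_fn fun x hx => ?_⟩
      rw [fn_quad_sum _ hx]
      have h1 := euler h hx
      simp only [← fn_pd (by norm_num : (1 : ℤ) + 1 = 2) _ h hx, hM, fn_add, fn_smul,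
        fn_X _ hx, Fin.sum_univ_three] at h1
      push_cast at h1
      simp
      linear_combination h1 / 2

instance : Module.Finite ℂ (O 0 ⊤) := Module.Finite.equiv constEquiv
instance : Module.Finite ℂ (O 1 ⊤) := Module.Finite.equiv linearEquiv
instance : Module.Finite ℂ (O 2 ⊤) := Module.Finite.equiv quadEquiv

theorem finrank_zero_top : Module.finrank ℂ (O 0 ⊤) = 1 := by
  simp [← constEquiv.finrank_eq]

theorem finrank_one_top : Module.finrank ℂ (O 1 ⊤) = 3 := by
  simp [← linearEquiv.finrank_eq]

theorem finrank_two_top : Module.finrank ℂ (O 2 ⊤) = 6 := by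
  simp [← quadEquiv.finrank_eq]

end O

/-! ### The first cohomology of `𝒪(k)` vanishes -/

section Cech

open Set Metric Function

/-- The substitution ζ ↦ t ζ scales the circle by ‖t‖ and rotates it by arg t; periodicity absorbs
the rotation. This is what makes the Cauchy projection homogeneous. -/
theorem circleIntegral_mul_left (G : ℂ → ℂ) (t : ℂ) (R : ℝ) :
    (∮ ζ in C(0, ‖t‖ * R), G ζ) = t * ∮ ζ in C(0, R), G (t * ζ) := by
  have h1 : ∀ θ : ℝ, circleMap 0 (‖t‖ * R) (θ + t.arg) = t * circleMap 0 R θ := by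
    intro θ
    conv_rhs => rw [← Complex.norm_mul_exp_arg_mul_I t]
    simp only [circleMap, zero_add, Complex.ofReal_mul, Complex.ofReal_add, add_mul, Complex.exp_add]
    ring
  have hper : Periodic (fun θ : ℝ => deriv (circleMap 0 (‖t‖ * R)) θ •
      G (circleMap 0 (‖t‖ * R) θ)) (2 * Real.pi) := by
    intro θ
    simp only [deriv_circleMap, periodic_circleMap 0 _ θ]
  have h2 := hper.intervalIntegral_add_eq 0 (0 + t.arg)
  simp only [circleIntegral]
  rw [zero_add] at h2
  rw [h2, show 0 + t.arg + 2 * Real.pi = 2 * Real.pi + t.arg by ring,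
    ← intervalIntegral.integral_comp_add_right, ← intervalIntegral.integral_const_mul]
  refine intervalIntegral.integral_congr fun θ _ => ?_
  simp only [deriv_circleMap, h1, smul_eq_mul]
  ring

namespace O

variable {k : ℤ} {a b : Fin 3} {x : Fin 3 → ℂ}

theorem update_mem_cone (hab : a ≠ b) {ζ : ℂ} (hζ : ζ ≠ 0) (hx : x b ≠ 0) :
    update x a ζ ∈ cone (chart a ⊓ chart b) := by
  simp [hζ, hab.symm, hx]

theorem differentiable_update (x : Fin 3 → ℂ) (a : Fin 3) :
    Differentiable ℂ fun ζ : ℂ => update x a ζ := by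
  rw [differentiable_pi]
  intro c
  by_cases hc : c = a
  · subst hc; simp
  · simp [hc]

theorem differentiable_update' (a : Fin 3) (ζ : ℂ) :
    Differentiable ℂ fun x : Fin 3 → ℂ => update x a ζ := by
  rw [differentiable_pi]
  intro c
  by_cases hc : c = a
  · subst hc; simp
  · simpa [hc] using differentiable_apply c

/-- The Cauchy integral over a circle in the direction of the `a`-th coordinate. -/
def cauchyInt (f : O k (chart a ⊓ chart b)) (R : ℝ) (x : Fin 3 → ℂ) : ℂ :=
  (2 * Real.pi * Complex.I : ℂ)⁻¹ • ∮ ζ in C(0, R), (ζ - x a)⁻¹ • f.fn (update x a ζ)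

theorem differentiableAt_cauchy_integrand (hab : a ≠ b) (f : O k (chart a ⊓ chart b))
    (hx : x b ≠ 0) {ζ : ℂ} (hζ : ‖x a‖ < ‖ζ‖) :
    DifferentiableAt ℂ (fun ζ => (ζ - x a)⁻¹ • f.fn (update x a ζ)) ζ := by
  have h1 : ζ - x a ≠ 0 := sub_ne_zero.2 fun h => by rw [h] at hζ; exact lt_irrefl _ hζ
  have h2 : ζ ≠ 0 := norm_pos_iff.1 ((norm_nonneg _).trans_lt hζ)
  refine DifferentiableAt.fun_smul ((differentiableAt_fun_id.sub_const _).fun_inv h1) ?_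
  exact (f.differentiableAt_fn (update_mem_cone hab h2 hx)).comp ζ
    (f := fun ζ : ℂ => update x a ζ) (differentiable_update x a ζ)

/-- The integrand is holomorphic for |ζ| > |x_a|, so the radius is immaterial. It can therefore be
frozen near a given point, which gives holomorphy although the radius ‖x_a‖ + 1 is not holomorphic
in x. -/
theorem cauchyInt_eq_of_le (hab : a ≠ b) (f : O k (chart a ⊓ chart b)) (hx : x b ≠ 0) {r R : ℝ}
    (hr : ‖x a‖ < r) (hR : r ≤ R) : cauchyInt f R x = cauchyInt f r x := by
  have hr0 : 0 < r := (norm_nonneg _).trans_lt hr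
  have hd : ∀ ζ : ℂ, r ≤ ‖ζ‖ →
      DifferentiableAt ℂ (fun ζ => (ζ - x a)⁻¹ • f.fn (update x a ζ)) ζ := fun ζ hζ =>
    differentiableAt_cauchy_integrand hab f hx (hr.trans_le hζ)
  unfold cauchyInt
  rw [Complex.circleIntegral_eq_of_differentiable_on_annulus_off_countable hr0 hR
    Set.countable_empty]
  · intro ζ hζ
    refine (hd ζ ?_).continuousAt.continuousWithinAt
    simpa using hζ.2
  · intro ζ hζ
    refine hd ζ ?_
    have := hζ.1.2
    simp only [mem_closedBall, dist_zero_right, not_le] at this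
    exact this.le

theorem cauchyInt_eq (hab : a ≠ b) (f : O k (chart a ⊓ chart b)) (hx : x b ≠ 0) {r R : ℝ}
    (hr : ‖x a‖ < r) (hR : ‖x a‖ < R) : cauchyInt f R x = cauchyInt f r x := by
  rcases le_total r R with h | h
  · exact cauchyInt_eq_of_le hab f hx hr h
  · exact (cauchyInt_eq_of_le hab f hx hR h).symm

theorem differentiableOn_cauchyInt (hab : a ≠ b) (f : O k (chart a ⊓ chart b)) {R : ℝ}
    (hR : 0 < R) : DifferentiableOn ℂ (cauchyInt f R) {x | x b ≠ 0 ∧ ‖x a‖ < R} := by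
  have hopen : IsOpen {x : Fin 3 → ℂ | x b ≠ 0 ∧ ‖x a‖ < R} :=
    (isOpen_ne_fun (continuous_apply b) continuous_const).inter
      (isOpen_lt (continuous_apply a).norm continuous_const)
  have hne : ∀ x ∈ {x : Fin 3 → ℂ | x b ≠ 0 ∧ ‖x a‖ < R}, ∀ ζ ∈ sphere (0 : ℂ) R,
      ζ - x a ≠ 0 := fun x hx ζ hζ => sub_ne_zero.2 fun h => by
    rw [mem_sphere_zero_iff_norm, h] at hζ
    linarith [hx.2]
  have hne0 : ∀ ζ ∈ sphere (0 : ℂ) R, ζ ≠ 0 := fun ζ hζ => ne_zero_of_mem_sphere hR.ne' ⟨ζ, hζ⟩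
  have key : DifferentiableOn ℂ
      (fun x => ∮ ζ in C(0, R), (ζ - x a)⁻¹ • f.fn (update x a ζ))
      {x | x b ≠ 0 ∧ ‖x a‖ < R} := by
    refine differentiableOn_circleIntegral hopen hR.le ?_ ?_
    · have h1 : ContinuousOn (fun p : (Fin 3 → ℂ) × ℂ => (p.2 - p.1 a)⁻¹)
          ({x : Fin 3 → ℂ | x b ≠ 0 ∧ ‖x a‖ < R} ×ˢ sphere (0 : ℂ) R) :=
        ContinuousOn.inv₀ (by fun_prop) fun p hp => hne p.1 hp.1 p.2 hp.2
      refine h1.smul (f.differentiableOn_fn.continuousOn.comp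
        (f := fun p : (Fin 3 → ℂ) × ℂ => update p.1 a p.2) ?_
        fun p hp => update_mem_cone hab (hne0 p.2 hp.2) hp.1.1)
      exact (continuous_fst.update a continuous_snd).continuousOn
    · intro ζ hζ x hx
      have h1 : DifferentiableAt ℂ (fun x : Fin 3 → ℂ => (ζ - x a)⁻¹) x :=
        ((differentiableAt_apply a x).const_sub ζ).fun_inv (hne x hx ζ hζ)
      exact (h1.fun_smul ((f.differentiableAt_fn (update_mem_cone hab (hne0 ζ hζ) hx.1)).comp x
        (f := fun x : Fin 3 → ℂ => update x a ζ)
        (differentiable_update' a ζ x))).differentiableWithinAt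
  exact key.const_smul (2 * Real.pi * Complex.I : ℂ)⁻¹

theorem differentiableOn_cauchyInt_chart (hab : a ≠ b) (f : O k (chart a ⊓ chart b)) :
    DifferentiableOn ℂ (fun x => cauchyInt f (‖x a‖ + 1) x) (cone (chart b)) := by
  intro x₀ hx₀
  rw [mem_cone_chart] at hx₀
  have hR : 0 < ‖x₀ a‖ + 1 := by positivity
  have hmem : {x : Fin 3 → ℂ | x b ≠ 0 ∧ ‖x a‖ < ‖x₀ a‖ + 1} ∈ nhds x₀ :=
    ((isOpen_ne_fun (continuous_apply b) continuous_const).inter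
      (isOpen_lt (continuous_apply a).norm continuous_const)).mem_nhds
        ⟨hx₀, by simp⟩
  refine (((differentiableOn_cauchyInt hab f hR).differentiableAt hmem).congr_of_eventuallyEq
    ?_).differentiableWithinAt
  filter_upwards [hmem] with x hx
  exact cauchyInt_eq hab f hx.1 hx.2 (lt_add_one _)

theorem cauchyInt_smul (hab : a ≠ b) (f : O k (chart a ⊓ chart b)) (t : ℂ) (x : Fin 3 → ℂ)
    (ht : t ≠ 0) (hx : x ∈ cone (chart b)) :
    cauchyInt f (‖(t • x) a‖ + 1) (t • x) = t ^ k * cauchyInt f (‖x a‖ + 1) x := by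
  rw [mem_cone_chart] at hx
  have ht' : 0 < ‖t‖ := norm_pos_iff.2 ht
  have h1 : ‖(t • x) a‖ < ‖t‖ * (‖x a‖ + 1) := by
    rw [Pi.smul_apply, norm_smul]
    exact mul_lt_mul_of_pos_left (lt_add_one _) ht'
  rw [cauchyInt_eq hab f (by simp [ht, hx]) h1 (lt_add_one _)]
  unfold cauchyInt
  rw [circleIntegral_mul_left, smul_eq_mul, smul_eq_mul, mul_left_comm (t ^ k)]
  congr 1
  rw [← circleIntegral.integral_const_mul, ← circleIntegral.integral_const_mul]
  refine circleIntegral.integral_congr (by positivity) fun ζ hζ => ?_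
  have hζ0 : ζ ≠ 0 := ne_zero_of_mem_sphere (by positivity) ⟨ζ, hζ⟩
  have h2 : update (t • x) a (t * ζ) = t • update x a ζ := by
    rw [← smul_eq_mul, update_smul]
  have h3 : ζ - x a ≠ 0 := sub_ne_zero.2 fun h => by
    rw [mem_sphere_zero_iff_norm, h] at hζ
    linarith
  simp only [h2, f.fn_smul_arg ht (update_mem_cone hab hζ0 hx), Pi.smul_apply, smul_eq_mul]
  rw [← mul_sub, mul_inv]
  field_simp

/-- The part of a section over `U_a ∩ U_b` that extends to `U_b`. -/
def proj (hab : a ≠ b) (f : O k (chart a ⊓ chart b)) : O k (chart b) :=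
  ofFun (fun x => cauchyInt f (‖x a‖ + 1) x) (differentiableOn_cauchyInt_chart hab f)
    (cauchyInt_smul hab f)

theorem circleIntegral_cauchy {H : ℂ → ℂ} (hH : Differentiable ℂ H) (w : ℂ) :
    (2 * Real.pi * Complex.I : ℂ)⁻¹ • (∮ ζ in C(0, ‖w‖ + 1), (ζ - w)⁻¹ • H ζ) = H w :=
  hH.diffContOnCl.two_pi_i_inv_smul_circleIntegral_sub_inv_smul (by simp)

/-- The projection keeps the nonnegative powers of x_a in the Laurent expansion, so it fixes
whatever extends across x_a = 0. -/
theorem fn_proj_of_entire (hab : a ≠ b) (f : O k (chart a ⊓ chart b)) (hx : x b ≠ 0) {H : ℂ → ℂ}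
    (hH : Differentiable ℂ H) (hf : ∀ ζ ≠ 0, f.fn (update x a ζ) = H ζ) :
    (proj hab f).fn x = H (x a) := by
  unfold proj
  rw [fn_ofFun _ _ (mem_cone_chart.2 hx), ← circleIntegral_cauchy hH (x a)]
  unfold cauchyInt
  congr 1
  refine circleIntegral.integral_congr (by positivity) fun ζ hζ => ?_
  have hζ0 : ζ ≠ 0 := ne_zero_of_mem_sphere (by positivity) ⟨ζ, hζ⟩
  simp only [hf ζ hζ0]

/-- Additivity of the projection for sections over different overlaps: only the values on one line
in direction a matter, and there the difference extends across 0. -/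
theorem fn_proj_sub (hab : a ≠ b) {c : Fin 3} (hac : a ≠ c) (f : O k (chart a ⊓ chart b))
    (g : O k (chart a ⊓ chart c)) (hb : x b ≠ 0) (hc : x c ≠ 0) {H : ℂ → ℂ}
    (hH : Differentiable ℂ H) (hfg : ∀ ζ ≠ 0, g.fn (update x a ζ) - f.fn (update x a ζ) = H ζ) :
    (proj hac g).fn x - (proj hab f).fn x = H (x a) := by
  unfold proj
  rw [fn_ofFun _ _ (mem_cone_chart.2 hb), fn_ofFun _ _ (mem_cone_chart.2 hc),
    ← circleIntegral_cauchy hH (x a)]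
  unfold cauchyInt
  rw [← smul_sub, ← circleIntegral.integral_sub]
  · congr 1
    refine circleIntegral.integral_congr (by positivity) fun ζ hζ => ?_
    have hζ0 : ζ ≠ 0 := ne_zero_of_mem_sphere (by positivity) ⟨ζ, hζ⟩
    simp only [← hfg ζ hζ0, smul_sub]
  · refine ContinuousOn.circleIntegrable (by positivity) fun ζ hζ =>
      (differentiableAt_cauchy_integrand hac g hc ?_).continuousAt.continuousWithinAt
    rw [mem_sphere_zero_iff_norm.1 hζ]; exact lt_add_one _
  · refine ContinuousOn.circleIntegrable (by positivity) fun ζ hζ =>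
      (differentiableAt_cauchy_integrand hab f hb ?_).continuousAt.continuousWithinAt
    rw [mem_sphere_zero_iff_norm.1 hζ]; exact lt_add_one _

/-- The points with x_c ≠ 0 are dense: x is the limit of x + t e_c as t → 0. -/
theorem eq_of_eq_on_chart {U : Opens P2} {f g : O k U} (c : Fin 3)
    (h : ∀ x ∈ cone U, x c ≠ 0 → f.fn x = g.fn x) : f = g := by
  refine ext_fn fun x hx => ?_
  by_cases hxc : x c ≠ 0
  · exact h x hx hxc
  have hline : Continuous fun t : ℂ => x + t • (Pi.single c 1 : Fin 3 → ℂ) := by fun_prop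
  have hx0 : x + (0 : ℂ) • (Pi.single c 1 : Fin 3 → ℂ) ∈ cone U := by simpa using hx
  have hc : ∀ F : O k U, Filter.Tendsto
      (fun t : ℂ => F.fn (x + t • (Pi.single c 1 : Fin 3 → ℂ))) (nhdsWithin 0 {0}ᶜ)
      (nhds (F.fn x)) := by
    intro F
    have h1 := ContinuousAt.comp (f := fun t : ℂ => x + t • (Pi.single c 1 : Fin 3 → ℂ)) (x := 0)
      (F.differentiableAt_fn hx0).continuousAt hline.continuousAt
    simpa [Function.comp_def] using h1.tendsto.mono_left nhdsWithin_le_nhds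
  refine tendsto_nhds_unique ((hc f).congr' ?_) (hc g)
  have h3 : ∀ᶠ t : ℂ in nhds 0, x + t • (Pi.single c 1 : Fin 3 → ℂ) ∈ cone U :=
    hline.continuousAt.preimage_mem_nhds ((isOpen_cone U).mem_nhds hx0)
  filter_upwards [nhdsWithin_le_nhds h3, self_mem_nhdsWithin] with t ht ht'
  exact h _ ht (by simpa [not_not.1 hxc] using ht')

/-- The vanishing of `H¹(ℙ², 𝒪(k))`. -/
theorem exists_cech_primitive (f : ∀ i j, O k (chart i ⊓ chart j))
    (hf : ∀ i j l x, x i ≠ 0 → x j ≠ 0 → x l ≠ 0 →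
      (f j l).fn x - (f i l).fn x + (f i j).fn x = 0) :
    ∃ g : ∀ i, O k (chart i), ∀ i j x, x i ≠ 0 → x j ≠ 0 →
      (g j).fn x - (g i).fn x = (f i j).fn x := by
  have hdiag : ∀ i x, x i ≠ 0 → (f i i).fn x = 0 := fun i x hi => by
    simpa using hf i i i x hi hi hi
  have hanti : ∀ i j x, x i ≠ 0 → x j ≠ 0 → (f j i).fn x = -(f i j).fn x := fun i j x hi hj => by
    have := hf i j i x hi hj hi
    rw [hdiag i x hi] at this
    linear_combination this
  have hent : ∀ {a : Fin 3} {V : Opens P2} (F : O k V) (x : Fin 3 → ℂ),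
      (∀ ζ, update x a ζ ∈ cone V) → Differentiable ℂ fun ζ => F.fn (update x a ζ) :=
    fun {a} V F x h ζ => (F.differentiableAt_fn (h ζ)).comp ζ (f := fun ζ : ℂ => update x a ζ)
      (differentiable_update x a ζ)
  -- Take the parts of f₀₁ and f₀₂ regular along x₀ = 0. Their difference is the regular part of f₀₂
  -- - f₀₁ = f₁₂, which is f₁₂ itself since f₁₂ has no pole along x₀ = 0.
  let g1 : O k (chart 1) := proj (by decide : (0 : Fin 3) ≠ 1) (f 0 1)
  let g2 : O k (chart 2) := proj (by decide : (0 : Fin 3) ≠ 2) (f 0 2)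
  have h12 : ∀ x, x 1 ≠ 0 → x 2 ≠ 0 → g2.fn x - g1.fn x = (f 1 2).fn x := by
    intro x h1 h2
    rw [fn_proj_sub (by decide : (0 : Fin 3) ≠ 1) (by decide : (0 : Fin 3) ≠ 2) (f 0 1) (f 0 2) h1 h2
      (H := fun ζ => (f 1 2).fn (update x 0 ζ)) (hent _ x fun ζ => by simp [h1, h2])]
    · rw [update_eq_self]
    · intro ζ hζ
      linear_combination -hf 0 1 2 (update x 0 ζ) (by simpa using hζ) (by simpa using h1)
        (by simpa using h2)
  -- The section g₀ must be g₁ - f₀₁ on U₀ ∩ U₁ and g₂ - f₀₂ on U₀ ∩ U₂. The second expression has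
  -- no pole along x₁ = 0, so projecting the first in the direction of x₁ extends it to all of U₀.
  let h01 : O k (chart 1 ⊓ chart 0) := res inf_le_left g1 - res (inf_comm _ _).le (f 0 1)
  let g0 : O k (chart 0) := proj (by decide : (1 : Fin 3) ≠ 0) h01
  have hh01 : ∀ x, x 0 ≠ 0 → x 1 ≠ 0 → h01.fn x = g1.fn x - (f 0 1).fn x := by
    intro x h0 h1
    have hx : x ∈ cone (chart 1 ⊓ chart 0) := by simp [h0, h1]
    simp only [h01, fn_sub, fn_res _ _ hx]
  have h02 : ∀ x, x 0 ≠ 0 → x 2 ≠ 0 → g0.fn x = g2.fn x - (f 0 2).fn x := by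
    intro x h0 h2
    have := fn_proj_of_entire (by decide : (1 : Fin 3) ≠ 0) h01 h0
      (H := fun ζ => g2.fn (update x 1 ζ) - (f 0 2).fn (update x 1 ζ))
      ((hent _ x fun ζ => by simp [h2]).sub (hent _ x fun ζ => by simp [h0, h2])) ?_
    · simpa using this
    · intro ζ hζ
      have e0 : update x 1 ζ 0 ≠ 0 := by simpa using h0
      have e1 : update x 1 ζ 1 ≠ 0 := by simpa using hζ
      have e2 : update x 1 ζ 2 ≠ 0 := by simpa using h2
      rw [hh01 _ e0 e1]
      linear_combination -hf 0 1 2 _ e0 e1 e2 - h12 _ e1 e2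
  -- The projection has been computed only where x₂ ≠ 0; density gives the rest of U₀ ∩ U₁.
  have h01' : ∀ x, x 0 ≠ 0 → x 1 ≠ 0 → g0.fn x = g1.fn x - (f 0 1).fn x := by
    have key : res (inf_le_left : chart 0 ⊓ chart 1 ≤ chart 0) g0 =
        res inf_le_right g1 - f 0 1 := by
      refine eq_of_eq_on_chart 2 fun x hx h2 => ?_
      rw [fn_sub, fn_res _ _ hx, fn_res _ _ hx]
      simp only [mem_cone_inf, mem_cone_chart] at hx
      rw [h02 x hx.1 h2]
      linear_combination h12 x hx.2 h2 + hf 0 1 2 x hx.1 hx.2 h2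
    intro x h0 h1
    have hx : x ∈ cone (chart 0 ⊓ chart 1) := by simp [h0, h1]
    have := congrArg (fun F => F.fn x) key
    simpa only [fn_sub, fn_res _ _ hx] using this
  let g : ∀ i, O k (chart i) := fun i => match i with
    | 0 => g0
    | 1 => g1
    | 2 => g2
  have key : ∀ i j x, i < j → x i ≠ 0 → x j ≠ 0 → (g j).fn x - (g i).fn x = (f i j).fn x := by
    intro i j x hij hi hj
    fin_cases i <;> fin_cases j <;> first | exact absurd hij (by decide) | skip
    · change g1.fn x - g0.fn x = _
      rw [h01' x hi hj]; exact sub_sub_cancel _ _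
    · change g2.fn x - g0.fn x = _
      rw [h02 x hi hj]; exact sub_sub_cancel _ _
    · exact h12 x hi hj
  refine ⟨g, fun i j x hi hj => ?_⟩
  rcases lt_trichotomy i j with h | h | h
  · exact key i j x h hi hj
  · subst h; rw [hdiag i x hi, sub_self]
  · rw [hanti j i x hj hi, ← key j i x h hj hi, neg_sub]

end O

end Cech

/-! ### First order operators -/

section Operators

variable {k l m r : ℤ} {U V W : Opens P2} {x : Fin 3 → ℂ} {i : Fin 3}

theorem O.mul_Xpow_cancel (hV : V ≤ chart i) (hm : k + -k = 0) (b : O k V) :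
    O.mul (zero_add k) (O.mul hm b (O.Xpow i (-k) hV)) (O.Xpow i k hV) = b :=
  O.ext_fn fun x hx => by
    have hi : x i ≠ 0 := mem_cone_chart.1 (cone_mono hV hx)
    simp only [O.fn_mul, O.fn_Xpow _ _ hx, zpow_neg]
    rw [mul_assoc, inv_mul_cancel₀ (zpow_ne_zero _ hi), mul_one]

/-- The sections x_a x_i^(k-1) of 𝒪(k) are enough to detect the coefficients of a field at a point.
-/
theorem sum_mul_dv_test (hV : V ≤ chart i) (hx : x ∈ cone V) (c : Fin 3 → ℂ) (k : ℤ) (a : Fin 3) :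
    ∑ e, c e * (O.mul (add_sub_cancel 1 k) (O.X a V) (O.Xpow i (k - 1) hV)).dv e x =
      c a * x i ^ (k - 1) + x a * c i * ((k - 1) * x i ^ (k - 1 - 1)) := by
  simp only [O.dv_mul _ _ _ _ hx, O.fn_X _ hx, O.dv_X _ _ hx, O.fn_Xpow _ _ hx,
    O.dv_Xpow _ _ _ hx, mul_add, Finset.sum_add_distrib, ite_mul, mul_ite, mul_zero, zero_mul,
    one_mul, Finset.sum_ite_eq, Finset.mem_univ, if_true]
  push_cast
  ring

/-- The test section with a = i gives k c_i = 0, which is where k ≠ 0 is needed; the others then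
give c_a = 0. -/
theorem eq_zero_of_sum_mul_dv (hk : k ≠ 0) (hV : V ≤ chart i) (hx : x ∈ cone V) {c : Fin 3 → ℂ}
    (h : ∀ b : O k V, ∑ e, c e * b.dv e x = 0) : c = 0 := by
  have hi : x i ≠ 0 := mem_cone_chart.1 (cone_mono hV hx)
  have h1 : ∀ a, c a * x i ^ (k - 1) + x a * c i * ((k - 1) * x i ^ (k - 1 - 1)) = 0 :=
    fun a => by rw [← sum_mul_dv_test hV hx, h]
  have h2 : x i ^ (k - 1) = x i ^ (k - 1 - 1) * x i := by
    rw [zpow_sub_one₀ hi (k - 1), inv_mul_cancel_right₀ hi]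
  have h3 : x i ^ (k - 1 - 1) ≠ 0 := zpow_ne_zero _ hi
  have hci : c i = 0 := by
    have h4 := h1 i
    rw [h2] at h4
    have h5 : (k : ℂ) * (x i ^ (k - 1 - 1) * x i) * c i = 0 := by linear_combination h4
    have h6 : (k : ℂ) ≠ 0 := Int.cast_ne_zero.2 hk
    exact (mul_eq_zero.1 h5).resolve_left (mul_ne_zero h6 (mul_ne_zero h3 hi))
  funext a
  have h4 := h1 a
  rw [hci, mul_zero, zero_mul, add_zero] at h4
  exact (mul_eq_zero.1 h4).resolve_right (zpow_ne_zero _ hi)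

/-- In degree 0 the functions x_a/x_i see a vector only modulo the Euler direction, so c is merely
proportional to x. -/
theorem mul_eq_mul_of_sum_mul_dv (hV : V ≤ chart i) (hx : x ∈ cone V) {c : Fin 3 → ℂ}
    (h : ∀ b : O 0 V, ∑ e, c e * b.dv e x = 0) (a b : Fin 3) : c a * x b = c b * x a := by
  have hi : x i ≠ 0 := mem_cone_chart.1 (cone_mono hV hx)
  have h1 : ∀ a, c a * x i = c i * x a := fun a => by
    have h2 := sum_mul_dv_test hV hx c 0 a
    rw [h, zero_sub, zpow_neg_one, zpow_sub_one₀ hi, zpow_neg_one] at h2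
    field_simp at h2
    push_cast at h2
    linear_combination -h2
  apply mul_right_cancel₀ hi
  linear_combination x b * h1 a - x a * h1 b

theorem O.act_injective (hk : k ≠ 0) (h : m + k = l + 1) (hW : W ≤ chart i) {w w' : Fin 3 → O m W}
    (heq : ∀ b : O k W, O.act h le_rfl w b = O.act h le_rfl w' b) : w = w' := by
  funext a
  refine O.ext_fn fun x hx => ?_
  have := eq_zero_of_sum_mul_dv hk hW hx (c := fun a => (w a).fn x - (w' a).fn x) fun b => by
    have h1 := congrArg (fun f => f.fn x) (heq b)
    simp only [O.fn_act _ _ _ _ hx] at h1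
    simp only [sub_mul, Finset.sum_sub_distrib, h1, sub_self]
  exact sub_eq_zero.1 (congrFun this a)

/-- D kills x_i/x_i = 1. The freedom of adding a multiple of the Euler field to a lift is thus fixed
by a vanishing i-th coefficient. -/
theorem T.field_self (D : T m W) (hW : W ≤ chart i) : D.field hW i = 0 := by
  have e : O.mul (add_neg_cancel 1) (O.X i W) (O.Xpow i (-1) hW) = O.one W :=
    O.ext_fn fun x hx => by
      have hi : x i ≠ 0 := mem_cone_chart.1 (cone_mono hW hx)
      simp [hx, hi]
  unfold T.field
  rw [e, T.app_one]
  exact O.ext_fn fun x hx => by simp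

theorem T.fn_app (D : T m W) (hW : W ≤ chart i) (hV : V ≤ W) (f : O 0 V) (hx : x ∈ cone V) :
    (D.app hV f).fn x = ∑ a, (D.field hW a).fn x * f.dv a x := by
  rw [D.app_eq_act hW hV, O.fn_act _ _ _ _ hx]

/-- A first order operator between line bundles over an affine chart is a vector field. -/
theorem exists_field_of_operator (hk : k ≠ 0) (hm : m + 1 = r) (h : r + k = l + 1)
    (hW : W ≤ chart i) (L : ∀ V, V ≤ W → (O k V →ₗ[ℂ] O l V))
    (hres : ∀ (V V' : Opens P2) (hV : V ≤ W) (hV' : V' ≤ V) (b : O k V),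
      L V' (hV'.trans hV) (O.res hV' b) = O.res hV' (L V hV b))
    (X : T m W)
    (hL : ∀ (V : Opens P2) (hV : V ≤ W) (f : O 0 V) (b : O k V), ∀ x ∈ cone V,
      (L V hV (O.mul (zero_add k) f b)).fn x =
        f.fn x * (L V hV b).fn x + (X.app hV f).fn x * b.fn x) :
    ∃ w : Fin 3 → O r W, ∀ (V : Opens P2) (hV : V ≤ W) (b : O k V),
      L V hV b = O.act h hV w b := by
  subst hm
  -- The lift of the symbol has no i-th coefficient, so it kills x_i^k. Adding k⁻¹ L(x_i^k)/x_i^k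
  -- times the Euler field corrects the value there, and b = (b x_i^(-k)) x_i^k with the Leibniz
  -- rule gives every other value.
  refine ⟨fun a => X.field hW a + O.mul (by omega : m + 1 = m + 1)
    (O.mul (by omega : l + -k = m) ((k : ℂ)⁻¹ • L W le_rfl (O.Xpow i k hW)) (O.Xpow i (-k) hW))
    (O.X a W), fun V hV b => O.ext_fn fun x hx => ?_⟩
  have hi : x i ≠ 0 := mem_cone_chart.1 (cone_mono (hV.trans hW) hx)
  have hxW := cone_mono hV hx
  have hk' : (k : ℂ) ≠ 0 := Int.cast_ne_zero.2 hk
  have hp : x i ^ k ≠ 0 := zpow_ne_zero _ hi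
  have h1 : L V hV (O.Xpow i k (hV.trans hW)) = O.res hV (L W le_rfl (O.Xpow i k hW)) := by
    rw [← hres W V le_rfl hV]
    congr 1
  rw [O.fn_act _ _ _ _ hx]
  conv_lhs => rw [← O.mul_Xpow_cancel (hV.trans hW) (add_neg_cancel k) b]
  rw [hL V hV _ _ x hx, h1, O.fn_res _ _ hx, X.fn_app hW hV _ hx]
  simp only [O.fn_mul, O.fn_add, O.fn_smul, O.fn_Xpow _ _ hx, O.fn_Xpow _ _ hxW, O.fn_X _ hxW,
    O.dv_mul _ _ _ _ hx, O.dv_Xpow _ _ _ hx, add_mul, mul_add, Finset.sum_add_distrib, mul_ite,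
    mul_zero, Finset.sum_ite_eq, Finset.mem_univ, if_true, X.field_self hW, O.fn_zero, zero_mul,
    zero_add]
  have h2 := O.euler b hx
  have h3 : ∑ a, (k : ℂ)⁻¹ * (L W le_rfl (O.Xpow i k hW)).fn x * x i ^ (-k) * x a * b.dv a x =
      (k : ℂ)⁻¹ * (L W le_rfl (O.Xpow i k hW)).fn x * x i ^ (-k) * (k * b.fn x) := by
    rw [← h2, Finset.mul_sum]
    exact Finset.sum_congr rfl fun a _ => by ring
  rw [h3, Finset.sum_mul, zpow_neg, add_comm]
  congr 1
  · exact Finset.sum_congr rfl fun a _ => by field_simp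
  · field_simp

/-- A section of `𝒪(k)` over `ℙ²` is given by compatible sections over the charts. -/
theorem O.exists_glue_top (g : ∀ i, O k (chart i))
    (h : ∀ i j x, x i ≠ 0 → x j ≠ 0 → (g i).fn x = (g j).fn x) :
    ∃ G : O k ⊤, ∀ i x, x i ≠ 0 → G.fn x = (g i).fn x := by
  obtain ⟨G, hG⟩ := O.exists_glue (U := ⊤) (fun i => O.res inf_le_right (g i))
    fun i j x hx hi hj => by
      rw [O.fn_res _ _ (by simp [hi]), O.fn_res _ _ (by simp [hj])]
      exact h i j x hi hj
  refine ⟨G, fun i x hi => ?_⟩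
  have hx : x ∈ cone ⊤ := mem_cone_top.2 fun h => hi (by rw [h]; rfl)
  rw [hG i x hx hi, O.fn_res _ _ (by simp [hi])]

/-- An operator between line bundles that is linear over functions is a multiplication. -/
theorem exists_mul_of_operator (h : m + k = l) (L : ∀ V : Opens P2, O k V →ₗ[ℂ] O l V)
    (hres : ∀ (V V' : Opens P2) (hV' : V' ≤ V) (b : O k V),
      L V' (O.res hV' b) = O.res hV' (L V b))
    (hL : ∀ (i : Fin 3) (V : Opens P2) (_ : V ≤ chart i) (f : O 0 V) (b : O k V), ∀ x ∈ cone V,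
      (L V (O.mul (zero_add k) f b)).fn x = f.fn x * (L V b).fn x) :
    ∃ φ : O m ⊤, ∀ (V : Opens P2) (b : O k V), L V b = O.mul h (O.res le_top φ) b := by
  have key : ∀ (i : Fin 3) (V : Opens P2) (b : O k V), ∀ x ∈ cone V, x i ≠ 0 →
      (L V b).fn x = (L (chart i) (O.Xpow i k le_rfl)).fn x * x i ^ (-k) * b.fn x := by
    intro i V b x hx hi
    have hx' : x ∈ cone (V ⊓ chart i) := by simp [hx, hi]
    have e1 : (L V b).fn x = (L (V ⊓ chart i) (O.res inf_le_left b)).fn x := by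
      rw [hres V _ inf_le_left, O.fn_res _ _ hx']
    have e2 : O.Xpow i k (inf_le_right : V ⊓ chart i ≤ chart i) =
        O.res inf_le_right (O.Xpow i k le_rfl) :=
      O.ext_fn fun y hy => by
        rw [O.fn_Xpow _ _ hy, O.fn_res _ _ hy, O.fn_Xpow _ _ (cone_mono inf_le_right hy)]
    rw [e1, ← O.mul_Xpow_cancel inf_le_right (add_neg_cancel k) (O.res inf_le_left b),
      hL i _ inf_le_right _ _ x hx', e2, hres _ _ inf_le_right, O.fn_res _ _ hx', O.fn_mul,
      O.fn_res _ _ hx', O.fn_Xpow _ _ hx']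
    ring
  obtain ⟨φ, hφ⟩ := O.exists_glue_top (k := m)
    (fun i => O.mul (by omega) (L (chart i) (O.Xpow i k le_rfl)) (O.Xpow i (-k) le_rfl))
    fun i j x hi hj => by
      have hi' : x ∈ cone (chart i) := mem_cone_chart.2 hi
      have hj' : x ∈ cone (chart j) := mem_cone_chart.2 hj
      rw [O.fn_mul, O.fn_mul, O.fn_Xpow _ _ hi', O.fn_Xpow _ _ hj',
        key j (chart i) (O.Xpow i k le_rfl) x hi' hj, O.fn_Xpow _ _ hi', zpow_neg, zpow_neg]
      have := zpow_ne_zero k hi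
      field_simp
  refine ⟨φ, fun V b => O.ext_fn fun x hx => ?_⟩
  obtain ⟨i, hi⟩ := exists_coord_ne_zero (ne_zero_of_mem_cone hx)
  rw [key i V b x hx hi, O.fn_mul, O.fn_res _ _ hx, hφ i x hi, O.fn_mul,
    O.fn_Xpow _ _ (mem_cone_chart.2 hi)]

end Operators

/-! ### Cocycles -/

section Cocycles

variable {k : ℤ} {V : Opens P2} {x : Fin 3 → ℂ}

theorem Z1.cocycle (ω : Z1 k) {i j l : Fin 3} (hi : V ≤ chart i) (hj : V ≤ chart j)
    (hl : V ≤ chart l) (f : O 0 V) :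
    (ω.1 j l).app (le_inf hj hl) f - (ω.1 i l).app (le_inf hi hl) f
      + (ω.1 i j).app (le_inf hi hj) f = 0 := by
  have h : cechD1 k ω.1 = 0 := ω.2
  have h2 := congrArg (fun D => T.app D (le_inf (le_inf hi hj) hl) f)
    (congrFun (congrFun (congrFun h i) j) l)
  exact h2

theorem Z1.app_self (ω : Z1 k) {i : Fin 3} (hi : V ≤ chart i) (f : O 0 V) :
    (ω.1 i i).app (le_inf hi hi) f = 0 := by
  simpa using Z1.cocycle ω hi hi hi f

theorem Z1.app_swap (ω : Z1 k) {i j : Fin 3} (hi : V ≤ chart i) (hj : V ≤ chart j) (f : O 0 V) :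
    (ω.1 j i).app (le_inf hj hi) f = -(ω.1 i j).app (le_inf hi hj) f := by
  have := Z1.cocycle ω hi hj hi f
  rw [Z1.app_self ω hi, sub_zero] at this
  exact eq_neg_of_add_eq_zero_left this

/-- The operators `b ↦ ω_ij(φ b)` on `𝒪(k)`, `k ≠ 0`, are a coboundary of vector fields. -/
theorem Z1.exists_primitive_mul (ω : Z1 (-3)) {r s : ℤ} (hk : k ≠ 0) (hr : r + k = -3 + 1)
    (hs : s + k = 0) (φ : O s ⊤) :
    ∃ q : ∀ i, Fin 3 → O r (chart i), ∀ (i j : Fin 3) (V : Opens P2) (hi : V ≤ chart i)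
      (hj : V ≤ chart j) (b : O k V), O.act hr hj (q j) b - O.act hr hi (q i) b =
        (ω.1 i j).app (le_inf hi hj) (O.mul hs (O.res le_top φ) b) := by
  have h1 : ∀ i j, ∃ w : Fin 3 → O r (chart i ⊓ chart j), ∀ (V : Opens P2)
      (hV : V ≤ chart i ⊓ chart j) (b : O k V),
      (ω.1 i j).app hV (O.mul hs (O.res le_top φ) b) = O.act hr hV w b := by
    intro i j
    have hlin : ∀ (V : Opens P2) (hV : V ≤ chart i ⊓ chart j), ∃ L : O k V →ₗ[ℂ] O (-3) V,
        ∀ b, L b = (ω.1 i j).app hV (O.mul hs (O.res le_top φ) b) := fun V hV =>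
      ⟨⟨⟨fun b => (ω.1 i j).app hV (O.mul hs (O.res le_top φ) b), fun b c => by
          rw [← map_add]; congr 1; exact O.ext_fn fun y _ => by simp; ring⟩, fun c b => by
          simp only [RingHom.id_apply]
          rw [← map_smul]; congr 1; exact O.ext_fn fun y _ => by simp; ring⟩, fun b => rfl⟩
    choose L hLd using hlin
    -- The symbol of b ↦ ω_ij(φ b) is φ ω_ij.
    let X : T (r - 1) (chart i ⊓ chart j) := T.ofField fun a =>
      O.mul (by omega : s + (-3 + 1) = r - 1 + 1) (O.res le_top φ) ((ω.1 i j).field inf_le_left a)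
    have hres : ∀ (V V' : Opens P2) (hV : V ≤ chart i ⊓ chart j) (hV' : V' ≤ V) (b : O k V),
        L V' (hV'.trans hV) (O.res hV' b) = O.res hV' (L V hV b) := by
      intro V V' hV hV' b
      rw [hLd, hLd, T.res_app]
      rfl
    obtain ⟨w, hw⟩ := exists_field_of_operator hk (sub_add_cancel r 1) hr
      (inf_le_left : chart i ⊓ chart j ≤ chart i) L hres X fun V hV f b x hx => by
        have e : O.mul hs (O.res le_top φ) (O.mul (zero_add k) f b) =
            O.mul (add_zero 0) f (O.mul hs (O.res le_top φ) b) :=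
          O.ext_fn fun y _ => by simp; ring
        rw [hLd, hLd, e, T.fn_app_mul, T.app_ofField, O.fn_act _ _ _ _ hx,
          T.fn_app _ inf_le_left hV f hx, O.fn_mul, O.fn_res _ _ hx]
        simp only [O.fn_mul, O.fn_res _ _ (cone_mono hV hx), mul_assoc, ← Finset.mul_sum]
        ring
    exact ⟨w, fun V hV b => by rw [← hw, hLd]⟩
  choose w hw using h1
  have h2 : ∀ a, ∃ g : ∀ i, O r (chart i), ∀ i j x, x i ≠ 0 → x j ≠ 0 →
      (g j).fn x - (g i).fn x = (w i j a).fn x := by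
    intro a
    refine O.exists_cech_primitive (fun i j => w i j a) fun i j l x hi hj hl => ?_
    have hx : x ∈ cone (chart i ⊓ chart j ⊓ chart l) := by simp [hi, hj, hl]
    have hVi : chart i ⊓ chart j ⊓ chart l ≤ chart i := inf_le_left.trans inf_le_left
    have hVj : chart i ⊓ chart j ⊓ chart l ≤ chart j := inf_le_left.trans inf_le_right
    have hVl : chart i ⊓ chart j ⊓ chart l ≤ chart l := inf_le_right
    -- Since k ≠ 0, fields are determined by their action, so the cocycle identity for operators
    -- holds for each coefficient, and H¹(𝒪(r)) = 0 applies coefficientwise.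
    refine congrFun (eq_zero_of_sum_mul_dv hk hVi hx
      (c := fun a => (w j l a).fn x - (w i l a).fn x + (w i j a).fn x) fun b => ?_) a
    have h3 := congrArg (fun F => F.fn x)
      (Z1.cocycle ω hVi hVj hVl (O.mul hs (O.res le_top φ) b))
    simp only [hw, O.fn_add, O.fn_sub, O.fn_act _ _ _ _ hx, O.fn_zero] at h3
    simpa only [add_mul, sub_mul, Finset.sum_add_distrib, Finset.sum_sub_distrib] using h3
  choose g hg using h2
  refine ⟨fun i a => g a i, fun i j V hi hj b => O.ext_fn fun x hx => ?_⟩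
  rw [hw, O.fn_sub, O.fn_act _ _ _ _ hx, O.fn_act _ _ _ _ hx, O.fn_act _ _ _ _ hx,
    ← Finset.sum_sub_distrib]
  refine Finset.sum_congr rfl fun a _ => ?_
  rw [← hg a i j x (mem_cone_chart.1 (cone_mono hi hx)) (mem_cone_chart.1 (cone_mono hj hx))]
  ring

end Cocycles

/-! ### Lie derivatives of cocycles -/

section Lie

variable {k l m : ℤ} {U V W : Opens P2} {x : Fin 3 → ℂ} {i : Fin 3}

theorem O.dv_act (h : m + k = l + 1) (hV : V ≤ U) (w : Fin 3 → O m U) (f : O k V) (a : Fin 3)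
    (hx : x ∈ cone V) : (O.act h hV w f).dv a x =
      ∑ b, ((w b).dv a x * f.dv b x + (w b).fn x * (O.pd (sub_add_cancel k 1) b f).dv a x) := by
  change (∑ b, O.mul _ (O.res hV (w b)) (O.pd (sub_add_cancel k 1) b f) : O l V).dv a x = _
  simp only [O.dv_sum _ _ _ hx, O.dv_mul _ _ _ _ hx, O.fn_res _ _ hx, O.dv_res _ _ _ hx,
    O.fn_pd _ _ _ hx]
  exact Finset.sum_congr rfl fun b _ => add_comm _ _

/-- There are no global vector fields with values in `𝒪(-3)`. -/
theorem T.eq_zero_of_compatible (Z : ∀ i, T (-3) (chart i))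
    (h : ∀ (i j : Fin 3) (V : Opens P2) (hi : V ≤ chart i) (hj : V ≤ chart j) (f : O 0 V),
      (Z i).app hi f = (Z j).app hj f) (i : Fin 3) : Z i = 0 := by
  let v : ∀ i, Fin 3 → O (-3 + 1) (chart i) := fun i => (Z i).field le_rfl
  -- The minors x_a v_b - x_b v_a do not see the Euler ambiguity of the lifts. They glue to sections
  -- of 𝒪(-1), which are zero.
  have key : ∀ a b x, x i ≠ 0 → x a * (v i b).fn x - x b * (v i a).fn x = 0 := by
    intro a b x hi
    obtain ⟨G, hG⟩ := O.exists_glue_top (k := -1) (fun i =>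
      O.mul (by norm_num) (O.X a (chart i)) (v i b) - O.mul (by norm_num) (O.X b (chart i)) (v i a))
      fun i j x hi hj => by
        have hi' : x ∈ cone (chart i) := mem_cone_chart.2 hi
        have hj' : x ∈ cone (chart j) := mem_cone_chart.2 hj
        have hx : x ∈ cone (chart i ⊓ chart j) := by simp [hi, hj]
        have := mul_eq_mul_of_sum_mul_dv (inf_le_left : chart i ⊓ chart j ≤ chart i) hx
          (c := fun a => (v i a).fn x - (v j a).fn x) (fun f => by
            have h1 := congrArg (O.fn · x) (h i j _ inf_le_left inf_le_right f)
            simp only [T.fn_app _ le_rfl _ _ hx] at h1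
            simp only [sub_mul, Finset.sum_sub_distrib, v, h1, sub_self]) a b
        simp only [O.fn_sub, O.fn_mul, O.fn_X _ hi', O.fn_X _ hj']
        linear_combination -this
    have hi' : x ∈ cone (chart i) := mem_cone_chart.2 hi
    have h1 := hG i x hi
    rw [O.eq_zero_of_neg (by norm_num) G, O.fn_zero, O.fn_sub, O.fn_mul, O.fn_mul, O.fn_X _ hi',
      O.fn_X _ hi'] at h1
    exact h1.symm
  refine T.ext_app fun V hV f => O.ext_fn fun x hx => ?_
  have hi : x i ≠ 0 := mem_cone_chart.1 (cone_mono hV hx)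
  rw [T.fn_app _ le_rfl hV f hx, T.app_zero, O.fn_zero]
  refine Finset.sum_eq_zero fun b _ => ?_
  have h1 := key i b x hi
  have h2 : (v i i).fn x = 0 := by simp only [v, T.field_self, O.fn_zero]
  rw [h2, mul_zero, sub_zero] at h1
  have h3 : ((Z i).field le_rfl b).fn x = 0 := (mul_eq_zero.1 h1).resolve_left hi
  rw [h3, zero_mul]

/-- The determinant of three vectors. -/
def det3 (a b c : Fin 3 → ℂ) : ℂ :=
  a 0 * (b 1 * c 2 - b 2 * c 1) - a 1 * (b 0 * c 2 - b 2 * c 0) + a 2 * (b 0 * c 1 - b 1 * c 0)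

/-- The determinant of a vector field, the Euler field and another vector field. -/
def detO (w : Fin 3 → O 1 V) (u : Fin 3 → O (-3 + 1) V) : O 0 V :=
  O.mul (by norm_num : (1 : ℤ) + -1 = 0) (w 0)
      (O.mul (by norm_num) (O.X 1 V) (u 2) - O.mul (by norm_num) (O.X 2 V) (u 1))
    - O.mul (by norm_num : (1 : ℤ) + -1 = 0) (w 1)
      (O.mul (by norm_num) (O.X 0 V) (u 2) - O.mul (by norm_num) (O.X 2 V) (u 0))
    + O.mul (by norm_num : (1 : ℤ) + -1 = 0) (w 2)
      (O.mul (by norm_num) (O.X 0 V) (u 1) - O.mul (by norm_num) (O.X 1 V) (u 0))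

theorem fn_detO (w : Fin 3 → O 1 V) (u : Fin 3 → O (-3 + 1) V) (hx : x ∈ cone V) :
    (detO w u).fn x = det3 (fun a => (w a).fn x) x (fun a => (u a).fn x) := by
  simp only [detO, det3, O.fn_add, O.fn_sub, O.fn_mul, O.fn_X _ hx]

theorem dv_detO (w : Fin 3 → O 1 V) (u : Fin 3 → O (-3 + 1) V) (a : Fin 3) (hx : x ∈ cone V) :
    (detO w u).dv a x = det3 (fun b => (w b).dv a x) x (fun b => (u b).fn x)
      + det3 (fun b => (w b).fn x) (fun b => if b = a then 1 else 0) (fun b => (u b).fn x)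
      + det3 (fun b => (w b).fn x) x (fun b => (u b).dv a x) := by
  simp only [detO, det3, O.dv_add _ _ _ hx, O.dv_sub _ _ _ hx, O.dv_mul _ _ _ _ hx, O.fn_sub,
    O.fn_mul, O.fn_X _ hx, O.dv_X _ _ hx]
  ring

/-- The component `e` of the cross product. -/
def crossAt (g f : Fin 3 → ℂ) (e : Fin 3) : ℂ := g (e + 1) * f (e + 2) - g (e + 2) * f (e + 1)

/-- Two vectors orthogonal to x have a cross product parallel to x. For gradients of functions of
degree 0 the orthogonality is Euler's identity, so the resulting bracket does not depend on the
chart. -/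
theorem crossAt_div (x g f : Fin 3 → ℂ) (hg : x 0 * g 0 + x 1 * g 1 + x 2 * g 2 = 0)
    (hf : x 0 * f 0 + x 1 * f 1 + x 2 * f 2 = 0) {i j : Fin 3} (hi : x i ≠ 0) (hj : x j ≠ 0) :
    crossAt g f i / x i = crossAt g f j / x j := by
  rw [div_eq_div_iff hi hj]
  fin_cases i <;> fin_cases j <;> simp [crossAt]
  · linear_combination f 2 * hg - g 2 * hf
  · linear_combination g 1 * hf - f 1 * hg
  · linear_combination g 2 * hf - f 2 * hg
  · linear_combination f 0 * hg - g 0 * hf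
  · linear_combination f 1 * hg - g 1 * hf
  · linear_combination g 0 * hf - f 0 * hg

/-- The homotopy formula for the Lie derivative, at a point: `u a b` and `w a b` stand for the
derivatives in direction `b` of the components of vector fields of degree `-2` and `1`. -/
theorem lie_formula (x f u w : Fin 3 → ℂ) (u' w' : Fin 3 → Fin 3 → ℂ)
    (hf : x 0 * f 0 + x 1 * f 1 + x 2 * f 2 = 0)
    (hu : ∀ a, x 0 * u' a 0 + x 1 * u' a 1 + x 2 * u' a 2 = -2 * u a)
    (hw : ∀ a, x 0 * w' a 0 + x 1 * w' a 1 + x 2 * w' a 2 = w a) {e : Fin 3} (he : x e ≠ 0) :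
    (∑ a, ∑ b, (u a * w' b a - w a * u' b a) * f b) - (∑ a, w' a a) * ∑ a, u a * f a =
      -(∑ a, u' a a) * (∑ a, w a * f a) +
        crossAt (fun a => det3 (fun b => w' b a) x u + det3 w (fun b => if b = a then 1 else 0) u
          + det3 w x (fun b => u' b a)) f e / x e := by
  -- Euler's identity eliminates u and w in favour of their derivatives, which leaves a polynomial
  -- identity modulo x · f = 0.
  obtain rfl : u = fun a => -(x 0 * u' a 0 + x 1 * u' a 1 + x 2 * u' a 2) / 2 :=
    funext fun a => by rw [hu]; ring
  obtain rfl : w = fun a => x 0 * w' a 0 + x 1 * w' a 1 + x 2 * w' a 2 := funext fun a => (hw a).symm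
  rw [← sub_eq_iff_eq_add', eq_div_iff he]
  refine mul_left_cancel₀ he ?_
  fin_cases e <;> simp [crossAt, det3, Fin.sum_univ_three, -mul_eq_mul_left_iff]
  -- Put B = (u·∇)w - (w·∇)u - (div w) u + (div u) w = -curl(u × w). The determinant is x · (u × w),
  -- and u × w has degree -1, so its gradient is x × curl(u × w) = B × x. Finally (B × x) × f = (B ·
  -- f) x - (x · f) B; the coefficient below is x_e B_e.
  · linear_combination (x 0 *
      ((-(x 0 * u' 0 0 + x 1 * u' 0 1 + x 2 * u' 0 2) / 2) * w' 0 0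
      + (-(x 0 * u' 1 0 + x 1 * u' 1 1 + x 2 * u' 1 2) / 2) * w' 0 1
      + (-(x 0 * u' 2 0 + x 1 * u' 2 1 + x 2 * u' 2 2) / 2) * w' 0 2
      - ((x 0 * w' 0 0 + x 1 * w' 0 1 + x 2 * w' 0 2) * u' 0 0
      + (x 0 * w' 1 0 + x 1 * w' 1 1 + x 2 * w' 1 2) * u' 0 1
      + (x 0 * w' 2 0 + x 1 * w' 2 1 + x 2 * w' 2 2) * u' 0 2)
      - (w' 0 0 + w' 1 1 + w' 2 2) * (-(x 0 * u' 0 0 + x 1 * u' 0 1 + x 2 * u' 0 2) / 2)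
      + (u' 0 0 + u' 1 1 + u' 2 2) * (x 0 * w' 0 0 + x 1 * w' 0 1 + x 2 * w' 0 2))) * hf
  · linear_combination (x 1 *
      ((-(x 0 * u' 0 0 + x 1 * u' 0 1 + x 2 * u' 0 2) / 2) * w' 1 0
      + (-(x 0 * u' 1 0 + x 1 * u' 1 1 + x 2 * u' 1 2) / 2) * w' 1 1
      + (-(x 0 * u' 2 0 + x 1 * u' 2 1 + x 2 * u' 2 2) / 2) * w' 1 2
      - ((x 0 * w' 0 0 + x 1 * w' 0 1 + x 2 * w' 0 2) * u' 1 0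
      + (x 0 * w' 1 0 + x 1 * w' 1 1 + x 2 * w' 1 2) * u' 1 1
      + (x 0 * w' 2 0 + x 1 * w' 2 1 + x 2 * w' 2 2) * u' 1 2)
      - (w' 0 0 + w' 1 1 + w' 2 2) * (-(x 0 * u' 1 0 + x 1 * u' 1 1 + x 2 * u' 1 2) / 2)
      + (u' 0 0 + u' 1 1 + u' 2 2) * (x 0 * w' 1 0 + x 1 * w' 1 1 + x 2 * w' 1 2))) * hf
  · linear_combination (x 2 *
      ((-(x 0 * u' 0 0 + x 1 * u' 0 1 + x 2 * u' 0 2) / 2) * w' 2 0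
      + (-(x 0 * u' 1 0 + x 1 * u' 1 1 + x 2 * u' 1 2) / 2) * w' 2 1
      + (-(x 0 * u' 2 0 + x 1 * u' 2 1 + x 2 * u' 2 2) / 2) * w' 2 2
      - ((x 0 * w' 0 0 + x 1 * w' 0 1 + x 2 * w' 0 2) * u' 2 0
      + (x 0 * w' 1 0 + x 1 * w' 1 1 + x 2 * w' 1 2) * u' 2 1
      + (x 0 * w' 2 0 + x 1 * w' 2 1 + x 2 * w' 2 2) * u' 2 2)
      - (w' 0 0 + w' 1 1 + w' 2 2) * (-(x 0 * u' 2 0 + x 1 * u' 2 1 + x 2 * u' 2 2) / 2)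
      + (u' 0 0 + u' 1 1 + u' 2 2) * (x 0 * w' 2 0 + x 1 * w' 2 1 + x 2 * w' 2 2))) * hf

end Lie

/-! ### The bracket with a linear field and its Čech primitive -/

section Lie

variable {k l m : ℤ} {U V W : Opens P2} {x : Fin 3 → ℂ} {i : Fin 3}

/-- The second derivatives of f cancel in the commutator by symmetry. -/
theorem lie_bracket_at (w : Fin 3 → O 1 ⊤) (u : Fin 3 → O (-3 + 1) U) (hV : V ≤ U) (f : O 0 V)
    (hx : x ∈ cone V) :
    (∑ a, (u a).fn x * (O.act (by norm_num : (1 : ℤ) + 0 = 0 + 1) le_top w f).dv a x)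
      - ∑ a, (w a).fn x * (O.act (by norm_num : (-3 + 1 : ℤ) + 0 = -3 + 1) hV u f).dv a x =
    ∑ a, ∑ b, ((u a).fn x * (w b).dv a x - (w a).fn x * (u b).dv a x) * f.dv b x := by
  simp only [O.dv_act _ _ _ _ _ hx, Finset.mul_sum]
  have h : ∀ a b, (O.pd (sub_add_cancel 0 1) b f).dv a x = (O.pd (sub_add_cancel 0 1) a f).dv b x :=
    fun a b => O.dv_pd_comm _ _ _ _ hx
  have h2 : ∑ a, ∑ b, (u a).fn x * ((w b).fn x * (O.pd (sub_add_cancel 0 1) b f).dv a x) =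
      ∑ a, ∑ b, (w a).fn x * ((u b).fn x * (O.pd (sub_add_cancel 0 1) b f).dv a x) := by
    rw [Finset.sum_comm]
    exact Finset.sum_congr rfl fun a _ => Finset.sum_congr rfl fun b _ => by rw [h a b]; ring
  simp only [mul_add, Finset.sum_add_distrib, h2, sub_mul, Finset.sum_sub_distrib]
  simp only [mul_assoc]
  ring

/-- The Hamiltonian vector field of a function with values in `𝒪(-3)`. -/
def hamField (g : O 0 (chart i)) (a : Fin 3) : O (-3 + 1) (chart i) :=
  if a = i + 2 then O.mul (by norm_num) (O.pd (neg_add_cancel 1) (i + 1) g) (O.Xpow i (-1) le_rfl)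
  else if a = i + 1 then
    -O.mul (by norm_num) (O.pd (neg_add_cancel 1) (i + 2) g) (O.Xpow i (-1) le_rfl)
  else 0

theorem sum_hamField (g : O 0 (chart i)) (f : Fin 3 → ℂ) (hi : x i ≠ 0) :
    ∑ a, (hamField g a).fn x * f a = crossAt (fun a => g.dv a x) f i / x i := by
  have hx : x ∈ cone (chart i) := mem_cone_chart.2 hi
  have h1 : (hamField g (i + 2)).fn x = g.dv (i + 1) x * (x i)⁻¹ := by
    rw [hamField, if_pos rfl, O.fn_mul, O.fn_pd _ _ _ hx, O.fn_Xpow _ _ hx, zpow_neg_one]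
  have h2 : (hamField g (i + 1)).fn x = -(g.dv (i + 2) x * (x i)⁻¹) := by
    rw [hamField, if_neg (by fin_cases i <;> decide), if_pos rfl, O.fn_neg, O.fn_mul,
      O.fn_pd _ _ _ hx, O.fn_Xpow _ _ hx, zpow_neg_one]
  have h3 : (hamField g i).fn x = 0 := by
    rw [hamField, if_neg (by fin_cases i <;> decide), if_neg (by fin_cases i <;> decide), O.fn_zero]
  have h4 : ∀ F : Fin 3 → ℂ, ∑ a, F a = F i + F (i + 1) + F (i + 2) := fun F => by
    fin_cases i <;> simp [Fin.sum_univ_three] <;> ring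
  rw [h4, h1, h2, h3, crossAt]
  ring

/-- A multiple h · x of the Euler field has divergence 3 h + deg(h) h, and here h has degree -3.
Hence the divergence does not depend on the lift of a derivation with values in 𝒪(-3). To avoid
dividing, C_a x_b = C_b x_a is differentiated in direction b and summed over b. -/
theorem sum_dv_eq_zero_of_parallel (C : Fin 3 → O (-3 + 1) V)
    (hC : ∀ x ∈ cone V, ∀ a b, (C a).fn x * x b = (C b).fn x * x a) (hx : x ∈ cone V) :
    ∑ a, (C a).dv a x = 0 := by
  obtain ⟨a, ha⟩ := exists_coord_ne_zero (ne_zero_of_mem_cone hx)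
  have h1 : ∀ b, O.mul rfl (C a) (O.X b V) = O.mul rfl (C b) (O.X a V) := fun b =>
    O.ext_fn fun y hy => by
      rw [O.fn_mul, O.fn_mul, O.fn_X _ hy, O.fn_X _ hy]
      exact hC y hy a b
  have h2 : ∀ b, (C a).fn x + (C a).dv b x * x b =
      (C b).fn x * (if a = b then 1 else 0) + (C b).dv b x * x a := fun b => by
    have := congrArg (fun F => F.dv b x) (h1 b)
    simp only [O.dv_mul _ _ _ _ hx, O.fn_X _ hx, O.dv_X _ _ hx, if_true, mul_one] at this
    exact this
  have h3 := O.euler (C a) hx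
  have h4 : ∑ b, ((C a).fn x + (C a).dv b x * x b) =
      ∑ b, ((C b).fn x * (if a = b then 1 else 0) + (C b).dv b x * x a) :=
    Finset.sum_congr rfl fun b _ => h2 b
  have h5 : ∑ b, (C a).dv b x * x b = ∑ b, x b * (C a).dv b x :=
    Finset.sum_congr rfl fun b _ => mul_comm _ _
  simp only [Finset.sum_add_distrib, h5, h3, mul_ite, mul_one, mul_zero, Finset.sum_ite_eq,
    Finset.mem_univ, if_true, ← Finset.sum_mul, Finset.sum_const, Finset.card_univ,
    Fintype.card_fin, nsmul_eq_mul] at h4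
  push_cast at h4
  have h6 : (∑ b, (C b).dv b x) * x a = 0 := by linear_combination -h4
  exact (mul_eq_zero.1 h6).resolve_right ha

theorem det3_eq_zero_of_parallel (w x c : Fin 3 → ℂ) (h : ∀ a b, c a * x b = c b * x a) :
    det3 w x c = 0 := by
  unfold det3
  linear_combination w 0 * h 2 1 - w 1 * h 2 0 + w 2 * h 1 0

/-- Global vector fields on the cone act on the class of a cocycle by a scalar. -/
theorem Z1.exists_lie_primitive (ω : Z1 (-3)) (w : Fin 3 → O 1 ⊤) :
    ∃ α : ℂ, ∃ Z : ∀ i, T (-3) (chart i), ∀ (i j : Fin 3) (V : Opens P2) (hi : V ≤ chart i)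
      (hj : V ≤ chart j) (f : O 0 V), (Z j).app hj f - (Z i).app hi f =
        (ω.1 i j).app (le_inf hi hj) (O.act (by norm_num : (1 : ℤ) + 0 = 0 + 1) le_top w f)
        - O.act (by norm_num : (1 : ℤ) + -3 = -3 + 1) le_top w ((ω.1 i j).app (le_inf hi hj) f)
        - α • (ω.1 i j).app (le_inf hi hj) f := by
  -- The scalar is the divergence of w, the trace of the corresponding matrix.
  obtain ⟨α, hα⟩ := O.eq_smul_one (∑ a, O.pd (zero_add 1) a (w a))
  have hα' : ∀ x ∈ cone ⊤, ∑ a, (w a).dv a x = α := fun x hx => by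
    have := congrArg (O.fn · x) hα
    simpa only [O.fn_sum, O.fn_pd _ _ _ hx, O.fn_smul, O.fn_one hx, mul_one] using this
  let u : ∀ i j, Fin 3 → O (-3 + 1) (chart i ⊓ chart j) := fun i j => (ω.1 i j).field inf_le_left
  have hω : ∀ (i j : Fin 3) (V : Opens P2) (hV : V ≤ chart i ⊓ chart j) (f : O 0 V),
      (ω.1 i j).app hV f = O.act (add_zero _) hV (u i j) f := fun i j V hV f =>
    T.app_eq_act _ _ _ _
  -- The lifts u_ij satisfy the cocycle identity only up to a multiple C of the Euler field;
  -- divergence and determinant are blind to it.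
  have hcoc : ∀ i j l, ∃ C : Fin 3 → O (-3 + 1) (chart i ⊓ chart j ⊓ chart l),
      (∀ x ∈ cone (chart i ⊓ chart j ⊓ chart l), ∀ a,
        (C a).fn x = (u j l a).fn x - (u i l a).fn x + (u i j a).fn x ∧
        ∀ b, (C a).dv b x = (u j l a).dv b x - (u i l a).dv b x + (u i j a).dv b x) ∧
      ∀ x ∈ cone (chart i ⊓ chart j ⊓ chart l), ∀ a b,
        (C a).fn x * x b = (C b).fn x * x a := by
    intro i j l
    have hVi : chart i ⊓ chart j ⊓ chart l ≤ chart i := inf_le_left.trans inf_le_left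
    have hVj : chart i ⊓ chart j ⊓ chart l ≤ chart j := inf_le_left.trans inf_le_right
    have hVl : chart i ⊓ chart j ⊓ chart l ≤ chart l := inf_le_right
    let C : Fin 3 → O (-3 + 1) (chart i ⊓ chart j ⊓ chart l) := fun a =>
      O.res (le_inf hVj hVl) (u j l a) - O.res (le_inf hVi hVl) (u i l a)
        + O.res (le_inf hVi hVj) (u i j a)
    have hC : ∀ x ∈ cone (chart i ⊓ chart j ⊓ chart l), ∀ a,
        (C a).fn x = (u j l a).fn x - (u i l a).fn x + (u i j a).fn x ∧
        ∀ b, (C a).dv b x = (u j l a).dv b x - (u i l a).dv b x + (u i j a).dv b x :=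
      fun x hx a => ⟨by simp only [C, O.fn_add, O.fn_sub, O.fn_res _ _ hx], fun b => by
        simp only [C, O.dv_add _ _ _ hx, O.dv_sub _ _ _ hx, O.dv_res _ _ _ hx]⟩
    refine ⟨C, hC, fun x hx => mul_eq_mul_of_sum_mul_dv hVi hx (c := fun a => (C a).fn x)
      fun f => ?_⟩
    have h3 := congrArg (O.fn · x) (Z1.cocycle ω hVi hVj hVl f)
    simp only [hω, O.fn_add, O.fn_sub, O.fn_act _ _ _ _ hx, O.fn_zero] at h3
    simpa only [(hC x hx _).1, add_mul, sub_mul, Finset.sum_add_distrib, Finset.sum_sub_distrib]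
      using h3
  -- The divergence of u_ij, in 𝒪(-3), plays the role of d ω_ij.
  obtain ⟨c, hc⟩ := O.exists_cech_primitive
    (fun i j => ∑ a, O.pd rfl a (u i j a)) fun i j l x hi hj hl => by
      have hx : x ∈ cone (chart i ⊓ chart j ⊓ chart l) := by simp [hi, hj, hl]
      have hx1 : x ∈ cone (chart i ⊓ chart j) := by simp [hi, hj]
      have hx2 : x ∈ cone (chart i ⊓ chart l) := by simp [hi, hl]
      have hx3 : x ∈ cone (chart j ⊓ chart l) := by simp [hj, hl]
      obtain ⟨C, hC, hC'⟩ := hcoc i j l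
      have h1 := sum_dv_eq_zero_of_parallel C hC' hx
      simp only [(hC x hx _).2, Finset.sum_add_distrib, Finset.sum_sub_distrib] at h1
      simpa only [O.fn_sum, O.fn_pd _ _ _ hx1, O.fn_pd _ _ _ hx2, O.fn_pd _ _ _ hx3] using h1
  -- The determinant of w, x and u_ij, in 𝒪, plays the role of ι_w ω_ij.
  obtain ⟨g, hg⟩ := O.exists_cech_primitive
    (fun i j => detO (fun a => O.res le_top (w a)) (u i j)) fun i j l x hi hj hl => by
      have hx : x ∈ cone (chart i ⊓ chart j ⊓ chart l) := by simp [hi, hj, hl]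
      have hx1 : x ∈ cone (chart i ⊓ chart j) := by simp [hi, hj]
      have hx2 : x ∈ cone (chart i ⊓ chart l) := by simp [hi, hl]
      have hx3 : x ∈ cone (chart j ⊓ chart l) := by simp [hj, hl]
      obtain ⟨C, hC, hC'⟩ := hcoc i j l
      have h1 := det3_eq_zero_of_parallel (fun a => (w a).fn x) x (fun a => (C a).fn x) (hC' x hx)
      rw [fn_detO _ _ hx1, fn_detO _ _ hx2, fn_detO _ _ hx3]
      simp only [det3, (hC x hx _).1, O.fn_res _ _ hx1, O.fn_res _ _ hx2, O.fn_res _ _ hx3] at h1 ⊢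
      linear_combination h1
  -- Cartan's formula: the first term corresponds to d(ι_w ω), the second to ι_w(d ω).
  refine ⟨α, fun i => T.ofField fun a =>
    hamField (g i) a - O.mul (by norm_num) (c i) (O.res le_top (w a)), fun i j V hVi hVj f => ?_⟩
  refine O.ext_fn fun x hx => ?_
  have hi : x i ≠ 0 := mem_cone_chart.1 (cone_mono hVi hx)
  have hj : x j ≠ 0 := mem_cone_chart.1 (cone_mono hVj hx)
  have hi' : x ∈ cone (chart i) := mem_cone_chart.2 hi
  have hj' : x ∈ cone (chart j) := mem_cone_chart.2 hj
  have hij : x ∈ cone (chart i ⊓ chart j) := by simp [hi, hj]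
  have htop : x ∈ cone ⊤ := mem_cone_top.2 (ne_zero_of_mem_cone hx)
  have hgdv : ∀ a, (g j).dv a x - (g i).dv a x =
      (detO (fun a => O.res le_top (w a)) (u i j)).dv a x := by
    intro a
    have e : O.res inf_le_right (g j) - O.res inf_le_left (g i) =
        detO (fun a => O.res le_top (w a)) (u i j) := O.ext_fn fun y hy => by
      rw [O.fn_sub, O.fn_res _ _ hy, O.fn_res _ _ hy]
      simp only [mem_cone_inf, mem_cone_chart] at hy
      exact hg i j y hy.1 hy.2
    rw [← e, O.dv_sub _ _ _ hij, O.dv_res _ _ _ hij, O.dv_res _ _ _ hij]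
  have hcd := hc i j x hi hj
  simp only [O.fn_sum, O.fn_pd _ _ _ hij] at hcd
  have hbr := lie_bracket_at w (u i j) (le_inf hVi hVj) f hx
  have hf0 := O.euler' f hx
  have hgj := O.euler' (g j) hj'
  simp only [Int.cast_zero, zero_mul] at hf0 hgj
  have hlie := lie_formula x (fun a => f.dv a x) (fun a => (u i j a).fn x) (fun a => (w a).fn x)
    (fun a b => (u i j a).dv b x) (fun a b => (w a).dv b x) hf0
    (fun a => by rw [O.euler' _ hij]; push_cast; ring)
    (fun a => by rw [O.euler' _ htop]; push_cast; ring) hi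
  have hcr : crossAt (fun a => (g i).dv a x) (fun a => f.dv a x) i +
      crossAt (fun a => det3 (fun b => (w b).dv a x) x (fun a => (u i j a).fn x)
        + det3 (fun a => (w a).fn x) (fun b => if b = a then 1 else 0) (fun a => (u i j a).fn x)
        + det3 (fun a => (w a).fn x) x (fun b => (u i j b).dv a x)) (fun a => f.dv a x) i =
      crossAt (fun a => (g j).dv a x) (fun a => f.dv a x) i := by
    have h1 : ∀ a, (g j).dv a x = (g i).dv a x +
        (det3 (fun b => (w b).dv a x) x (fun a => (u i j a).fn x)
        + det3 (fun a => (w a).fn x) (fun b => if b = a then 1 else 0) (fun a => (u i j a).fn x)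
        + det3 (fun a => (w a).fn x) x (fun b => (u i j b).dv a x)) := fun a => by
      have h2 := hgdv a
      rw [dv_detO _ _ _ hij] at h2
      simp only [O.fn_res _ _ hij, O.dv_res _ _ _ hij] at h2
      linear_combination h2
    simp only [crossAt, h1]
    ring
  have hZ : ∀ l (hl : V ≤ chart l), (T.app (T.ofField fun a =>
      hamField (g l) a - O.mul (by norm_num) (c l) (O.res le_top (w a))) hl f).fn x =
      crossAt (fun a => (g l).dv a x) (fun a => f.dv a x) l / x l
        - (c l).fn x * ∑ a, (w a).fn x * f.dv a x := fun l hl => by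
    have hl' := cone_mono hl hx
    rw [T.app_ofField, O.fn_act _ _ _ _ hx, ← sum_hamField _ _ (mem_cone_chart.1 hl')]
    simp only [O.fn_sub, O.fn_mul, O.fn_res _ _ hl', sub_mul, Finset.sum_sub_distrib,
      Finset.mul_sum, mul_assoc]
  rw [O.fn_sub, hZ j hVj, hZ i hVi, crossAt_div x _ _ hgj hf0 hj hi, ← hcr]
  simp only [hω, O.fn_sub, O.fn_smul, O.fn_act _ _ _ _ hx]
  rw [hbr, ← hα' x htop, hlie, ← hcd]
  ring

end Lie

/-! ### Superfunctions -/

/-- A derivation given by its values on functions. -/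
def T.ofMaps {m : ℤ} {W : Opens P2} (L : ∀ V, V ≤ W → (O 0 V →ₗ[ℂ] O m V))
    (hres : ∀ (V V' : Opens P2) (hV : V ≤ W) (h : V' ≤ V) (f : O 0 V),
      L V' (h.trans hV) (O.res h f) = O.res h (L V hV f))
    (hL : ∀ (V : Opens P2) (hV : V ≤ W) (f g : O 0 V), ∀ x ∈ cone V,
      (L V hV (O.mul (add_zero 0) f g)).fn x =
        f.fn x * (L V hV g).fn x + g.fn x * (L V hV f).fn x) : T m W :=
  ⟨fun V => L V.1 V.2, fun V V' h f => hres V.1 V'.1 V.2 h f, fun V f g => O.ext_fn fun x hx => by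
    rw [O.fn_add, O.fn_mul, O.fn_mul]
    exact hL V.1 V.2 f g x hx⟩

namespace OM

variable {ω : Z1 (-3)} {U V W : Opens P2} {x : Fin 3 → ℂ} {i j : Fin 3}

/-- The component `f`, as a linear map. -/
def fL : OM ω V →ₗ[ℂ] O 0 V := ⟨⟨fun s => s.f, fun _ _ => rfl⟩, fun _ _ => rfl⟩

/-- The component `b₁`, as a linear map. -/
def b1L : OM ω V →ₗ[ℂ] O (-1) V := ⟨⟨fun s => s.b₁, fun _ _ => rfl⟩, fun _ _ => rfl⟩

/-- The component `b₂`, as a linear map. -/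
def b2L : OM ω V →ₗ[ℂ] O (-2) V := ⟨⟨fun s => s.b₂, fun _ _ => rfl⟩, fun _ _ => rfl⟩

/-- The component `c_i` over a subset of the chart `U_i`, as a linear map. -/
def cL (hi : V ≤ chart i) : OM ω V →ₗ[ℂ] O (-3) V :=
  ⟨⟨fun s => O.res (le_inf le_rfl hi) (s.c i), fun _ _ => rfl⟩, fun _ _ => rfl⟩

theorem fL_res (h : W ≤ V) (s : OM ω V) : fL (res h s) = O.res h (fL s) := rfl
theorem b1L_res (h : W ≤ V) (s : OM ω V) : b1L (res h s) = O.res h (b1L s) := rfl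
theorem b2L_res (h : W ≤ V) (s : OM ω V) : b2L (res h s) = O.res h (b2L s) := rfl
theorem cL_res (hi : V ≤ chart i) (h : W ≤ V) (s : OM ω V) :
    cL (h.trans hi) (res h s) = O.res h (cL hi s) := rfl

theorem res_c (h : W ≤ V) (s : OM ω V) (i : Fin 3) :
    (res h s).c i = O.res (inf_le_inf_right _ h) (s.c i) := rfl

theorem fn_c (s : OM ω V) (i : Fin 3) (hx : x ∈ cone (V ⊓ chart i)) :
    (s.c i).fn x = (cL inf_le_right (res (inf_le_left : V ⊓ chart i ≤ V) s)).fn x := by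
  change _ = (O.res (le_inf le_rfl inf_le_right)
    (O.res (inf_le_inf_right _ inf_le_left) (s.c i))).fn x
  rw [O.res_res, O.fn_res _ _ hx]

/-- Superfunctions are determined by their restrictions to the charts. -/
theorem ext_charts {s t : OM ω V}
    (h : ∀ i, res (inf_le_left : V ⊓ chart i ≤ V) s = res inf_le_left t) : s = t := by
  refine OM.ext (O.ext_charts fun i => congrArg fL (h i)) (O.ext_charts fun i => congrArg b1L (h i))
    (O.ext_charts fun i => congrArg b2L (h i)) (funext fun i => O.ext_fn fun x hx => ?_)
  rw [fn_c s i hx, fn_c t i hx, h i]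

/-- Over a subset of a chart, superfunctions are determined by the components in that chart. -/
theorem ext_chart (hi : V ≤ chart i) {s t : OM ω V} (hf : fL s = fL t) (h1 : b1L s = b1L t)
    (h2 : b2L s = b2L t) (hc : cL hi s = cL hi t) : s = t := by
  refine OM.ext hf h1 h2 (funext fun j => O.ext_fn fun x hx => ?_)
  have hs := congrArg (O.fn · x) (s.2 i j)
  have ht := congrArg (O.fn · x) (t.2 i j)
  have hx' : x ∈ cone (V ⊓ (chart i ⊓ chart j)) := by
    rw [mem_cone_inf] at hx
    rw [mem_cone_inf, mem_cone_inf]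
    exact ⟨hx.1, cone_mono hi hx.1, hx.2⟩
  have hxV : x ∈ cone V := cone_mono inf_le_left hx
  simp only [O.fn_sub, O.fn_res _ _ hx'] at hs ht
  have hf' : s.1.1 = t.1.1 := hf
  rw [hf', ← ht] at hs
  have hc' := congrArg (O.fn · x) hc
  change (O.res (le_inf le_rfl hi) (s.c i)).fn x = (O.res (le_inf le_rfl hi) (t.c i)).fn x at hc'
  rw [O.fn_res _ _ hxV, O.fn_res _ _ hxV] at hc'
  change (s.c j).fn x - (s.c i).fn x = (t.c j).fn x - (t.c i).fn x at hs
  rw [hc'] at hs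
  exact sub_left_injective hs

theorem c_sub (s : OM ω V) (hi : V ≤ chart i) (hj : V ≤ chart j) :
    cL hj s - cL hi s = (ω.1 i j).app (le_inf hi hj) (fL s) := by
  have h := congrArg (O.res (le_inf le_rfl (le_inf hi hj))) (s.2 i j)
  rw [map_sub] at h
  refine h.trans ?_
  exact T.res_app (ω.1 i j) _ _ _

/-! #### Components of products -/

theorem fL_mul (s t : OM ω V) : (fL (s * t)).fn x = (fL s).fn x * (fL t).fn x :=
  O.fn_mul (by norm_num) s.f t.f

theorem b1L_mul (s t : OM ω V) :
    (b1L (s * t)).fn x = (fL s).fn x * (b1L t).fn x + (b1L s).fn x * (fL t).fn x := by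
  change (O.mul _ s.f t.b₁ + O.mul _ s.b₁ t.f : O (-1) V).fn x = _
  rw [O.fn_add, O.fn_mul, O.fn_mul]; rfl

theorem b2L_mul (s t : OM ω V) :
    (b2L (s * t)).fn x = (fL s).fn x * (b2L t).fn x + (b2L s).fn x * (fL t).fn x := by
  change (O.mul _ s.f t.b₂ + O.mul _ s.b₂ t.f : O (-2) V).fn x = _
  rw [O.fn_add, O.fn_mul, O.fn_mul]; rfl

theorem cL_mul (hi : V ≤ chart i) (s t : OM ω V) :
    (cL hi (s * t)).fn x = (fL s).fn x * (cL hi t).fn x + (cL hi s).fn x * (fL t).fn x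
      + ((b1L s).fn x * (b2L t).fn x - (b2L s).fn x * (b1L t).fn x) := by
  change (O.res (le_inf le_rfl hi) (O.mul (zero_add (-3)) (O.res inf_le_left s.f) (t.c i)
        + O.mul (add_zero (-3)) (s.c i) (O.res inf_le_left t.f)
        + O.res inf_le_left
          (O.mul _ s.b₁ t.b₂ - O.mul _ s.b₂ t.b₁)) : O (-3) V).fn x = _
  simp only [map_add, map_sub, O.res_mul, O.res_res, O.fn_add, O.fn_sub, O.fn_mul]
  rfl

/-! #### Homogeneous superfunctions -/

/-- The lift of a function over a subset of `U_i` that has `c_i = 0`. -/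
def lift (hi : V ≤ chart i) : O 0 V →ₗ[ℂ] OM ω V where
  toFun f := ⟨(f, 0, 0, fun j =>
      (ω.1 i j).app (le_inf (inf_le_left.trans hi) inf_le_right) (O.res inf_le_left f)), by
    rw [mem_OMSubmodule]
    intro j l
    have hVi : V ⊓ (chart j ⊓ chart l) ≤ chart i := inf_le_left.trans hi
    have hVj : V ⊓ (chart j ⊓ chart l) ≤ chart j := inf_le_right.trans inf_le_left
    have hVl : V ⊓ (chart j ⊓ chart l) ≤ chart l := inf_le_right.trans inf_le_right
    have h := Z1.cocycle ω hVi hVj hVl (O.res inf_le_left f)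
    simp only [T.res_app, O.res_res]
    rw [sub_add] at h
    exact (sub_eq_zero.1 h).symm⟩
  map_add' f g := by
    refine OM.ext rfl (add_zero (0 : O (-1) V)).symm (add_zero (0 : O (-2) V)).symm (funext fun j => ?_)
    exact map_add (((ω.1 i j).app (le_inf (inf_le_left.trans hi) inf_le_right)) ∘ₗ
      O.res (inf_le_left : V ⊓ chart j ≤ V)) f g
  map_smul' c f := by
    refine OM.ext rfl (smul_zero (A := O (-1) V) c).symm (smul_zero (A := O (-2) V) c).symm
      (funext fun j => ?_)
    exact map_smul (((ω.1 i j).app (le_inf (inf_le_left.trans hi) inf_le_right)) ∘ₗ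
      O.res (inf_le_left : V ⊓ chart j ≤ V)) c f

/-- The superfunction `b θ₁`. -/
def th1 : O (-1) V →ₗ[ℂ] OM ω V where
  toFun b := ⟨(0, b, 0, 0), by rw [mem_OMSubmodule]; intro i j; simp⟩
  map_add' b b' := OM.ext (add_zero (0 : O 0 V)).symm rfl (add_zero (0 : O (-2) V)).symm
    (funext fun j => (add_zero (0 : O (-3) (V ⊓ chart j))).symm)
  map_smul' a b := OM.ext (smul_zero (A := O 0 V) a).symm rfl (smul_zero (A := O (-2) V) a).symm
    (funext fun j => (smul_zero (A := O (-3) (V ⊓ chart j)) a).symm)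

/-- The superfunction `b θ₂`. -/
def th2 : O (-2) V →ₗ[ℂ] OM ω V where
  toFun b := ⟨(0, 0, b, 0), by rw [mem_OMSubmodule]; intro i j; simp⟩
  map_add' b b' := OM.ext (add_zero (0 : O 0 V)).symm (add_zero (0 : O (-1) V)).symm rfl
    (funext fun j => (add_zero (0 : O (-3) (V ⊓ chart j))).symm)
  map_smul' a b := OM.ext (smul_zero (A := O 0 V) a).symm (smul_zero (A := O (-1) V) a).symm rfl
    (funext fun j => (smul_zero (A := O (-3) (V ⊓ chart j)) a).symm)

/-- The superfunction `c θ₁θ₂`. -/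
def th12 : O (-3) V →ₗ[ℂ] OM ω V where
  toFun c := ⟨(0, 0, 0, fun _ => O.res inf_le_left c), by rw [mem_OMSubmodule]; intro i j; simp⟩
  map_add' b b' := OM.ext (add_zero (0 : O 0 V)).symm (add_zero (0 : O (-1) V)).symm
    (add_zero (0 : O (-2) V)).symm rfl
  map_smul' a b := OM.ext (smul_zero (A := O 0 V) a).symm (smul_zero (A := O (-1) V) a).symm
    (smul_zero (A := O (-2) V) a).symm rfl

@[simp] theorem fL_lift (hi : V ≤ chart i) (f : O 0 V) : fL (lift hi f : OM ω V) = f := rfl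
@[simp] theorem b1L_lift (hi : V ≤ chart i) (f : O 0 V) : b1L (lift hi f : OM ω V) = 0 := rfl
@[simp] theorem b2L_lift (hi : V ≤ chart i) (f : O 0 V) : b2L (lift hi f : OM ω V) = 0 := rfl

theorem cL_lift (hi : V ≤ chart i) (hj : V ≤ chart j) (f : O 0 V) :
    cL hj (lift hi f : OM ω V) = (ω.1 i j).app (le_inf hi hj) f :=
  (T.res_app (ω.1 i j) (le_inf (inf_le_left.trans hi) inf_le_right)
    (le_inf le_rfl hj : V ≤ V ⊓ chart j) (O.res inf_le_left f))

@[simp] theorem cL_lift_self (hi : V ≤ chart i) (f : O 0 V) : cL hi (lift hi f : OM ω V) = 0 := by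
  rw [cL_lift hi hi, Z1.app_self ω hi]

@[simp] theorem fL_th1 (b : O (-1) V) : fL (th1 b : OM ω V) = 0 := rfl
@[simp] theorem b1L_th1 (b : O (-1) V) : b1L (th1 b : OM ω V) = b := rfl
@[simp] theorem b2L_th1 (b : O (-1) V) : b2L (th1 b : OM ω V) = 0 := rfl
@[simp] theorem cL_th1 (hi : V ≤ chart i) (b : O (-1) V) : cL hi (th1 b : OM ω V) = 0 := rfl
@[simp] theorem fL_th2 (b : O (-2) V) : fL (th2 b : OM ω V) = 0 := rfl
@[simp] theorem b1L_th2 (b : O (-2) V) : b1L (th2 b : OM ω V) = 0 := rfl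
@[simp] theorem b2L_th2 (b : O (-2) V) : b2L (th2 b : OM ω V) = b := rfl
@[simp] theorem cL_th2 (hi : V ≤ chart i) (b : O (-2) V) : cL hi (th2 b : OM ω V) = 0 := rfl
@[simp] theorem fL_th12 (b : O (-3) V) : fL (th12 b : OM ω V) = 0 := rfl
@[simp] theorem b1L_th12 (b : O (-3) V) : b1L (th12 b : OM ω V) = 0 := rfl
@[simp] theorem b2L_th12 (b : O (-3) V) : b2L (th12 b : OM ω V) = 0 := rfl
@[simp] theorem cL_th12 (hi : V ≤ chart i) (b : O (-3) V) : cL hi (th12 b : OM ω V) = b := rfl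

theorem res_lift (hi : V ≤ chart i) (h : W ≤ V) (f : O 0 V) :
    res h (lift hi f : OM ω V) = lift (h.trans hi) (O.res h f) :=
  ext_chart (h.trans hi) rfl rfl rfl (by
    rw [cL_res hi h, cL_lift_self, cL_lift_self, map_zero])

theorem res_th1 (h : W ≤ V) (b : O (-1) V) :
    res h (th1 b : OM ω V) = th1 (O.res h b) := rfl

theorem res_th2 (h : W ≤ V) (b : O (-2) V) :
    res h (th2 b : OM ω V) = th2 (O.res h b) := rfl

theorem eq_sum (hi : V ≤ chart i) (s : OM ω V) :
    s = lift hi (fL s) + th1 (b1L s) + th2 (b2L s) + th12 (cL hi s) := by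
  refine ext_chart hi ?_ ?_ ?_ ?_ <;> simp

theorem lift_eq_add (hi : V ≤ chart i) (hj : V ≤ chart j) (f : O 0 V) :
    (lift hj f : OM ω V) = lift hi f + th12 ((ω.1 j i).app (le_inf hj hi) f) := by
  refine ext_chart hi ?_ ?_ ?_ ?_ <;> simp [cL_lift]

theorem lift_mul_lift (hi : V ≤ chart i) (f g : O 0 V) :
    (lift hi f * lift hi g : OM ω V) = lift hi (O.mul (add_zero 0) f g) := by
  refine ext_chart hi ?_ ?_ ?_ ?_ <;> refine O.ext_fn fun x hx => ?_
  · rw [fL_mul]; simp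
  · rw [b1L_mul]; simp
  · rw [b2L_mul]; simp
  · rw [cL_mul]; simp

theorem lift_mul_th1 (hi : V ≤ chart i) (f : O 0 V) (b : O (-1) V) :
    (lift hi f * th1 b : OM ω V) = th1 (O.mul (zero_add (-1)) f b) := by
  refine ext_chart hi ?_ ?_ ?_ ?_ <;> refine O.ext_fn fun x hx => ?_
  · rw [fL_mul]; simp
  · rw [b1L_mul]; simp
  · rw [b2L_mul]; simp
  · rw [cL_mul]; simp

theorem lift_mul_th2 (hi : V ≤ chart i) (f : O 0 V) (b : O (-2) V) :
    (lift hi f * th2 b : OM ω V) = th2 (O.mul (zero_add (-2)) f b) := by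
  refine ext_chart hi ?_ ?_ ?_ ?_ <;> refine O.ext_fn fun x hx => ?_
  · rw [fL_mul]; simp
  · rw [b1L_mul]; simp
  · rw [b2L_mul]; simp
  · rw [cL_mul]; simp

theorem th1_mul_th2 (hi : V ≤ chart i) (b : O (-1) V) (b' : O (-2) V) :
    (th1 b * th2 b' : OM ω V) = th12 (O.mul (by norm_num) b b') := by
  refine ext_chart hi ?_ ?_ ?_ ?_ <;> refine O.ext_fn fun x hx => ?_
  · rw [fL_mul]; simp
  · rw [b1L_mul]; simp
  · rw [b2L_mul]; simp
  · rw [cL_mul]; simp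

theorem lift_mem_part (hi : V ≤ chart i) (f : O 0 V) : (lift hi f : OM ω V) ∈ part ω V 0 :=
  ⟨fun _ => ⟨rfl, rfl⟩, fun h => absurd h (by decide)⟩

theorem th1_mem_part (b : O (-1) V) : (th1 b : OM ω V) ∈ part ω V 1 :=
  ⟨fun h => absurd h (by decide), fun _ => ⟨rfl, rfl⟩⟩

theorem th2_mem_part (b : O (-2) V) : (th2 b : OM ω V) ∈ part ω V 1 :=
  ⟨fun h => absurd h (by decide), fun _ => ⟨rfl, rfl⟩⟩

theorem b1L_of_mem {s : OM ω V} (h : s ∈ part ω V 0) : b1L s = 0 := (h.1 rfl).1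
theorem b2L_of_mem {s : OM ω V} (h : s ∈ part ω V 0) : b2L s = 0 := (h.1 rfl).2
theorem fL_of_mem {s : OM ω V} (h : s ∈ part ω V 1) : fL s = 0 := (h.2 rfl).1
theorem cL_of_mem (hi : V ≤ chart i) {s : OM ω V} (h : s ∈ part ω V 1) : cL hi s = 0 := by
  change O.res (le_inf le_rfl hi) (s.c i) = 0
  rw [show s.c i = 0 from congrFun (h.2 rfl).2 i, map_zero]

end OM

/-! ### Global superderivations -/

namespace TM

variable {ω : Z1 (-3)} {p : ZMod 2} {V W : Opens P2} {x : Fin 3 → ℂ} {i j : Fin 3}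

/-- The action of a global superderivation on superfunctions over `V`. -/
def app (D : TM ω ⊤ p) (V : Opens P2) : OM ω V →ₗ[ℂ] OM ω V := D.1 ⟨V, Set.mem_Iic.2 le_top⟩

@[simp] theorem app_zero (s : OM ω V) : app (0 : TM ω ⊤ p) V s = 0 := rfl

@[simp] theorem app_add (D E : TM ω ⊤ p) (s : OM ω V) : app (D + E) V s = app D V s + app E V s := rfl

@[simp] theorem app_smul (a : ℂ) (D : TM ω ⊤ p) (s : OM ω V) : app (a • D) V s = a • app D V s := rfl

theorem app_res (D : TM ω ⊤ p) (h : W ≤ V) (s : OM ω V) :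
    app D W (OM.res h s) = OM.res h (app D V s) :=
  D.2.1 ⟨V, Set.mem_Iic.2 le_top⟩ ⟨W, Set.mem_Iic.2 le_top⟩ h s

theorem app_mem (D : TM ω ⊤ p) {q r : ZMod 2} (h : q + p = r) {s : OM ω V} (hs : s ∈ OM.part ω V q) :
    app D V s ∈ OM.part ω V r :=
  h ▸ D.2.2.1 ⟨V, Set.mem_Iic.2 le_top⟩ q s hs

theorem app_mul_of_even (D : TM ω ⊤ p) {s : OM ω V} (hs : s ∈ OM.part ω V 0) (t : OM ω V) :
    app D V (s * t) = app D V s * t + s * app D V t := by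
  refine (D.2.2.2 ⟨V, Set.mem_Iic.2 le_top⟩ 0 s hs t).trans ?_
  rw [mul_zero, ZMod.val_zero, pow_zero, one_smul]
  rfl

theorem app_mul (D : TM ω ⊤ p) {q : ZMod 2} {s : OM ω V} (hs : s ∈ OM.part ω V q) (t : OM ω V) :
    app D V (s * t) = app D V s * t + (-1 : ℂ) ^ (p * q).val • (s * app D V t) :=
  D.2.2.2 ⟨V, Set.mem_Iic.2 le_top⟩ q s hs t

theorem app_lift_mul_lift (D : TM ω ⊤ p) (hi : V ≤ chart i) (f g : O 0 V) :
    app D V (OM.lift hi (O.mul (add_zero 0) f g)) =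
      app D V (OM.lift hi f) * OM.lift hi g + OM.lift hi f * app D V (OM.lift hi g) := by
  rw [← OM.lift_mul_lift, app_mul_of_even D (OM.lift_mem_part hi f)]

theorem app_lift_mul_th1 (D : TM ω ⊤ p) (hi : V ≤ chart i) (f : O 0 V) (b : O (-1) V) :
    app D V (OM.th1 (O.mul (zero_add (-1)) f b)) =
      app D V (OM.lift hi f) * OM.th1 b + OM.lift hi f * app D V (OM.th1 b) := by
  rw [← OM.lift_mul_th1 hi, app_mul_of_even D (OM.lift_mem_part hi f)]

theorem app_lift_mul_th2 (D : TM ω ⊤ p) (hi : V ≤ chart i) (f : O 0 V) (b : O (-2) V) :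
    app D V (OM.th2 (O.mul (zero_add (-2)) f b)) =
      app D V (OM.lift hi f) * OM.th2 b + OM.lift hi f * app D V (OM.th2 b) := by
  rw [← OM.lift_mul_th2 hi, app_mul_of_even D (OM.lift_mem_part hi f)]

/-- Over a chart c θ₁θ₂ factors as (c x_i² θ₁)(x_i⁻² θ₂), so the values on the odd generators force
those on θ₁θ₂. -/
theorem app_th12 (D : TM ω ⊤ p) (hi : V ≤ chart i) (c : O (-3) V) :
    app D V (OM.th12 c) =
      app D V (OM.th1 (O.mul (by norm_num : (-3 : ℤ) + 2 = -1) c (O.Xpow i 2 hi))) *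
        OM.th2 (O.Xpow i (-2) hi) + (-1 : ℂ) ^ (p * 1).val •
      (OM.th1 (O.mul (by norm_num : (-3 : ℤ) + 2 = -1) c (O.Xpow i 2 hi)) *
        app D V (OM.th2 (O.Xpow i (-2) hi))) := by
  rw [← app_mul D (OM.th1_mem_part _), OM.th1_mul_th2 hi]
  congr 2
  refine O.ext_fn fun x hx => ?_
  have hxi : x i ≠ 0 := mem_cone_chart.1 (cone_mono hi hx)
  simp only [O.fn_mul, O.fn_Xpow _ _ hx]
  rw [mul_assoc, ← zpow_add₀ hxi]
  simp

/-- Superderivations are determined by their values on functions and odd coordinates in charts. -/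
theorem eq_zero (D : TM ω ⊤ p)
    (h0 : ∀ (i : Fin 3) (V : Opens P2) (hi : V ≤ chart i) (f : O 0 V), app D V (OM.lift hi f) = 0)
    (h1 : ∀ (i : Fin 3) (V : Opens P2) (_ : V ≤ chart i) (b : O (-1) V), app D V (OM.th1 b) = 0)
    (h2 : ∀ (i : Fin 3) (V : Opens P2) (_ : V ≤ chart i) (b : O (-2) V), app D V (OM.th2 b) = 0) :
    D = 0 := by
  refine Subtype.ext (funext fun V => LinearMap.ext fun s => ?_)
  change app D V.1 s = 0
  refine OM.ext_charts fun i => ?_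
  rw [← app_res, map_zero, OM.eq_sum inf_le_right (OM.res inf_le_left s)]
  simp only [map_add, h0, h1 i _ inf_le_right, h2 i _ inf_le_right, app_th12 D inf_le_right]
  simp

end TM

/-- A linear relation both of whose projections are injective is an isomorphism between its
domain and its range. -/
theorem nonempty_linearEquiv_of_relation {K A B : Type*} [Field K] [AddCommGroup A] [AddCommGroup B]
    [Module K A] [Module K B] (R : Submodule K (A × B)) (S : Submodule K A)
    (hS : ∀ a b, (a, b) ∈ R → a ∈ S) (hA : ∀ b, ((0 : A), b) ∈ R → b = 0)
    (hB : ∀ a, (a, (0 : B)) ∈ R → a = 0) (hA' : ∀ a ∈ S, ∃ b, (a, b) ∈ R)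
    (hB' : ∀ b, ∃ a, (a, b) ∈ R) : Nonempty (S ≃ₗ[K] B) := by
  let π₁ : R →ₗ[K] S := (LinearMap.fst K A B ∘ₗ R.subtype).codRestrict S fun r => hS _ r.1.2 r.2
  let π₂ : R →ₗ[K] B := LinearMap.snd K A B ∘ₗ R.subtype
  have h₁ : Function.Bijective π₁ := by
    refine ⟨(injective_iff_map_eq_zero π₁).2 ?_, fun a => ?_⟩
    · rintro ⟨⟨a, b⟩, h⟩ e
      obtain rfl : a = 0 := congrArg Subtype.val e
      rw [Submodule.mk_eq_zero, hA b h]; rfl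
    · obtain ⟨b, hb⟩ := hA' a a.2
      exact ⟨⟨_, hb⟩, rfl⟩
  have h₂ : Function.Bijective π₂ := by
    refine ⟨(injective_iff_map_eq_zero π₂).2 ?_, fun b => ?_⟩
    · rintro ⟨⟨a, b⟩, h⟩ (rfl : b = 0)
      rw [Submodule.mk_eq_zero, hB a h]; rfl
    · obtain ⟨a, ha⟩ := hB' b
      exact ⟨⟨_, ha⟩, rfl⟩
  exact ⟨(LinearEquiv.ofBijective π₁ h₁).symm.trans (LinearEquiv.ofBijective π₂ h₂)⟩

/-! ### The even part -/

namespace TM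

variable {ω : Z1 (-3)} {V W : Opens P2} {x : Fin 3 → ℂ} {i j : Fin 3}

/-- The relation between the data of an even superderivation and the cocycle. -/
def IsEvenDatum (ω : Z1 (-3)) (w : Fin 3 → O 1 ⊤) (α : ℂ) (Z : ∀ i, T (-3) (chart i)) : Prop :=
  ∀ (i j : Fin 3) (V : Opens P2) (hi : V ≤ chart i)
    (hj : V ≤ chart j) (f : O 0 V), (Z j).app hj f - (Z i).app hi f =
      (ω.1 i j).app (le_inf hi hj) (O.act (by norm_num : (1 : ℤ) + 0 = 0 + 1) le_top w f)
      - O.act (by norm_num : (1 : ℤ) + -3 = -3 + 1) le_top w ((ω.1 i j).app (le_inf hi hj) f)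
      - α • (ω.1 i j).app (le_inf hi hj) f

/-- The values of an even superderivation. -/
def evenFun (w : Fin 3 → O 1 ⊤) (ℓ : O 1 ⊤) (α : ℂ) (Z : ∀ i, T (-3) (chart i)) (V : Opens P2) :
    (O 0 V × O (-1) V × O (-2) V × ∀ i, O (-3) (V ⊓ chart i)) →ₗ[ℂ]
      (O 0 V × O (-1) V × O (-2) V × ∀ i, O (-3) (V ⊓ chart i)) where
  -- The weight α is carried by θ₂, hence also by θ₁θ₂. The term ℓ sends θ₂ to θ₁ and does not
  -- contribute on θ₁θ₂, since θ₁² = 0.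
  toFun s := (O.act (by norm_num) le_top w s.1,
    O.act (by norm_num) le_top w s.2.1 + O.mul (by norm_num) (O.res le_top ℓ) s.2.2.1,
    O.act (by norm_num) le_top w s.2.2.1 + α • s.2.2.1,
    fun i => (Z i).app inf_le_right (O.res inf_le_left s.1)
      + O.act (by norm_num) le_top w (s.2.2.2 i) + α • s.2.2.2 i)
  map_add' s t := by
    refine Prod.ext (map_add _ _ _) (Prod.ext ?_ (Prod.ext ?_ (funext fun i => ?_)))
    · ext x; simp; ring
    · simp; abel
    · simp; abel
  map_smul' c s := by
    refine Prod.ext (map_smul _ _ _) (Prod.ext ?_ (Prod.ext ?_ (funext fun i => ?_)))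
    · ext x; simp; ring
    · simp [smul_comm α c]
    · simp [smul_comm α c]

/-- The new θ₁θ₂-components differ by (Z_j - Z_i)(f) + w(ω_ij(f)) + α ω_ij(f). The datum equation is
precisely that this equals ω_ij(w f). -/
theorem evenFun_mem {w : Fin 3 → O 1 ⊤} {α : ℂ} {Z : ∀ i, T (-3) (chart i)} (ℓ : O 1 ⊤)
    (h : IsEvenDatum ω w α Z) (s : OM ω V) : evenFun w ℓ α Z V s.1 ∈ OMSubmodule ω V := by
  rw [mem_OMSubmodule]
  intro i j
  have hs := s.2 i j
  have hZ := h i j (V ⊓ (chart i ⊓ chart j)) (inf_le_right.trans inf_le_left)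
    (inf_le_right.trans inf_le_right) (O.res inf_le_left s.1.1)
  change _ = (ω.1 i j).app inf_le_right _ at hs
  rw [← hs] at hZ
  change _ = (ω.1 i j).app inf_le_right (O.res inf_le_left (O.act (by norm_num) le_top w s.1.1))
  rw [O.res_act, eq_comm, ← sub_eq_zero]
  rw [← sub_eq_zero] at hZ
  rw [← neg_eq_zero, ← hZ]
  simp only [evenFun, LinearMap.coe_mk, AddHom.coe_mk, map_add, map_sub, map_smul, T.res_app,
    O.res_act, O.res_res, smul_sub]
  abel

end TM

namespace OM

variable {ω : Z1 (-3)} {V W : Opens P2} {x : Fin 3 → ℂ} {i : Fin 3}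

theorem f_res (h : W ≤ V) (s : OM ω V) : (res h s).f = O.res h s.f := rfl

theorem f_mul (s t : OM ω V) : (s * t).f = O.mul (by norm_num) s.f t.f := rfl

theorem b₁_mul (s t : OM ω V) : (s * t).b₁ =
    O.mul (by norm_num) s.f t.b₁ + O.mul (by norm_num) s.b₁ t.f := rfl

theorem b₂_mul (s t : OM ω V) : (s * t).b₂ =
    O.mul (by norm_num) s.f t.b₂ + O.mul (by norm_num) s.b₂ t.f := rfl

theorem c_mul (s t : OM ω V) (i : Fin 3) : (s * t).c i =
    O.mul (zero_add (-3)) (O.res inf_le_left s.f) (t.c i)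
        + O.mul (add_zero (-3)) (s.c i) (O.res inf_le_left t.f)
        + O.res inf_le_left
          (O.mul (by norm_num) s.b₁ t.b₂ - O.mul (by norm_num) s.b₂ t.b₁) := rfl

end OM

namespace TM

variable {ω : Z1 (-3)} {V W : Opens P2} {x : Fin 3 → ℂ} {i j : Fin 3}

/-- The even superderivation with given data, over `V`. -/
def evenMap {w : Fin 3 → O 1 ⊤} {α : ℂ} {Z : ∀ i, T (-3) (chart i)} (ℓ : O 1 ⊤)
    (h : IsEvenDatum ω w α Z) (V : Opens P2) : OM ω V →ₗ[ℂ] OM ω V :=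
  (evenFun w ℓ α Z V).restrict (p := OMSubmodule ω V) (q := OMSubmodule ω V)
    fun s hs => evenFun_mem ℓ h (⟨s, hs⟩ : OM ω V)

section evenMap

variable {w : Fin 3 → O 1 ⊤} {α : ℂ} {Z : ∀ i, T (-3) (chart i)} (ℓ : O 1 ⊤)
  (h : IsEvenDatum ω w α Z) (s : OM ω V)

theorem f_evenMap : (evenMap ℓ h V s).f = O.act (by norm_num) le_top w s.f := rfl

theorem b₁_evenMap : (evenMap ℓ h V s).b₁ =
    O.act (by norm_num) le_top w s.b₁ + O.mul (by norm_num) (O.res le_top ℓ) s.b₂ := rfl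

theorem b₂_evenMap : (evenMap ℓ h V s).b₂ = O.act (by norm_num) le_top w s.b₂ + α • s.b₂ := rfl

theorem c_evenMap (i : Fin 3) : (evenMap ℓ h V s).c i =
    (Z i).app inf_le_right (O.res inf_le_left s.f)
      + O.act (by norm_num) le_top w (s.c i) + α • s.c i := rfl

end evenMap

/-- The even superderivation with given data. -/
def ofEvenDatum {w : Fin 3 → O 1 ⊤} {α : ℂ} {Z : ∀ i, T (-3) (chart i)} (ℓ : O 1 ⊤)
    (h : IsEvenDatum ω w α Z) : TM ω ⊤ 0 where
  val V := evenMap ℓ h V.1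
  property := by
    refine ⟨fun V V' hV s => ?_, fun V q s hs => ?_, fun V q s hs t => ?_⟩
    · refine OM.ext (O.res_act _ _ _ _ _).symm ?_ ?_ (funext fun i => ?_)
      · change _ = O.res hV (evenMap ℓ h V.1 s).b₁
        simp only [b₁_evenMap, map_add, O.res_mul, O.res_act, O.res_res]
        rfl
      · change _ = O.res hV (evenMap ℓ h V.1 s).b₂
        simp only [b₂_evenMap, map_add, map_smul, O.res_act]
        rfl
      · change _ = O.res (inf_le_inf_right _ hV) ((evenMap ℓ h V.1 s).c i)
        simp only [c_evenMap, map_add, map_smul, O.res_act, T.res_app, O.res_res]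
        simp only [OM.f_res, OM.res_c, O.res_res]
    · rw [add_zero]
      refine ⟨fun hq => ?_, fun hq => ?_⟩
      · obtain ⟨h1, h2⟩ := hs.1 hq
        rw [b₁_evenMap, b₂_evenMap, h1, h2]
        exact ⟨O.ext_fn fun x hx => by simp, by simp⟩
      · obtain ⟨h1, h2⟩ := hs.2 hq
        refine ⟨?_, funext fun i => ?_⟩
        · rw [f_evenMap, h1, map_zero]
        · rw [c_evenMap, h1, congrFun h2 i]
          simp
    · rw [zero_mul, ZMod.val_zero, pow_zero, one_smul]
      refine OM.ext (O.ext_fn fun x hx => ?_) (O.ext_fn fun x hx => ?_) (O.ext_fn fun x hx => ?_)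
        (funext fun i => O.ext_fn fun x hx => ?_)
      · change ((evenMap ℓ h V.1 (s * t)).f).fn x =
          ((evenMap ℓ h V.1 s * t).f + (s * evenMap ℓ h V.1 t).f).fn x
        simp only [f_evenMap, OM.f_mul, O.fn_add, O.fn_mul, O.fn_act _ _ _ _ hx,
          O.dv_mul _ _ _ _ hx, Fin.sum_univ_three]
        ring
      · change ((evenMap ℓ h V.1 (s * t)).b₁).fn x =
          ((evenMap ℓ h V.1 s * t).b₁ + (s * evenMap ℓ h V.1 t).b₁).fn x
        simp only [f_evenMap, b₁_evenMap, OM.b₁_mul, OM.b₂_mul, map_add, O.fn_add, O.fn_mul,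
          O.fn_act _ _ _ _ hx, O.dv_mul _ _ _ _ hx, Fin.sum_univ_three, O.fn_res _ _ hx]
        ring
      · change ((evenMap ℓ h V.1 (s * t)).b₂).fn x =
          ((evenMap ℓ h V.1 s * t).b₂ + (s * evenMap ℓ h V.1 t).b₂).fn x
        simp only [f_evenMap, b₂_evenMap, OM.b₂_mul, map_add, O.fn_add, O.fn_mul, O.fn_smul,
          O.fn_act _ _ _ _ hx, O.dv_mul _ _ _ _ hx, Fin.sum_univ_three]
        ring
      · change ((evenMap ℓ h V.1 (s * t)).c i).fn x =
          ((evenMap ℓ h V.1 s * t).c i + (s * evenMap ℓ h V.1 t).c i).fn x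
        have hxV := cone_mono inf_le_left hx
        simp only [f_evenMap, b₁_evenMap, b₂_evenMap, c_evenMap, OM.f_mul, OM.c_mul, O.res_mul,
          map_add, map_sub, O.fn_add, O.fn_sub, O.fn_mul, O.fn_smul, T.fn_app_mul,
          O.fn_act _ _ _ _ hx, O.fn_act _ _ _ _ hxV,
          O.dv_mul _ _ _ _ hx, O.dv_res _ _ _ hx, Fin.sum_univ_three,
          O.fn_res _ _ hx, O.fn_res _ _ hxV]
        ring

end TM

/-! ### Uniqueness and gluing of fields on the whole cone -/

theorem O.act_add_left {m k l : ℤ} {U V : Opens P2} (h : m + k = l + 1) (hV : V ≤ U)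
    (w w' : Fin 3 → O m U) (f : O k V) :
    O.act h hV (w + w') f = O.act h hV w f + O.act h hV w' f :=
  O.ext_fn fun x hx => by
    simp only [O.fn_act _ _ _ _ hx, O.fn_add, Pi.add_apply, add_mul, Finset.sum_add_distrib]

theorem O.act_smul_left {m k l : ℤ} {U V : Opens P2} (h : m + k = l + 1) (hV : V ≤ U) (c : ℂ)
    (w : Fin 3 → O m U) (f : O k V) :
    O.act h hV (c • w) f = c • O.act h hV w f :=
  O.ext_fn fun x hx => by
    simp only [O.fn_act _ _ _ _ hx, O.fn_smul, Pi.smul_apply, mul_assoc, Finset.mul_sum]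

theorem O.act_zero_left {m k l : ℤ} {U V : Opens P2} (h : m + k = l + 1) (hV : V ≤ U)
    (f : O k V) : O.act h hV (0 : Fin 3 → O m U) f = 0 :=
  O.ext_fn fun x hx => by simp [O.fn_act _ _ _ _ hx]

/-- A field on the whole cone that kills `𝒪(k)`, `k ≠ 0`, is zero. -/
theorem O.eq_zero_of_act {m k l : ℤ} (hk : k ≠ 0) (h : m + k = l + 1) (w : Fin 3 → O m ⊤)
    (hw : ∀ (i : Fin 3) (V : Opens P2) (_ : V ≤ chart i) (b : O k V), O.act h le_top w b = 0) :
    w = 0 := by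
  funext a
  refine O.ext_fn fun x hx => ?_
  obtain ⟨i, hi⟩ := exists_coord_ne_zero (ne_zero_of_mem_cone hx)
  have e := congrFun (O.act_injective hk h (le_refl (chart i)) (w := fun a => O.res le_top (w a))
    (w' := 0) fun b => by rw [O.act_res, hw i _ le_rfl, O.act_zero_left]) a
  have := congrArg (O.fn · x) e
  simpa [O.fn_res _ _ (mem_cone_chart.2 hi)] using this

/-- A section of `𝒪(m)` that kills `𝒪(k)` is zero. -/
theorem O.eq_zero_of_mul {m k l : ℤ} (h : m + k = l) (φ : O m ⊤)
    (hφ : ∀ (V : Opens P2) (b : O k V), O.mul h (O.res le_top φ) b = 0) : φ = 0 := by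
  refine O.ext_fn fun x hx => ?_
  obtain ⟨i, hi⟩ := exists_coord_ne_zero (ne_zero_of_mem_cone hx)
  have := congrArg (O.fn · x) (hφ (chart i) (O.Xpow i k le_rfl))
  simpa [O.fn_res _ _ (mem_cone_chart.2 hi), O.fn_Xpow _ _ (mem_cone_chart.2 hi), hi,
    zpow_ne_zero] using this

/-- Local fields that agree as operators on `𝒪(k)`, `k ≠ 0`, glue. -/
theorem O.exists_glue_act {m k l : ℤ} (hk : k ≠ 0) (h : m + k = l + 1)
    (w : ∀ i, Fin 3 → O m (chart i))
    (hw : ∀ (i j : Fin 3) (V : Opens P2) (hi : V ≤ chart i) (hj : V ≤ chart j) (b : O k V),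
      O.act h hi (w i) b = O.act h hj (w j) b) :
    ∃ W : Fin 3 → O m ⊤, ∀ (i : Fin 3) (V : Opens P2) (hi : V ≤ chart i) (b : O k V),
      O.act h le_top W b = O.act h hi (w i) b := by
  have hg : ∀ a, ∃ G : O m ⊤, ∀ i x, x i ≠ 0 → G.fn x = (w i a).fn x := fun a =>
    O.exists_glue_top (fun i => w i a) fun i j x hi hj => by
      have e := congrFun (O.act_injective hk h (inf_le_left : chart i ⊓ chart j ≤ chart i)
        (w := fun a => O.res inf_le_left (w i a)) (w' := fun a => O.res inf_le_right (w j a))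
        fun b => by rw [O.act_res, O.act_res, hw]) a
      have hx : x ∈ cone (chart i ⊓ chart j) := by simp [hi, hj]
      simpa [O.fn_res _ _ hx] using congrArg (O.fn · x) e
  choose W hW using hg
  refine ⟨W, fun i V hi b => O.ext_fn fun x hx => ?_⟩
  have hxi : x i ≠ 0 := mem_cone_chart.1 (cone_mono hi hx)
  simp only [O.fn_act _ _ _ _ hx, hW _ i x hxi]

/-! ### The parameters of an even superderivation -/

namespace TM

variable {ω : Z1 (-3)} {V W : Opens P2} {x : Fin 3 → ℂ} {i j : Fin 3}

/-- Even superderivations with their action on the odd coordinates. -/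
def evenRel (ω : Z1 (-3)) : Submodule ℂ (TM ω ⊤ 0 × ((Fin 3 → O 1 ⊤) × O 1 ⊤)) where
  carrier := {r | (∀ (V : Opens P2) (b : O (-1) V), OM.b1L (app r.1 V (OM.th1 b)) =
      O.act (by norm_num : (1 : ℤ) + -1 = -1 + 1) le_top r.2.1 b) ∧
    ∀ (V : Opens P2) (b : O (-2) V), OM.b1L (app r.1 V (OM.th2 b)) =
      O.mul (by norm_num : (1 : ℤ) + -2 = -1) (O.res le_top r.2.2) b}
  zero_mem' := ⟨fun V b => by simp [O.act_zero_left], fun V b => by ext x; simp⟩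
  add_mem' := by
    rintro r r' ⟨h1, h2⟩ ⟨h1', h2'⟩
    refine ⟨fun V b => ?_, fun V b => ?_⟩
    · simp only [Prod.fst_add, Prod.snd_add, app_add, map_add, h1, h1', O.act_add_left]
    · simp only [Prod.fst_add, Prod.snd_add, app_add, map_add, h2, h2']
      ext x; simp; ring
  smul_mem' := by
    rintro c r ⟨h1, h2⟩
    refine ⟨fun V b => ?_, fun V b => ?_⟩
    · simp only [Prod.smul_fst, Prod.smul_snd, app_smul, map_smul, h1, O.act_smul_left]
    · simp only [Prod.smul_fst, Prod.smul_snd, app_smul, map_smul, h2]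
      ext x; simp; ring

/-- The action of a superderivation on functions, in a chart. -/
def baseField (D : TM ω ⊤ 0) (i : Fin 3) : T 0 (chart i) :=
  T.ofMaps (fun V hi => OM.fL ∘ₗ app D V ∘ₗ OM.lift hi)
    (fun V V' hi h f => by
      simp only [LinearMap.comp_apply]
      rw [← OM.res_lift hi h, app_res, OM.fL_res])
    fun V hi f g x hx => by
      simp only [LinearMap.comp_apply]
      rw [app_lift_mul_lift, map_add, O.fn_add, OM.fL_mul, OM.fL_mul, OM.fL_lift, OM.fL_lift]
      ring

theorem app_baseField (D : TM ω ⊤ 0) (hi : V ≤ chart i) (f : O 0 V) :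
    (baseField D i).app hi f = OM.fL (app D V (OM.lift hi f)) := rfl

theorem b1L_app_lift_mul_th1 (D : TM ω ⊤ 0) (hi : V ≤ chart i) (f : O 0 V) (b : O (-1) V) :
    (OM.b1L (app D V (OM.th1 (O.mul (zero_add (-1)) f b)))).fn x =
      f.fn x * (OM.b1L (app D V (OM.th1 b))).fn x +
        ((baseField D i).app hi f).fn x * b.fn x := by
  rw [app_lift_mul_th1 D hi, map_add, O.fn_add, OM.b1L_mul, OM.b1L_mul, app_baseField]
  simp
  ring

/-- On b θ₁ the θ₁-component is a first order operator whose symbol is the action on functions. It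
is a field in each chart, and uniqueness for k = -1 glues these fields. On b θ₂ the θ₁-component is
function-linear, because D(f) is even and f D(b θ₂) alone contributes. -/
theorem exists_evenRel (D : TM ω ⊤ 0) : ∃ r, (D, r) ∈ evenRel ω := by
  have h1 : ∀ i, ∃ w : Fin 3 → O 1 (chart i), ∀ (V : Opens P2) (hi : V ≤ chart i) (b : O (-1) V),
      OM.b1L (app D V (OM.th1 b)) = O.act (by norm_num : (1 : ℤ) + -1 = -1 + 1) hi w b := fun i =>
    exists_field_of_operator (by norm_num) (zero_add 1) (by norm_num) le_rfl
      (fun V _ => OM.b1L ∘ₗ app D V ∘ₗ OM.th1)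
      (fun V V' _ h b => by
        simp only [LinearMap.comp_apply]
        rw [← OM.res_th1, app_res, OM.b1L_res])
      (baseField D i) fun V hi f b x hx => b1L_app_lift_mul_th1 D hi f b
  choose w hw using h1
  obtain ⟨W, hW⟩ := O.exists_glue_act (k := -1) (by norm_num) (by norm_num : (1 : ℤ) + -1 = -1 + 1) w fun i j V hi hj b => by
    rw [← hw i V hi, ← hw j V hj]
  obtain ⟨ℓ, hℓ⟩ := exists_mul_of_operator (by norm_num : (1 : ℤ) + -2 = -1)
    (fun V => OM.b1L ∘ₗ app D V ∘ₗ OM.th2)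
    (fun V V' h b => by
      simp only [LinearMap.comp_apply]
      rw [← OM.res_th2, app_res, OM.b1L_res])
    fun i V hi f b x hx => by
      simp only [LinearMap.comp_apply]
      rw [app_lift_mul_th2 D hi, map_add, O.fn_add, OM.b1L_mul, OM.b1L_mul,
        OM.b1L_of_mem (app_mem D (zero_add 0) (OM.lift_mem_part hi f))]
      simp
  refine ⟨(W, ℓ), fun V b => O.ext_charts fun i => ?_, hℓ⟩
  rw [← OM.b1L_res, ← app_res, OM.res_th1, hw i _ inf_le_right, ← hW, O.res_act]

/-- The only obstruction to prescribing w is that its bracket with ω be a multiple of ω in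
cohomology; the form ℓ is unobstructed. -/
theorem exists_evenRel' (ω : Z1 (-3)) (r : (Fin 3 → O 1 ⊤) × O 1 ⊤) : ∃ D, (D, r) ∈ evenRel ω := by
  obtain ⟨α, Z, h⟩ := Z1.exists_lie_primitive ω r.1
  refine ⟨ofEvenDatum r.2 (h : IsEvenDatum ω r.1 α Z), fun V b => ?_, fun V b => ?_⟩
  · refine (b₁_evenMap r.2 h (OM.th1 b)).trans ?_
    refine O.ext_fn fun x hx => ?_
    change (O.act _ le_top r.1 b + O.mul _ (O.res le_top r.2) (0 : O (-2) V) : O (-1) V).fn x = _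
    simp
  · refine (b₁_evenMap r.2 h (OM.th2 b)).trans ?_
    change (O.act _ le_top r.1 (0 : O (-1) V) + O.mul _ (O.res le_top r.2) b : O (-1) V) = _
    rw [map_zero, zero_add]

theorem evenRel_zero_left (r : (Fin 3 → O 1 ⊤) × O 1 ⊤) (h : (0, r) ∈ evenRel ω) : r = 0 :=
  Prod.ext (O.eq_zero_of_act (by norm_num) _ _ fun _ V _ b => (h.1 V b).symm)
    (O.eq_zero_of_mul _ _ fun V b => (h.2 V b).symm)

/-- The action on functions is the symbol of w, so it vanishes modulo θ₁θ₂ when w = 0. The only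
freedom left is D(b θ₂) = α b θ₂ and D(f) = Z_i(f) θ₁θ₂, tied by Z_j - Z_i = -α ω_ij. The nonzero
class forces α = 0, and then H⁰(𝒯(-3)) = 0 forces Z = 0. -/
theorem evenRel_zero_right (hω : H1.mk ω ≠ 0) (D : TM ω ⊤ 0) (h : (D, 0) ∈ evenRel ω) : D = 0 := by
  have h1 : ∀ (V : Opens P2) (b : O (-1) V), OM.b1L (app D V (OM.th1 b)) = 0 := fun V b => by
    rw [h.1 V b]; exact O.act_zero_left _ _ _
  have h2 : ∀ (V : Opens P2) (b : O (-2) V), OM.b1L (app D V (OM.th2 b)) = 0 := fun V b => by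
    rw [h.2 V b]; ext x; simp
  have hX : ∀ (i : Fin 3) (V : Opens P2) (hi : V ≤ chart i) (f : O 0 V),
      OM.fL (app D V (OM.lift hi f)) = 0 := fun i V hi f => O.ext_fn fun x hx => by
    have := b1L_app_lift_mul_th1 (x := x) D hi f (O.Xpow i (-1) hi)
    rw [h1, h1, app_baseField, O.fn_Xpow _ _ hx] at this
    have hxi : x i ≠ 0 := mem_cone_chart.1 (cone_mono hi hx)
    simpa [hxi] using this
  -- With zero symbol this is multiplication by a section of 𝒪(-1), hence zero.
  have h1' : ∀ (V : Opens P2) (b : O (-1) V), OM.b2L (app D V (OM.th1 b)) = 0 := by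
    obtain ⟨ℓ, hℓ⟩ := exists_mul_of_operator (by norm_num : (-1 : ℤ) + -1 = -2)
      (fun V => OM.b2L ∘ₗ app D V ∘ₗ OM.th1)
      (fun V V' h b => by
        simp only [LinearMap.comp_apply]
        rw [← OM.res_th1, app_res, OM.b2L_res])
      fun i V hi f b x hx => by
        simp only [LinearMap.comp_apply]
        rw [app_lift_mul_th1 D hi, map_add, O.fn_add, OM.b2L_mul, OM.b2L_mul, hX]
        simp [OM.b2L_of_mem (app_mem D (zero_add 0) (OM.lift_mem_part hi f))]
    intro V b
    refine (hℓ V b).trans ?_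
    rw [O.eq_zero_of_neg (by norm_num) ℓ]
    ext x; simp
  obtain ⟨α, h2'⟩ : ∃ α : ℂ, ∀ (V : Opens P2) (b : O (-2) V),
      OM.b2L (app D V (OM.th2 b)) = α • b := by
    obtain ⟨ℓ, hℓ⟩ := exists_mul_of_operator (by norm_num : (0 : ℤ) + -2 = -2)
      (fun V => OM.b2L ∘ₗ app D V ∘ₗ OM.th2)
      (fun V V' h b => by
        simp only [LinearMap.comp_apply]
        rw [← OM.res_th2, app_res, OM.b2L_res])
      fun i V hi f b x hx => by
        simp only [LinearMap.comp_apply]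
        rw [app_lift_mul_th2 D hi, map_add, O.fn_add, OM.b2L_mul, OM.b2L_mul, hX]
        simp
    obtain ⟨α, rfl⟩ := O.eq_smul_one ℓ
    refine ⟨α, fun V b => (hℓ V b).trans ?_⟩
    ext x; simp
  have t1 : ∀ (i : Fin 3) (V : Opens P2) (_ : V ≤ chart i) (b : O (-1) V),
      app D V (OM.th1 b) = 0 := fun i V hi b => by
    have hm := app_mem D (add_zero 1) (OM.th1_mem_part b)
    refine OM.ext_chart hi (OM.fL_of_mem hm) (h1 V b) (h1' V b) (OM.cL_of_mem hi hm)
  have t2 : ∀ (i : Fin 3) (V : Opens P2) (_ : V ≤ chart i) (b : O (-2) V),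
      app D V (OM.th2 b) = α • OM.th2 b := fun i V hi b => by
    have hm := app_mem D (add_zero 1) (OM.th2_mem_part b)
    refine OM.ext_chart hi ?_ ?_ ?_ ?_
    · rw [OM.fL_of_mem hm]; simp
    · rw [h2]; simp
    · rw [h2']; simp
    · rw [OM.cL_of_mem hi hm]; simp
  have t12 : ∀ (i : Fin 3) (V : Opens P2) (_ : V ≤ chart i) (c : O (-3) V),
      app D V (OM.th12 c) = α • OM.th12 c := fun i V hi c => by
    rw [app_th12 D hi, t1 i V hi, t2 i V hi, mul_smul_comm, OM.th1_mul_th2 hi]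
    simp only [zero_mul, zero_add, ZMod.val_zero, pow_zero, one_smul]
    congr 2
    refine O.ext_fn fun x hx => ?_
    have hxi : x i ≠ 0 := mem_cone_chart.1 (cone_mono hi hx)
    simp only [O.fn_mul, O.fn_Xpow _ _ hx]
    rw [mul_assoc, ← zpow_add₀ hxi]
    simp
  have t0 : ∀ (i : Fin 3) (V : Opens P2) (hi : V ≤ chart i) (f : O 0 V),
      app D V (OM.lift hi f) = OM.th12 (OM.cL hi (app D V (OM.lift hi f))) := fun i V hi f => by
    have hm := app_mem D (zero_add 0) (OM.lift_mem_part hi f)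
    refine OM.ext_chart hi ?_ ?_ ?_ ?_
    · rw [hX]; simp
    · rw [OM.b1L_of_mem hm]; simp
    · rw [OM.b2L_of_mem hm]; simp
    · simp
  let Z : ∀ i, T (-3) (chart i) := fun i =>
    T.ofMaps (fun V hi => OM.cL hi ∘ₗ app D V ∘ₗ OM.lift hi)
      (fun V V' hi h f => by
        simp only [LinearMap.comp_apply]
        rw [← OM.res_lift hi h, app_res, OM.cL_res hi h])
      fun V hi f g x hx => by
        simp only [LinearMap.comp_apply]
        rw [app_lift_mul_lift, map_add, O.fn_add, OM.cL_mul, OM.cL_mul]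
        simp
        ring
  have hZ : ∀ (i j : Fin 3) (V : Opens P2) (hi : V ≤ chart i) (hj : V ≤ chart j) (f : O 0 V),
      (Z j).app hj f - (Z i).app hi f = -(α • (ω.1 i j).app (le_inf hi hj) f) := by
    intro i j V hi hj f
    change OM.cL hj (app D V (OM.lift hj f)) - OM.cL hi (app D V (OM.lift hi f)) = _
    rw [OM.lift_eq_add hi hj, map_add, t12 i V hi, t0 i V hi, Z1.app_swap ω hi hj]
    simp
  have hα : α = 0 := by
    by_contra hα
    refine hω ((Submodule.Quotient.mk_eq_zero _).2 ?_)
    change ω.1 ∈ LinearMap.range (cechD0 (-3))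
    -- If α were invertible, -α⁻¹ Z would be a primitive of ω.
    refine ⟨fun i => -(α⁻¹ • Z i), funext fun i => funext fun j => T.ext_app fun V hV f => ?_⟩
    have := hZ i j V (hV.trans inf_le_left) (hV.trans inf_le_right) f
    change -(α⁻¹ • (Z j).app _ f) - -(α⁻¹ • (Z i).app _ f) = _
    rw [sub_neg_eq_add, ← sub_eq_neg_add, ← smul_sub, ← neg_sub, this, neg_neg, smul_smul,
      inv_mul_cancel₀ hα, one_smul]
  subst hα
  have hZ0 := T.eq_zero_of_compatible Z fun i j V hi hj f => by
    have := hZ i j V hi hj f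
    rw [zero_smul, neg_zero, sub_eq_zero] at this
    exact this.symm
  refine eq_zero D (fun i V hi f => ?_) t1 fun i V hi b => ?_
  · have e : (Z i).app hi f = OM.cL hi (app D V (OM.lift hi f)) := rfl
    rw [t0, ← e, hZ0, T.app_zero, map_zero]
  · rw [t2 i V hi, zero_smul]

/-- The parameters are three linear forms for w and one for ℓ: 3 · 3 + 3. -/
theorem finrank_even (hω : H1.mk ω ≠ 0) : Module.finrank ℂ (TM ω ⊤ 0) = 12 := by
  obtain ⟨e⟩ := nonempty_linearEquiv_of_relation (evenRel ω) ⊤ (fun _ _ _ => trivial)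
    evenRel_zero_left (evenRel_zero_right hω) (fun D _ => exists_evenRel D) (exists_evenRel' ω)
  rw [← finrank_top, e.finrank_eq, Module.finrank_prod, Module.finrank_pi_fintype]
  simp [O.finrank_one_top]

end TM

/-! ### The odd part -/

/-- Compatible linear maps to the sections over the charts glue. -/
theorem O.exists_glue_linear {M : Type*} [AddCommGroup M] [Module ℂ M] {k : ℤ} {V : Opens P2}
    (L : ∀ i, M →ₗ[ℂ] O k (V ⊓ chart i))
    (hL : ∀ i j m, ∀ x ∈ cone V, x i ≠ 0 → x j ≠ 0 → (L i m).fn x = (L j m).fn x) :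
    ∃ G : M →ₗ[ℂ] O k V, ∀ i m, ∀ x ∈ cone V, x i ≠ 0 → (G m).fn x = (L i m).fn x := by
  choose G hG using fun m => O.exists_glue (fun i => L i m) fun i j => hL i j m
  refine ⟨⟨⟨G, fun m n => O.ext_fn fun x hx => ?_⟩, fun c m => O.ext_fn fun x hx => ?_⟩, fun i m =>
    hG m i⟩
  all_goals obtain ⟨i, hi⟩ := exists_coord_ne_zero (ne_zero_of_mem_cone hx)
  · simp only [O.fn_add, hG _ i x hx hi, map_add]
  · simp only [O.fn_smul, hG _ i x hx hi, map_smul, RingHom.id_apply]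

/-- Multiplication by a global section. -/
def O.mulL {k l m : ℤ} {U : Opens P2} (h : k + l = m) (φ : O k ⊤) : O l U →ₗ[ℂ] O m U where
  toFun b := O.mul h (O.res le_top φ) b
  map_add' b b' := by ext x; simp; ring
  map_smul' c b := by ext x; simp; ring

@[simp]
theorem O.fn_mulL {k l m : ℤ} {U : Opens P2} (h : k + l = m) (φ : O k ⊤) (b : O l U)
    {x : Fin 3 → ℂ} (hx : x ∈ cone U) : (O.mulL h φ b).fn x = φ.fn x * b.fn x := by
  change (O.mul h (O.res le_top φ) b).fn x = _
  rw [O.fn_mul, O.fn_res _ _ hx]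

theorem O.res_mulL {k l m : ℤ} {U V : Opens P2} (h : k + l = m) (hV : V ≤ U) (φ : O k ⊤)
    (b : O l U) : O.res hV (O.mulL h φ b) = O.mulL h φ (O.res hV b) := rfl

/-- The operators `b ↦ ω_ij(φ b)` are the coboundary of the fields `q_i`. -/
def IsPrimitive (ω : Z1 (-3)) {k r s : ℤ} (hr : r + k = -3 + 1) (hs : s + k = 0) (φ : O s ⊤)
    (q : ∀ i, Fin 3 → O r (chart i)) : Prop :=
  ∀ (i j : Fin 3) (V : Opens P2) (hi : V ≤ chart i) (hj : V ≤ chart j) (b : O k V),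
    O.act hr hj (q j) b - O.act hr hi (q i) b =
      (ω.1 i j).app (le_inf hi hj) (O.mul hs (O.res le_top φ) b)

/-- Equality of symbols: compare the defining equation on x_i^k and on f x_i^k. -/
theorem IsPrimitive.sub_eq {ω : Z1 (-3)} {k r s : ℤ} {hr : r + k = -3 + 1} {hs : s + k = 0}
    {φ : O s ⊤} {q : ∀ i, Fin 3 → O r (chart i)} (h : IsPrimitive ω hr hs φ q) {i j : Fin 3}
    {V : Opens P2} (hi : V ≤ chart i) (hj : V ≤ chart j) (f : O 0 V) {x : Fin 3 → ℂ}
    (hx : x ∈ cone V) :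
    ∑ a, (q j a).fn x * f.dv a x - ∑ a, (q i a).fn x * f.dv a x =
      φ.fn x * ((ω.1 i j).app (le_inf hi hj) f).fn x := by
  have hxi : x i ≠ 0 := mem_cone_chart.1 (cone_mono hi hx)
  have h1 := congrArg (O.fn · x) (h i j V hi hj (O.Xpow i k hi))
  have h2 := congrArg (O.fn · x) (h i j V hi hj (O.mul (zero_add k) f (O.Xpow i k hi)))
  have e : O.mul hs (O.res le_top φ) (O.mul (zero_add k) f (O.Xpow i k hi)) =
      O.mul (add_zero 0) f (O.mul hs (O.res le_top φ) (O.Xpow i k hi)) :=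
    O.ext_fn fun y hy => by simp only [O.fn_mul]; ring
  simp only [e, T.fn_app_mul, O.fn_sub, O.fn_act _ _ _ _ hx, O.dv_mul _ _ _ _ hx,
    Fin.sum_univ_three, O.fn_Xpow _ _ hx, O.fn_mul, O.fn_res _ _ hx] at h1 h2
  refine mul_right_cancel₀ (zpow_ne_zero k hxi) ?_
  simp only [Fin.sum_univ_three]
  linear_combination h2 - f.fn x * h1

namespace TM

variable {ω : Z1 (-3)} {V W : Opens P2} {x : Fin 3 → ℂ} {i j : Fin 3}

/-- The linear maps with the values of an odd superderivation. -/
theorem exists_oddMap {φ₁ : O 1 ⊤} {φ₂ : O 2 ⊤} {q₁ : ∀ i, Fin 3 → O (-1) (chart i)}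
    {q₂ : ∀ i, Fin 3 → O 0 (chart i)} 
    (h₁ : IsPrimitive ω (by norm_num) (by norm_num : (1 : ℤ) + -1 = 0) φ₁ q₁)
    (h₂ : IsPrimitive ω (by norm_num) (by norm_num : (2 : ℤ) + -2 = 0) φ₂ q₂) (V : Opens P2) :
    ∃ D : OM ω V →ₗ[ℂ] OM ω V, ∀ s, ∀ x ∈ cone V,
      (D s).f.fn x = φ₁.fn x * s.b₁.fn x + φ₂.fn x * s.b₂.fn x ∧
      ∀ i, x i ≠ 0 →
        (D s).b₁.fn x = ∑ a, (q₂ i a).fn x * s.f.dv a x - φ₂.fn x * (s.c i).fn x ∧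
        (D s).b₂.fn x = φ₁.fn x * (s.c i).fn x - ∑ a, (q₁ i a).fn x * s.f.dv a x ∧
        ((D s).c i).fn x = ∑ a, (q₁ i a).fn x * s.b₁.dv a x + ∑ a, (q₂ i a).fn x * s.b₂.dv a x := by
  -- The formulas are forced by D(b θ₁) = φ₁ b + q₁(b) θ₁θ₂ and D(b θ₂) = φ₂ b + q₂(b) θ₁θ₂. The
  -- Leibniz rule gives D(f) = q₂(f) θ₁ - q₁(f) θ₂ and D(c θ₁θ₂) = -φ₂ c θ₁ + φ₁ c θ₂.
  have hc : ∀ (s : OM ω V) (i j : Fin 3) x, x ∈ cone V → x i ≠ 0 → x j ≠ 0 →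
      (s.c j).fn x - (s.c i).fn x =
        ((ω.1 i j).app inf_le_right (O.res (inf_le_left : V ⊓ (chart i ⊓ chart j) ≤ V) s.f)).fn x := by
    intro s i j x hx hi hj
    have hx' : x ∈ cone (V ⊓ (chart i ⊓ chart j)) := by simp [hx, hi, hj]
    have := congrArg (O.fn · x) (s.2 i j)
    simp only [O.fn_sub, O.fn_res _ _ hx'] at this
    exact this
  have hq : ∀ {k r t : ℤ} {hr : r + k = -3 + 1} {ht : t + k = 0}
      {φ : O t ⊤} {q : ∀ i, Fin 3 → O r (chart i)} (_ : IsPrimitive ω hr ht φ q) (s : OM ω V)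
      (i j : Fin 3) x, x ∈ cone V → x i ≠ 0 → x j ≠ 0 →
      ∑ a, (q j a).fn x * s.f.dv a x - ∑ a, (q i a).fn x * s.f.dv a x =
        φ.fn x * ((s.c j).fn x - (s.c i).fn x) := by
    intro k r t hr ht φ q h s i j x hx hi hj
    have hx' : x ∈ cone (V ⊓ (chart i ⊓ chart j)) := by simp [hx, hi, hj]
    rw [hc s i j x hx hi hj, ← h.sub_eq (inf_le_right.trans inf_le_left)
      (inf_le_right.trans inf_le_right) (O.res inf_le_left s.f) hx']
    simp only [O.dv_res _ _ _ hx']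
  let cM : ∀ i, OM ω V →ₗ[ℂ] O (-3) (V ⊓ chart i) := fun i =>
    ⟨⟨fun s => s.c i, fun _ _ => rfl⟩, fun _ _ => rfl⟩
  -- From chart i to chart j both q₂(f) and φ₂ c change by φ₂ ω_ij(f), so their difference is chart
  -- independent. The same holds for q₁ and φ₁ in the θ₂-component.
  obtain ⟨G₁, hG₁⟩ := O.exists_glue_linear (M := OM ω V) (k := -1) (V := V) (fun i =>
    O.act (by norm_num) inf_le_right (q₂ i) ∘ₗ O.res inf_le_left ∘ₗ OM.fL - O.mulL (by norm_num) φ₂ ∘ₗ cM i) (by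
      intro i j s x hx hi hj
      have hxi : x ∈ cone (V ⊓ chart i) := by simp [hx, hi]
      have hxj : x ∈ cone (V ⊓ chart j) := by simp [hx, hj]
      have := hq h₂ s i j x hx hi hj
      simp only [LinearMap.sub_apply, LinearMap.comp_apply, O.fn_sub, O.fn_mulL _ _ _ hxi,
        O.fn_mulL _ _ _ hxj, O.fn_act _ _ _ _ hxi, O.fn_act _ _ _ _ hxj, O.dv_res _ _ _ hxi,
        O.dv_res _ _ _ hxj]
      change _ - φ₂.fn x * (s.c i).fn x = _ - φ₂.fn x * (s.c j).fn x
      change ∑ a, (q₂ i a).fn x * s.f.dv a x - _ = ∑ a, (q₂ j a).fn x * s.f.dv a x - _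
      linear_combination -this)
  obtain ⟨G₂, hG₂⟩ := O.exists_glue_linear (M := OM ω V) (k := -2) (V := V) (fun i =>
    O.mulL (by norm_num) φ₁ ∘ₗ cM i - O.act (by norm_num) inf_le_right (q₁ i) ∘ₗ O.res inf_le_left ∘ₗ OM.fL) (by
      intro i j s x hx hi hj
      have hxi : x ∈ cone (V ⊓ chart i) := by simp [hx, hi]
      have hxj : x ∈ cone (V ⊓ chart j) := by simp [hx, hj]
      have := hq h₁ s i j x hx hi hj
      simp only [LinearMap.sub_apply, LinearMap.comp_apply, O.fn_sub, O.fn_mulL _ _ _ hxi,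
        O.fn_mulL _ _ _ hxj, O.fn_act _ _ _ _ hxi, O.fn_act _ _ _ _ hxj, O.dv_res _ _ _ hxi,
        O.dv_res _ _ _ hxj]
      change φ₁.fn x * (s.c i).fn x - _ = φ₁.fn x * (s.c j).fn x - _
      change _ - ∑ a, (q₁ i a).fn x * s.f.dv a x = _ - ∑ a, (q₁ j a).fn x * s.f.dv a x
      linear_combination this)
  let F : OM ω V →ₗ[ℂ] O 0 V :=
    O.mulL (by norm_num) φ₁ ∘ₗ OM.b1L + O.mulL (by norm_num) φ₂ ∘ₗ OM.b2L
  let C : ∀ i, OM ω V →ₗ[ℂ] O (-3) (V ⊓ chart i) := fun i =>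
    O.act (by norm_num) inf_le_right (q₁ i) ∘ₗ O.res inf_le_left ∘ₗ OM.b1L +
      O.act (by norm_num) inf_le_right (q₂ i) ∘ₗ O.res inf_le_left ∘ₗ OM.b2L
  -- The gluing rule for the θ₁θ₂-components is the primitive equation itself, applied to b₁ and b₂:
  -- the body of D(s) is φ₁ b₁ + φ₂ b₂.
  have hmem : ∀ s : OM ω V, (F s, G₁ s, G₂ s, fun i => C i s) ∈ OMSubmodule ω V := by
    intro s
    rw [mem_OMSubmodule]
    intro i j
    have e₁ := h₁ i j (V ⊓ (chart i ⊓ chart j)) (inf_le_right.trans inf_le_left)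
      (inf_le_right.trans inf_le_right) (O.res inf_le_left s.b₁)
    have e₂ := h₂ i j (V ⊓ (chart i ⊓ chart j)) (inf_le_right.trans inf_le_left)
      (inf_le_right.trans inf_le_right) (O.res inf_le_left s.b₂)
    change _ = (ω.1 i j).app inf_le_right (O.mulL (by norm_num) φ₁ (O.res inf_le_left s.b₁)) at e₁
    change _ = (ω.1 i j).app inf_le_right (O.mulL (by norm_num) φ₂ (O.res inf_le_left s.b₂)) at e₂
    change _ = (ω.1 i j).app inf_le_right (O.res inf_le_left
      (O.mulL (by norm_num) φ₁ s.b₁ + O.mulL (by norm_num) φ₂ s.b₂))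
    rw [map_add, O.res_mulL, O.res_mulL, map_add, ← e₁, ← e₂]
    simp only [C, LinearMap.add_apply, LinearMap.comp_apply, map_add, O.res_act, O.res_res]
    change O.act _ _ _ (O.res _ s.b₁) + O.act _ _ _ (O.res _ s.b₂) -
      (O.act _ _ _ (O.res _ s.b₁) + O.act _ _ _ (O.res _ s.b₂)) = _
    abel
  refine ⟨⟨⟨fun s => ⟨_, hmem s⟩, fun s t => ?_⟩, fun c s => ?_⟩, fun s x hx => ⟨?_, fun i hi => ?_⟩⟩
  · exact OM.ext (map_add F s t) (map_add G₁ s t) (map_add G₂ s t)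
      (funext fun i => map_add (C i) s t)
  · exact OM.ext (map_smul F c s) (map_smul G₁ c s) (map_smul G₂ c s)
      (funext fun i => map_smul (C i) c s)
  · change (F s).fn x = _
    simp only [F, LinearMap.add_apply, LinearMap.comp_apply, O.fn_add, O.fn_mulL _ _ _ hx]
    rfl
  · have hxi : x ∈ cone (V ⊓ chart i) := by simp [hx, hi]
    refine ⟨(hG₁ i s x hx hi).trans ?_, (hG₂ i s x hx hi).trans ?_, ?_⟩
    · simp only [LinearMap.sub_apply, LinearMap.comp_apply, O.fn_sub, O.fn_mulL _ _ _ hxi,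
        O.fn_act _ _ _ _ hxi, O.dv_res _ _ _ hxi]
      rfl
    · simp only [LinearMap.sub_apply, LinearMap.comp_apply, O.fn_sub, O.fn_mulL _ _ _ hxi,
        O.fn_act _ _ _ _ hxi, O.dv_res _ _ _ hxi]
      rfl
    · change (C i s).fn x = _
      simp only [C, LinearMap.add_apply, LinearMap.comp_apply, O.fn_add,
        O.fn_act _ _ _ _ hxi, O.dv_res _ _ _ hxi]
      rfl

end TM

theorem OM.b₁_res {ω : Z1 (-3)} {V W : Opens P2} (h : W ≤ V) (s : OM ω V) :
    (OM.res h s).b₁ = O.res h s.b₁ := rfl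

theorem OM.b₂_res {ω : Z1 (-3)} {V W : Opens P2} (h : W ≤ V) (s : OM ω V) :
    (OM.res h s).b₂ = O.res h s.b₂ := rfl

namespace TM

variable {ω : Z1 (-3)} {V W : Opens P2} {x : Fin 3 → ℂ} {i j : Fin 3}

theorem eq_zero_or_eq_one (q : ZMod 2) : q = 0 ∨ q = 1 := by
  revert q; decide

/-- The odd superderivation with given data. -/
theorem exists_odd {φ₁ : O 1 ⊤} {φ₂ : O 2 ⊤} {q₁ : ∀ i, Fin 3 → O (-1) (chart i)}
    {q₂ : ∀ i, Fin 3 → O 0 (chart i)}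
    (h₁ : IsPrimitive ω (by norm_num) (by norm_num : (1 : ℤ) + -1 = 0) φ₁ q₁)
    (h₂ : IsPrimitive ω (by norm_num) (by norm_num : (2 : ℤ) + -2 = 0) φ₂ q₂) :
    ∃ D : TM ω ⊤ 1, ∀ V (s : OM ω V), ∀ x ∈ cone V,
      (app D V s).f.fn x = φ₁.fn x * s.b₁.fn x + φ₂.fn x * s.b₂.fn x ∧
      ∀ i, x i ≠ 0 → ((app D V s).c i).fn x =
        ∑ a, (q₁ i a).fn x * s.b₁.dv a x + ∑ a, (q₂ i a).fn x * s.b₂.dv a x := by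
  choose E hE using fun V => exists_oddMap h₁ h₂ V
  -- Every point lies in some chart, so all four components may be compared pointwise there; the
  -- derivation identities then become polynomial.
  have key : ∀ (V : Opens P2) {s t : OM ω V}, (∀ x ∈ cone V, s.f.fn x = t.f.fn x ∧
      ∀ i, x i ≠ 0 → s.b₁.fn x = t.b₁.fn x ∧ s.b₂.fn x = t.b₂.fn x ∧
        (s.c i).fn x = (t.c i).fn x) → s = t := by
    intro V s t h
    refine OM.ext (O.ext_fn fun x hx => (h x hx).1) (O.ext_fn fun x hx => ?_)
      (O.ext_fn fun x hx => ?_) (funext fun i => O.ext_fn fun x hx => ?_)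
    · obtain ⟨i, hi⟩ := exists_coord_ne_zero (ne_zero_of_mem_cone hx)
      exact ((h x hx).2 i hi).1
    · obtain ⟨i, hi⟩ := exists_coord_ne_zero (ne_zero_of_mem_cone hx)
      exact ((h x hx).2 i hi).2.1
    · rw [mem_cone_inf, mem_cone_chart] at hx
      exact ((h x hx.1).2 i hx.2).2.2
  refine ⟨⟨fun V => E V.1, fun V V' hV s => ?_, fun V q s hs => ?_, fun V q s hs t => ?_⟩,
    fun V s x hx => ⟨(hE V s x hx).1, fun i hi => ((hE V s x hx).2 i hi).2.2⟩⟩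
  · refine key V'.1 fun x hx => ?_
    have hxV := cone_mono hV hx
    obtain ⟨e0, e⟩ := hE V.1 s x hxV
    obtain ⟨e0', e'⟩ := hE V'.1 (OM.res hV s) x hx
    refine ⟨?_, fun i hi => ?_⟩
    · change (E V'.1 (OM.res hV s)).f.fn x = (OM.res hV (E V.1 s)).f.fn x
      simp only [e0', OM.f_res, OM.b₁_res, OM.b₂_res, O.fn_res _ _ hx, e0]
    · have hxi : x ∈ cone (V'.1 ⊓ chart i) := by simp [hx, hi]
      obtain ⟨e1, e2, e3⟩ := e i hi
      obtain ⟨e1', e2', e3'⟩ := e' i hi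
      simp only [OM.f_res, OM.b₁_res, OM.b₂_res, OM.res_c, O.fn_res _ _ hxi,
        O.dv_res _ _ _ hx] at e1' e2' e3'
      change (E V'.1 (OM.res hV s)).b₁.fn x = (OM.res hV (E V.1 s)).b₁.fn x ∧
        (E V'.1 (OM.res hV s)).b₂.fn x = (OM.res hV (E V.1 s)).b₂.fn x ∧
        ((E V'.1 (OM.res hV s)).c i).fn x = ((OM.res hV (E V.1 s)).c i).fn x
      simp only [e1', e2', e3', OM.b₁_res, OM.b₂_res, OM.res_c, O.fn_res _ _ hx,
        O.fn_res _ _ hxi, e1, e2, e3, and_self]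
  · refine ⟨fun hq => ?_, fun hq => ?_⟩
    · obtain rfl | rfl := eq_zero_or_eq_one q
      · exact absurd hq (by decide)
      · obtain ⟨hf, hc⟩ := hs.2 rfl
        refine ⟨O.ext_fn fun x hx => ?_, O.ext_fn fun x hx => ?_⟩ <;>
        obtain ⟨i, hi⟩ := exists_coord_ne_zero (ne_zero_of_mem_cone hx)
        · rw [((hE V.1 s x hx).2 i hi).1, hf, congrFun hc i]
          simp [O.dv_zero]
        · rw [((hE V.1 s x hx).2 i hi).2.1, hf, congrFun hc i]
          simp [O.dv_zero]
    · obtain rfl | rfl := eq_zero_or_eq_one q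
      · obtain ⟨h1, h2⟩ := hs.1 rfl
        refine ⟨O.ext_fn fun x hx => ?_, funext fun i => O.ext_fn fun x hx => ?_⟩
        · rw [(hE V.1 s x hx).1, h1, h2]
          simp
        · rw [mem_cone_inf, mem_cone_chart] at hx
          rw [((hE V.1 s x hx.1).2 i hx.2).2.2, h1, h2]
          simp [O.dv_zero]
      · exact absurd hq (by decide)
  · refine key V.1 fun x hx => ?_
    obtain ⟨e0, e⟩ := hE V.1 s x hx
    obtain ⟨e0', e'⟩ := hE V.1 t x hx
    obtain ⟨g0, g⟩ := hE V.1 (s * t) x hx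
    have hsm : ∀ (c : ℂ) (u v : OM ω V.1), (u + c • v).f = u.f + c • v.f ∧
      (u + c • v).b₁ = u.b₁ + c • v.b₁ ∧ (u + c • v).b₂ = u.b₂ + c • v.b₂ ∧
      ∀ i, (u + c • v).c i = u.c i + c • v.c i := fun c u v => ⟨rfl, rfl, rfl, fun _ => rfl⟩
    refine ⟨?_, fun i hi => ?_⟩
    · rw [(hsm _ _ _).1, g0]
      simp only [OM.f_mul, OM.b₁_mul, OM.b₂_mul, O.fn_add, O.fn_mul, O.fn_smul, e0, e0']
      obtain rfl | rfl := eq_zero_or_eq_one q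
      · obtain ⟨h1, h2⟩ := hs.1 rfl
        simp [h1, h2]
        ring
      · obtain ⟨hf, hc⟩ := hs.2 rfl
        simp [hf]
        ring
    · have hxi : x ∈ cone (V.1 ⊓ chart i) := by simp [hx, hi]
      obtain ⟨e1, e2, e3⟩ := e i hi
      obtain ⟨e1', e2', e3'⟩ := e' i hi
      obtain ⟨g1, g2, g3⟩ := g i hi
      rw [(hsm _ _ _).2.1, (hsm _ _ _).2.2.1, (hsm _ _ _).2.2.2 i, g1, g2, g3]
      simp only [OM.f_mul, OM.b₁_mul, OM.b₂_mul, OM.c_mul, map_sub, O.fn_add, O.fn_sub, O.fn_mul,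
        O.fn_smul, O.fn_res _ _ hxi, O.dv_add _ _ _ hx, O.dv_mul _ _ _ _ hx, Fin.sum_univ_three,
        e0, e0', e1, e2, e3, e1', e2', e3']
      obtain rfl | rfl := eq_zero_or_eq_one q
      · obtain ⟨h1, h2⟩ := hs.1 rfl
        simp only [h1, h2, O.fn_zero, O.dv_zero, mul_zero, ZMod.val_zero, pow_zero]
        refine ⟨?_, ?_, ?_⟩ <;> ring
      · obtain ⟨hf, hc⟩ := hs.2 rfl
        simp only [hf, congrFun hc i, Pi.zero_apply, O.fn_zero, O.dv_zero, mul_one, ZMod.val_one,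
          pow_one]
        refine ⟨?_, ?_, ?_⟩ <;> ring

end TM

/-- Dimension count for a linear relation that is a surjective map in one direction. -/
theorem finrank_eq_of_relation {K A B : Type*} [Field K] [AddCommGroup A] [AddCommGroup B]
    [Module K A] [Module K B] [Module.Finite K B] (R : Submodule K (A × B))
    (hA : ∀ b, ((0 : A), b) ∈ R → b = 0) (hA' : ∀ a, ∃ b, (a, b) ∈ R) (hB' : ∀ b, ∃ a, (a, b) ∈ R)
    [Module.Finite K (R.comap (LinearMap.inl K A B))] :
    Module.finrank K A =
      Module.finrank K (R.comap (LinearMap.inl K A B)) + Module.finrank K B := by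
  have h₁ : Function.Bijective (LinearMap.fst K A B ∘ₗ R.subtype) := by
    refine ⟨(injective_iff_map_eq_zero _).2 ?_, fun a => ?_⟩
    · rintro ⟨⟨a, b⟩, h⟩ (rfl : a = 0)
      rw [Submodule.mk_eq_zero, hA b h]; rfl
    · obtain ⟨b, hb⟩ := hA' a
      exact ⟨⟨_, hb⟩, rfl⟩
  let e := LinearEquiv.ofBijective _ h₁
  let π : A →ₗ[K] B := LinearMap.snd K A B ∘ₗ R.subtype ∘ₗ e.symm.toLinearMap
  have hπ : ∀ a b, (a, b) ∈ R → π a = b := fun a b h => by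
    have : e.symm a = ⟨(a, b), h⟩ := e.symm_apply_eq.2 rfl
    simp [π, this]
  have hsurj : Function.Surjective π := fun b => (hB' b).imp fun a h => hπ a b h
  have hker : LinearMap.ker π = R.comap (LinearMap.inl K A B) := by
    ext a
    obtain ⟨b, hb⟩ := hA' a
    rw [LinearMap.mem_ker, hπ a b hb]
    refine ⟨fun h => by rw [h] at hb; exact hb, fun h => hA b ?_⟩
    simpa using R.sub_mem hb h
  have : Module.Finite K (LinearMap.ker π) := hker ▸ inferInstance
  rw [← hker]
  have e' := π.quotKerEquivOfSurjective hsurj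
  have := Module.Finite.equiv e'.symm
  have := Module.Finite.of_submodule_quotient (LinearMap.ker π)
  rw [← Submodule.finrank_quotient_add_finrank (LinearMap.ker π), e'.finrank_eq, add_comm]

/-- Over a subset of a chart, a superfunction vanishes if its components in that chart do. -/
theorem OM.eq_zero_of_chart {ω : Z1 (-3)} {V : Opens P2} {i : Fin 3} (hi : V ≤ chart i) {s : OM ω V}
    (hf : OM.fL s = 0) (h1 : OM.b1L s = 0) (h2 : OM.b2L s = 0) (hc : OM.cL hi s = 0) : s = 0 := by
  refine OM.ext_chart hi ?_ ?_ ?_ ?_ <;> simp only [hf, h1, h2, hc, map_zero]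

/-! ### The parameters of an odd superderivation -/

namespace TM

variable {ω : Z1 (-3)} {V W : Opens P2} {x : Fin 3 → ℂ} {i j : Fin 3}

/-- Odd superderivations with their leading coefficients. -/
def oddRel (ω : Z1 (-3)) : Submodule ℂ (TM ω ⊤ 1 × (O 1 ⊤ × O 2 ⊤)) where
  carrier := {r | (∀ (V : Opens P2) (b : O (-1) V), OM.fL (app r.1 V (OM.th1 b)) =
      O.mul (by norm_num : (1 : ℤ) + -1 = 0) (O.res le_top r.2.1) b) ∧
    ∀ (V : Opens P2) (b : O (-2) V), OM.fL (app r.1 V (OM.th2 b)) =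
      O.mul (by norm_num : (2 : ℤ) + -2 = 0) (O.res le_top r.2.2) b}
  zero_mem' := ⟨fun V b => by ext x; simp, fun V b => by ext x; simp⟩
  add_mem' := by
    rintro r r' ⟨h1, h2⟩ ⟨h1', h2'⟩
    refine ⟨fun V b => ?_, fun V b => ?_⟩
    · simp only [Prod.fst_add, Prod.snd_add, app_add, map_add, h1, h1']
      ext x; simp; ring
    · simp only [Prod.fst_add, Prod.snd_add, app_add, map_add, h2, h2']
      ext x; simp; ring
  smul_mem' := by
    rintro c r ⟨h1, h2⟩
    refine ⟨fun V b => ?_, fun V b => ?_⟩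
    · simp only [Prod.smul_fst, Prod.smul_snd, app_smul, map_smul, h1]
      ext x; simp; ring
    · simp only [Prod.smul_fst, Prod.smul_snd, app_smul, map_smul, h2]
      ext x; simp; ring

theorem oddRel_zero_left (r : O 1 ⊤ × O 2 ⊤) (h : (0, r) ∈ oddRel ω) : r = 0 :=
  Prod.ext (O.eq_zero_of_mul _ _ fun V b => (h.1 V b).symm)
    (O.eq_zero_of_mul _ _ fun V b => (h.2 V b).symm)

/-- D(f) θ has no body, so the body of D(f b θ) is f times that of D(b θ). Function-linear operators
are multiplications by global sections. -/
theorem exists_oddRel (D : TM ω ⊤ 1) : ∃ r, (D, r) ∈ oddRel ω := by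
  obtain ⟨φ₁, h1⟩ := exists_mul_of_operator (by norm_num : (1 : ℤ) + -1 = 0)
    (fun V => OM.fL ∘ₗ app D V ∘ₗ OM.th1)
    (fun V V' h b => by
      simp only [LinearMap.comp_apply]
      rw [← OM.res_th1, app_res, OM.fL_res])
    fun i V hi f b x hx => by
      simp only [LinearMap.comp_apply]
      rw [app_lift_mul_th1 D hi, map_add, O.fn_add, OM.fL_mul, OM.fL_mul]
      simp
  obtain ⟨φ₂, h2⟩ := exists_mul_of_operator (by norm_num : (2 : ℤ) + -2 = 0)
    (fun V => OM.fL ∘ₗ app D V ∘ₗ OM.th2)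
    (fun V V' h b => by
      simp only [LinearMap.comp_apply]
      rw [← OM.res_th2, app_res, OM.fL_res])
    fun i V hi f b x hx => by
      simp only [LinearMap.comp_apply]
      rw [app_lift_mul_th2 D hi, map_add, O.fn_add, OM.fL_mul, OM.fL_mul]
      simp
  exact ⟨(φ₁, φ₂), h1, h2⟩

/-- Any φ₁, φ₂ are admissible: the operators b ↦ ω_ij(φ b) on 𝒪(-1) and 𝒪(-2) have primitives, since
H¹ of 𝒪(-1) and of 𝒪 vanishes. -/
theorem exists_oddRel' (ω : Z1 (-3)) (r : O 1 ⊤ × O 2 ⊤) : ∃ D, (D, r) ∈ oddRel ω := by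
  obtain ⟨q₁, h₁⟩ := Z1.exists_primitive_mul ω (k := -1) (r := -1) (by norm_num) (by norm_num)
    (by norm_num : (1 : ℤ) + -1 = 0) r.1
  obtain ⟨q₂, h₂⟩ := Z1.exists_primitive_mul ω (k := -2) (r := 0) (by norm_num) (by norm_num)
    (by norm_num : (2 : ℤ) + -2 = 0) r.2
  obtain ⟨D, hD⟩ := exists_odd h₁ h₂
  refine ⟨D, fun V b => O.ext_fn fun x hx => ?_, fun V b => O.ext_fn fun x hx => ?_⟩
  · refine (hD V (OM.th1 b) x hx).1.trans ?_
    change r.1.fn x * b.fn x + r.2.fn x * (0 : O (-2) V).fn x = _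
    simp [O.fn_res _ _ hx]
  · refine (hD V (OM.th2 b) x hx).1.trans ?_
    change r.1.fn x * (0 : O (-1) V).fn x + r.2.fn x * b.fn x = _
    simp [O.fn_res _ _ hx]

/-- The odd superderivations without leading coefficients. -/
abbrev oddKer (ω : Z1 (-3)) : Submodule ℂ (TM ω ⊤ 1) :=
  (oddRel ω).comap (LinearMap.inl ℂ (TM ω ⊤ 1) (O 1 ⊤ × O 2 ⊤))

theorem fL_app_th1 (D : oddKer ω) (b : O (-1) V) : OM.fL (app D.1 V (OM.th1 b)) = 0 :=
  (D.2.1 V b).trans (by ext x; simp)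

theorem fL_app_th2 (D : oddKer ω) (b : O (-2) V) : OM.fL (app D.1 V (OM.th2 b)) = 0 :=
  (D.2.2 V b).trans (by ext x; simp)

/-- Odd superderivations without leading coefficients, with their action on `θ₂`. -/
def oddKerRel (ω : Z1 (-3)) : Submodule ℂ (TM ω ⊤ 1 × (Fin 3 → O 0 ⊤)) where
  carrier := {r | r.1 ∈ oddKer ω ∧ ∀ (i : Fin 3) (V : Opens P2) (hi : V ≤ chart i) (b : O (-2) V),
    OM.cL hi (app r.1 V (OM.th2 b)) =
      O.act (by norm_num : (0 : ℤ) + -2 = -3 + 1) le_top r.2 b}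
  zero_mem' := ⟨(oddKer ω).zero_mem, fun i V hi b => by simp [O.act_zero_left]⟩
  add_mem' := by
    rintro r r' ⟨hr, h⟩ ⟨hr', h'⟩
    refine ⟨(oddKer ω).add_mem hr hr', fun i V hi b => ?_⟩
    simp only [Prod.fst_add, Prod.snd_add, app_add, map_add, h i V hi, h' i V hi,
      O.act_add_left]
  smul_mem' := by
    rintro c r ⟨hr, h⟩
    refine ⟨(oddKer ω).smul_mem c hr, fun i V hi b => ?_⟩
    simp only [Prod.smul_fst, Prod.smul_snd, app_smul, map_smul, h i V hi, O.act_smul_left]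

theorem oddKerRel_zero_left (r : Fin 3 → O 0 ⊤) (h : (0, r) ∈ oddKerRel ω) : r = 0 :=
  O.eq_zero_of_act (by norm_num) _ _ fun i V hi b => (h.2 i V hi b).symm

/-- The coefficient of `θ₁` in the action of an odd superderivation on functions, in a chart. -/
def thetaField₁ (D : TM ω ⊤ 1) (i : Fin 3) : T (-1) (chart i) :=
  T.ofMaps (fun V hi => OM.b1L ∘ₗ app D V ∘ₗ OM.lift hi)
    (fun V V' hi h f => by
      simp only [LinearMap.comp_apply]
      rw [← OM.res_lift hi h, app_res, OM.b1L_res])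
    fun V hi f g x hx => by
      simp only [LinearMap.comp_apply]
      rw [app_lift_mul_lift, map_add, O.fn_add, OM.b1L_mul, OM.b1L_mul]
      simp
      ring

/-- The coefficient of `θ₂` in the action of an odd superderivation on functions, in a chart. -/
def thetaField₂ (D : TM ω ⊤ 1) (i : Fin 3) : T (-2) (chart i) :=
  T.ofMaps (fun V hi => OM.b2L ∘ₗ app D V ∘ₗ OM.lift hi)
    (fun V V' hi h f => by
      simp only [LinearMap.comp_apply]
      rw [← OM.res_lift hi h, app_res, OM.b2L_res])
    fun V hi f g x hx => by
      simp only [LinearMap.comp_apply]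
      rw [app_lift_mul_lift, map_add, O.fn_add, OM.b2L_mul, OM.b2L_mul]
      simp
      ring

/-- The symbol is minus the θ₂-component on functions, because θ₂θ₁ = -θ₁θ₂. Killing the
θ₁θ₂-components on the odd generators thus kills the action on functions as well. -/
theorem cL_app_lift_mul_th1 (D : oddKer ω) (hi : V ≤ chart i) (f : O 0 V) (b : O (-1) V) :
    (OM.cL hi (app D.1 V (OM.th1 (O.mul (zero_add (-1)) f b)))).fn x =
      f.fn x * (OM.cL hi (app D.1 V (OM.th1 b))).fn x +
        ((-thetaField₂ D.1 i).app hi f).fn x * b.fn x := by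
  have e : (-thetaField₂ D.1 i).app hi f = -OM.b2L (app D.1 V (OM.lift hi f)) := rfl
  rw [app_lift_mul_th1 D.1 hi, map_add, O.fn_add, OM.cL_mul, OM.cL_mul, fL_app_th1, e]
  simp
  ring

theorem cL_app_lift_mul_th2 (D : oddKer ω) (hi : V ≤ chart i) (f : O 0 V) (b : O (-2) V) :
    (OM.cL hi (app D.1 V (OM.th2 (O.mul (zero_add (-2)) f b)))).fn x =
      f.fn x * (OM.cL hi (app D.1 V (OM.th2 b))).fn x +
        ((thetaField₁ D.1 i).app hi f).fn x * b.fn x := by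
  have e : (thetaField₁ D.1 i).app hi f = OM.b1L (app D.1 V (OM.lift hi f)) := rfl
  rw [app_lift_mul_th2 D.1 hi, map_add, O.fn_add, OM.cL_mul, OM.cL_mul, fL_app_th2, e]
  simp
  ring

/-- The gluing alters θ₁θ₂-coefficients only through the body. -/
theorem cL_eq_of_fL_eq_zero (hi : V ≤ chart i) (hj : V ≤ chart j) {s : OM ω V} (h : OM.fL s = 0) :
    OM.cL hi s = OM.cL hj s := by
  have := OM.c_sub s hi hj
  rw [h, map_zero, sub_eq_zero] at this
  exact this.symm

/-- An operator 𝒪(-1) → 𝒪(-3) has field coefficients in 𝒪(-1). Its globality makes it vanish, so θ₁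
contributes no parameters to the kernel. -/
theorem exists_field_th1 (D : oddKer ω) : ∃ q : Fin 3 → O (-1) ⊤, ∀ (i : Fin 3) (V : Opens P2)
    (hi : V ≤ chart i) (b : O (-1) V), OM.cL hi (app D.1 V (OM.th1 b)) =
      O.act (by norm_num : (-1 : ℤ) + -1 = -3 + 1) le_top q b := by
  have h1 : ∀ i, ∃ w : Fin 3 → O (-1) (chart i), ∀ (V : Opens P2) (hi : V ≤ chart i) (b : O (-1) V),
      OM.cL hi (app D.1 V (OM.th1 b)) = O.act (by norm_num : (-1 : ℤ) + -1 = -3 + 1) hi w b :=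
    fun i => exists_field_of_operator (m := -2) (by norm_num) (by norm_num) (by norm_num) le_rfl
      (fun V hi => OM.cL hi ∘ₗ app D.1 V ∘ₗ OM.th1)
      (fun V V' hi h b => by
        simp only [LinearMap.comp_apply]
        rw [← OM.res_th1, app_res, OM.cL_res])
      (-thetaField₂ D.1 i) fun V hi f b x hx => cL_app_lift_mul_th1 D hi f b
  choose w hw using h1
  obtain ⟨q, hq⟩ := O.exists_glue_act (k := -1) (by norm_num) (by norm_num : (-1 : ℤ) + -1 = -3 + 1)
    w fun i j V hi hj b => by
      rw [← hw i V hi, ← hw j V hj]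
      exact cL_eq_of_fL_eq_zero hi hj (fL_app_th1 D b)
  exact ⟨q, fun i V hi b => (hw i V hi b).trans (hq i V hi b).symm⟩

/-- An operator 𝒪(-2) → 𝒪(-3) has field coefficients in 𝒪, so the global ones have constant
coefficients. -/
theorem exists_oddKerRel (D : oddKer ω) : ∃ r, (D.1, r) ∈ oddKerRel ω := by
  have h1 : ∀ i, ∃ w : Fin 3 → O 0 (chart i), ∀ (V : Opens P2) (hi : V ≤ chart i) (b : O (-2) V),
      OM.cL hi (app D.1 V (OM.th2 b)) = O.act (by norm_num : (0 : ℤ) + -2 = -3 + 1) hi w b :=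
    fun i => exists_field_of_operator (m := -1) (by norm_num) (by norm_num) (by norm_num) le_rfl
      (fun V hi => OM.cL hi ∘ₗ app D.1 V ∘ₗ OM.th2)
      (fun V V' hi h b => by
        simp only [LinearMap.comp_apply]
        rw [← OM.res_th2, app_res, OM.cL_res])
      (thetaField₁ D.1 i) fun V hi f b x hx => cL_app_lift_mul_th2 D hi f b
  choose w hw using h1
  obtain ⟨q, hq⟩ := O.exists_glue_act (k := -2) (by norm_num) (by norm_num : (0 : ℤ) + -2 = -3 + 1)
    w fun i j V hi hj b => by
      rw [← hw i V hi, ← hw j V hj]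
      exact cL_eq_of_fL_eq_zero hi hj (fL_app_th2 D b)
  exact ⟨q, D.2, fun i V hi b => (hw i V hi b).trans (hq i V hi b).symm⟩

/-- For φ₁ = φ₂ = 0 a primitive is a family of fields that agree as operators on overlaps;
restrictions of a global field qualify. -/
theorem exists_oddKerRel' (ω : Z1 (-3)) (r : Fin 3 → O 0 ⊤) : ∃ D, (D, r) ∈ oddKerRel ω := by
  have h₁ : IsPrimitive ω (by norm_num) (by norm_num : (1 : ℤ) + -1 = 0) 0
      (fun i => (0 : Fin 3 → O (-1) (chart i))) := fun i j V hi hj b => by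
    rw [O.act_zero_left, O.act_zero_left, sub_zero]
    refine (Eq.trans (congrArg _ ?_) (map_zero ((ω.1 i j).app (le_inf hi hj)))).symm
    ext x; simp
  have h₂ : IsPrimitive ω (by norm_num) (by norm_num : (2 : ℤ) + -2 = 0) 0
      (fun i a => O.res (le_top : chart i ≤ ⊤) (r a)) := fun i j V hi hj b => by
    rw [O.act_res, O.act_res, sub_self]
    refine (Eq.trans (congrArg _ ?_) (map_zero ((ω.1 i j).app (le_inf hi hj)))).symm
    ext x; simp
  obtain ⟨D, hD⟩ := exists_odd h₁ h₂
  refine ⟨D, ⟨fun V b => O.ext_fn fun x hx => ?_, fun V b => O.ext_fn fun x hx => ?_⟩,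
    fun i V hi b => O.ext_fn fun x hx => ?_⟩
  · refine (hD V (OM.th1 b) x hx).1.trans ?_
    simp
  · refine (hD V (OM.th2 b) x hx).1.trans ?_
    simp
  · have hxi : x i ≠ 0 := mem_cone_chart.1 (cone_mono hi hx)
    have := (hD V (OM.th2 b) x hx).2 i hxi
    change (O.res (le_inf le_rfl hi) ((app D V (OM.th2 b)).c i)).fn x = _
    rw [O.fn_res _ _ hx, this, O.fn_act _ _ _ _ hx]
    simp only [Pi.zero_apply, O.fn_zero, zero_mul, Finset.sum_const_zero, zero_add,
      O.fn_res _ _ (mem_cone_chart.2 hxi)]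
    rfl

theorem oddKerRel_zero_right (D : TM ω ⊤ 1) (h : (D, 0) ∈ oddKerRel ω) : D = 0 := by
  lift D to oddKer ω using h.1
  have c2 : ∀ (i : Fin 3) (V : Opens P2) (hi : V ≤ chart i) (b : O (-2) V),
      OM.cL hi (app D.1 V (OM.th2 b)) = 0 := fun i V hi b =>
    (h.2 i V hi b).trans (O.act_zero_left _ _ _)
  have c1 : ∀ (i : Fin 3) (V : Opens P2) (hi : V ≤ chart i) (b : O (-1) V),
      OM.cL hi (app D.1 V (OM.th1 b)) = 0 := fun i V hi b => by
    obtain ⟨q, hq⟩ := exists_field_th1 D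
    have : q = 0 := funext fun a => O.eq_zero_of_neg (by norm_num) (q a)
    rw [hq, this, O.act_zero_left]
  refine eq_zero D.1 (fun i V hi f => ?_) (fun i V hi b => ?_) fun i V hi b => ?_
  · have hm := app_mem D.1 (zero_add 1) (OM.lift_mem_part (ω := ω) hi f)
    refine OM.eq_zero_of_chart hi (OM.fL_of_mem hm) (O.ext_fn fun x hx => ?_) (O.ext_fn fun x hx => ?_)
      (OM.cL_of_mem hi hm)
    · have hxi : x i ≠ 0 := mem_cone_chart.1 (cone_mono hi hx)
      have := cL_app_lift_mul_th2 (x := x) D hi f (O.Xpow i (-2) hi)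
      rw [c2, c2, O.fn_Xpow _ _ hx] at this
      have hz : ((thetaField₁ D.1 i).app hi f).fn x = 0 := by simpa [hxi] using this
      rw [O.fn_zero]
      exact hz
    · have hxi : x i ≠ 0 := mem_cone_chart.1 (cone_mono hi hx)
      have := cL_app_lift_mul_th1 (x := x) D hi f (O.Xpow i (-1) hi)
      rw [c1, c1, O.fn_Xpow _ _ hx] at this
      have hz : ((-thetaField₂ D.1 i).app hi f).fn x = 0 := by simpa [hxi] using this
      rw [O.fn_zero]
      exact neg_eq_zero.1 ((O.fn_neg _).symm.trans hz)
  · have hm := app_mem D.1 (by decide : (1 : ZMod 2) + 1 = 0) (OM.th1_mem_part (ω := ω) b)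
    exact OM.eq_zero_of_chart hi (fL_app_th1 D b) (OM.b1L_of_mem hm) (OM.b2L_of_mem hm) (c1 i V hi b)
  · have hm := app_mem D.1 (by decide : (1 : ZMod 2) + 1 = 0) (OM.th2_mem_part (ω := ω) b)
    exact OM.eq_zero_of_chart hi (fL_app_th2 D b) (OM.b1L_of_mem hm) (OM.b2L_of_mem hm) (c2 i V hi b)

/-- The kernel gives three constants, and the bodies give a linear and a quadratic form: 3 + (3 +
6). -/
theorem finrank_odd (ω : Z1 (-3)) : Module.finrank ℂ (TM ω ⊤ 1) = 12 := by
  obtain ⟨e⟩ := nonempty_linearEquiv_of_relation (oddKerRel ω) (oddKer ω) (fun _ _ h => h.1)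
    oddKerRel_zero_left oddKerRel_zero_right (fun D hD => exists_oddKerRel ⟨D, hD⟩)
    (exists_oddKerRel' ω)
  have := Module.Finite.equiv e.symm
  rw [finrank_eq_of_relation (oddRel ω) oddRel_zero_left exists_oddRel (exists_oddRel' ω),
    e.finrank_eq, Module.finrank_prod, Module.finrank_pi_fintype]
  simp [O.finrank_zero_top, O.finrank_one_top, O.finrank_two_top]

end TM

end

end SuperP2

theorem mainTheorem1 (ω : SuperP2.Z1 (-3)) (hω : SuperP2.H1.mk ω ≠ 0) :
    Module.finrank ℂ (SuperP2.H0TM ω 0) = 12 ∧ Module.finrank ℂ (SuperP2.H0TM ω 1) = 12 := by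
  exact ⟨SuperP2.TM.finrank_even hω, SuperP2.TM.finrank_odd ω⟩
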